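/- Setting. Words are over finite alphabets. In an optimization problem $\mathcal P$ the input consists of a data part $D$ and a problem instance $P$ defined on $D$. Each such $(D,P)$ has a set of feasible solutions, which are words $y$ with a measure $\tau_{\mathcal P}(D,P,y)>0$, and at least one of them is optimum (of minimum, respectively maximum, measure); $\mathsf{opt}_{\mathcal P}(D,P)$ denotes the optimum measure. The approximation ratio of a feasible $y$ is $\max\{\tau_{\mathcal P}(D,P,y)/\mathsf{opt}_{\mathcal P}(D,P),\ \mathsf{opt}_{\mathcal P}(D,P)/\tau_{\mathcal P}(D,P,y)\}$. A random-access Turing machine (RATM) is a multi-tape Turing machine with read-only input in which every non-index tape has a binary index tape, and which can move all heads of its non-index tapes in one step to the cells given by their index tapes. A pseudo-sublinear-time $r$-approximation algorithm for $\mathcal P$ is a polynomial-time computable preprocessing function $\Pi$ together with a RATM that, for all $D$ and all instances $P$ defined on $D$, given $\Pi(D)$ and $P$ computes a feasible solution of approximation ratio at most $r$ in time $t(|D|)$, where $t(n)=o(n)$. A word function $g(x,y)$ is PsT computable if there are a polynomial-time computable $\Pi$ and a RATM that computes $g(x,y)$ from $\Pi(x)$ and $y$, for all words $x,y$, in time $t(|x|)$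 with $t(n)=o(n)$. A pseudo-sublinear-time L-reduction from $\mathcal P_1$ to $\mathcal P_2$ with parameters $\alpha,\beta$, written $\mathcal P_1\le^{\rm PsT}_L\mathcal P_2$, consists of functions $f_1,f_2$ in (log-space uniform) NC with $|f_1(D)|,|f_2(D)|=O(|D|)$ and PsT computable functions $g,h$ such that for all $D$ and all instances $P$ of $\mathcal P_1$ defined on $D$, writing $D'=f_1(D)$ and $P'=g(f_2(D),P)$: (0) $P'$ is an instance of $\mathcal P_2$ defined on $D'$, and $h(f_2(D),y)$ is a feasible solution of $\mathcal P_1$ for $(D,P)$ whenever $y$ is a feasible solution of $\mathcal P_2$ for $(D',P')$; (1) $\mathsf{opt}_{\mathcal P_2}(D',P')\le\alpha\cdot\mathsf{opt}_{\mathcal P_1}(D,P)$; (2) $|\mathsf{opt}_{\mathcal P_1}(D,P)-\tau_{\mathcal P_1}(D,P,h(f_2(D),y))|\le\beta\cdot|\mathsf{opt}_{\mathcal P_2}(D',P')-\tau_{\mathcal P_2}(D',P',y)|$ for every feasible solution $y$ of $\mathcal P_2$ for $(D',P')$. Theorem. Let $\mathcal P_1,\mathcal P_2$ be optimization problems and $\alpha,\beta,\delta\ge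 0$ real numbers. Suppose that $\mathcal P_1\le^{\rm PsT}_L\mathcal P_2$ with parameters $\alpha$ and $\beta$, and that there is a pseudo-sublinear-time $(1+\delta)$-approximation algorithm for $\mathcal P_2$. Then there is a pseudo-sublinear-time $(1+\gamma)$-approximation algorithm for $\mathcal P_1$, where $\gamma=\alpha\beta\delta$ if $\mathcal P_1$ is a minimization problem, and $\gamma=\dfrac{\alpha\beta\delta}{1-\alpha\beta\delta}$ if $\mathcal P_1$ is a maximization problem and $\alpha\beta\delta<1$. -/

import Mathlib

open Filter Asymptotics

namespace SublinearTime

/-! ### Random-access Turing machines -/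

/-- A head movement. -/
inductive Move
  | left
  | stay
  | right

/-- Effect of a movement on a head of a one-way infinite tape with cells `0, 1, 2, …`. -/
def Move.apply : Move → ℕ → ℕ
  | .left, p => p - 1
  | .stay, p => p
  | .right, p => p + 1

/-- The non-index tapes of a machine whose work tapes are named by `W`: the read-only input, which
consists of the (preprocessed) data part and the problem part, and the work tapes. -/
inductive Tape (W : Type)
  | data
  | query
  | work (w : W)

/-- What a machine does in one ordinary step: next state, symbols written on the work tapes and on
the index tapes (`none` is the blank), and head movements. -/
structure Action (Q W Γ : Type) where
  next : Q
  write : W → Option Γ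
  writeIdx : Tape W → Option Bool
  move : Tape W → Move
  moveIdx : Tape W → Move

/-- A random-access Turing machine. The two parts of the input are words over `A` and `B`, the
output is a word over `C`. Every non-index tape has its own binary index tape. Entering a state
with `isAccess` moves the heads of all non-index tapes to the cells named by their index tapes.
The machine halts when `δ` is undefined. -/
structure RATM (A B C : Type) where
  Q : Type
  [finQ : Fintype Q]
  W : Type
  [finW : Fintype W]
  Γ : Type
  [finΓ : Fintype Γ]
  /-- the work tape that carries the output -/
  outTape : W
  /-- the output alphabet is part of the work alphabet -/
  embed : C ↪ Γ
  start : Q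
  isAccess : Q → Bool
  δ : Q → Option A → Option B → (W → Option Γ) → (Tape W → Option Bool) → Option (Action Q W Γ)

/-- The number written in binary, most significant digit first, on an index tape: its digits are
the symbols before the first blank (the empty word denotes `0`). -/
noncomputable def address (t : ℕ → Option Bool) : ℕ :=
  ∑ i ∈ Finset.range (sInf {i | t i = none}),
    if t i = some true then 2 ^ (sInf {i | t i = none} - 1 - i) else 0

namespace RATM

variable {A B C : Type}

/-- Configurations: state, head positions and contents of all tapes that can change. -/
structure Cfg (M : RATM A B C) where
  state : M.Q
  head : Tape M.W → ℕ
  work : M.W → ℕ → Option M.Γ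
  idxHead : Tape M.W → ℕ
  idx : Tape M.W → ℕ → Option Bool

/-- The initial configuration: all heads on cell `0`, all work and index tapes blank. -/
def init (M : RATM A B C) : M.Cfg where
  state := M.start
  head := fun _ => 0
  work := fun _ _ => none
  idxHead := fun _ => 0
  idx := fun _ _ => none

/-- The action chosen in a configuration, on data part `x` and problem part `y`. -/
def action (M : RATM A B C) (x : List A) (y : List B) (c : M.Cfg) :
    Option (Action M.Q M.W M.Γ) :=
  M.δ c.state (x[c.head .data]?) (y[c.head .query]?) (fun w => c.work w (c.head (.work w)))
    (fun t => c.idx t (c.idxHead t))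

/-- The result of performing an action: write, move, and, if an access state is entered, jump. -/
noncomputable def perform (M : RATM A B C) (c : M.Cfg) (a : Action M.Q M.W M.Γ) : M.Cfg where
  state := a.next
  head := fun t =>
    if M.isAccess a.next then
      address (Function.update (c.idx t) (c.idxHead t) (a.writeIdx t))
    else (a.move t).apply (c.head t)
  work := fun w => Function.update (c.work w) (c.head (.work w)) (a.write w)
  idxHead := fun t => (a.moveIdx t).apply (c.idxHead t)
  idx := fun t => Function.update (c.idx t) (c.idxHead t) (a.writeIdx t)

/-- One step; `none` if the machine has halted. -/
noncomputable def step (M : RATM A B C) (x : List A) (y : List B) (c : M.Cfg) : Option M.Cfg :=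
  (M.action x y c).map (M.perform c)

/-- On data part `x` and problem part `y` the machine halts after at most `t` steps with exactly
the word `z` on its output tape. -/
def OutputsWithin (M : RATM A B C) (x : List A) (y : List B) (z : List C) (t : ℕ) : Prop :=
  ∃ n ≤ t, ∃ c : M.Cfg, (fun o : Option M.Cfg => o.bind (M.step x y))^[n] (some M.init) = some c ∧
    M.step x y c = none ∧ ∀ i, c.work M.outTape i = (z[i]?).map M.embed

end RATM

/-- `t(n) = o(n)`. -/
def IsSublinear (t : ℕ → ℕ) : Prop :=
  (fun n => (t n : ℝ)) =o[atTop] (fun n : ℕ => (n : ℝ))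

/-- A word function that a Turing machine computes in polynomial time. -/
def PTimeComputable {A B : Type} (f : List A → List B) : Prop :=
  Nonempty (Turing.TM2ComputableInPolyTime (id : List A → List A) (id : List B → List B) f)

/-- A function of a data part and a problem part that a RATM computes in time `o(n)`, where `n` is
the length of the data part, after a polynomial-time preprocessing of the data part. -/
def PsTComputable {A B C : Type} (g : List A → List B → List C) : Prop :=
  ∃ (E : Type) (_ : Fintype E) (Pi : List A → List E) (M : RATM E B C) (t : ℕ → ℕ),
    PTimeComputable Pi ∧ IsSublinear t ∧
      ∀ x y, M.OutputsWithin (Pi x) y (g x y) (t x.length)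

/-! ### The function class NC: log-space uniform circuits of polynomial size, polylogarithmic depth -/

/-- Gates of fan-in at most two. An input gate is the Boolean variable telling whether the `i`-th
input symbol is `a`; the other arguments are numbers of earlier gates. -/
inductive Gate (S : Type)
  | input (i : ℕ) (a : S)
  | const (b : Bool)
  | neg (j : ℕ)
  | conj (j k : ℕ)
  | disj (j k : ℕ)

/-- A circuit: gates in topological order, and a list of outputs, each of which is a gate number
tagged with an output symbol. -/
structure Circuit (S T : Type) where
  gates : List (Gate S)
  outputs : List (T × ℕ)

open Classical in
/-- The value of a gate on input `x`, given the list of values of the earlier gates. -/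
noncomputable def Gate.value {S : Type} (x : List S) (v : List Bool) : Gate S → Bool
  | .input i a => decide (x[i]? = some a)
  | .const b => b
  | .neg j => !(v.getD j false)
  | .conj j k => v.getD j false && v.getD k false
  | .disj j k => v.getD j false || v.getD k false

/-- The depth of a gate, given the list of depths of the earlier gates. -/
def Gate.depth {S : Type} (d : List ℕ) : Gate S → ℕ
  | .input _ _ => 0
  | .const _ => 0
  | .neg j => d.getD j 0 + 1
  | .conj j k => max (d.getD j 0) (d.getD k 0) + 1
  | .disj j k => max (d.getD j 0) (d.getD k 0) + 1

namespace Circuit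

variable {S T : Type}

/-- The values of all gates on input `x`. -/
noncomputable def values (C : Circuit S T) (x : List S) : List Bool :=
  C.gates.foldl (fun v g => v ++ [g.value x v]) []

/-- The output word: the tags of the outputs that are true, in order. (Output words may have
different lengths on inputs of the same length; the outputs that are false are padding.) -/
noncomputable def eval (C : Circuit S T) (x : List S) : List T :=
  C.outputs.filterMap fun o => if (C.values x).getD o.2 false then some o.1 else none

def size (C : Circuit S T) : ℕ := C.gates.length + C.outputs.length

def depth (C : Circuit S T) : ℕ :=
  (C.gates.foldl (fun d g => d ++ [g.depth d]) []).foldr max 0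

end Circuit

/-- The symbols used to write down circuits. -/
inductive Token (S T : Type)
  | tick
  | comma
  | input (a : S)
  | const (b : Bool)
  | neg
  | conj
  | disj
  | output (a : T)

/-- A number in unary. -/
def unary {S T : Type} (n : ℕ) : List (Token S T) := List.replicate n .tick

def Gate.encode {S T : Type} : Gate S → List (Token S T)
  | .input i a => .input a :: unary i
  | .const b => [.const b]
  | .neg j => .neg :: unary j
  | .conj j k => .conj :: (unary j ++ .comma :: unary k)
  | .disj j k => .disj :: (unary j ++ .comma :: unary k)

/-- The description of a circuit. -/
def Circuit.encode {S T : Type} (C : Circuit S T) : List (Token S T) :=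
  C.gates.flatMap Gate.encode ++ C.outputs.flatMap (fun o => .output o.1 :: unary o.2)

/-- What the head on the input `1ⁿ`, enclosed by two end markers, can see. -/
inductive Scan
  | leftEnd
  | one
  | rightEnd

/-- The symbol in cell `p` of the input tape with content `1ⁿ`. -/
def scan (n p : ℕ) : Scan :=
  if p = 0 then .leftEnd else if p ≤ n then .one else .rightEnd

/-- A Turing machine with a two-way read-only input tape with content `1ⁿ`, one work tape and a
write-only output tape. A transition gives the next state, the symbol written on the work tape, the
movements of the input head and of the work head, and possibly an output symbol. -/
structure Transducer (O : Type) where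
  Q : Type
  [finQ : Fintype Q]
  Γ : Type
  [finΓ : Fintype Γ]
  start : Q
  δ : Q → Scan → Option Γ → Option (Q × Option Γ × Move × Move × Option O)

namespace Transducer

variable {O : Type}

structure Cfg (M : Transducer O) where
  state : M.Q
  inHead : ℕ
  work : ℕ → Option M.Γ
  workHead : ℕ
  out : List O

def init (M : Transducer O) : M.Cfg where
  state := M.start
  inHead := 0
  work := fun _ => none
  workHead := 0
  out := []

/-- One step on input `1ⁿ`; the input head cannot leave the end markers. -/
def step (M : Transducer O) (n : ℕ) (c : M.Cfg) : Option M.Cfg :=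
  (M.δ c.state (scan n c.inHead) (c.work c.workHead)).map fun r =>
    { state := r.1
      inHead := min (r.2.2.1.apply c.inHead) (n + 1)
      work := Function.update c.work c.workHead r.2.1
      workHead := r.2.2.2.1.apply c.workHead
      out := c.out ++ r.2.2.2.2.toList }

/-- The configuration after `k` steps on input `1ⁿ`, if the machine has not halted before. -/
def after (M : Transducer O) (n k : ℕ) : Option M.Cfg :=
  (fun o : Option M.Cfg => o.bind (M.step n))^[k] (some M.init)

end Transducer

/-- A Turing machine maps `1ⁿ` to `F n` using only `O(log n)` cells of its work tape. -/
def LogSpaceComputable {O : Type} (F : ℕ → List O) : Prop :=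
  ∃ (M : Transducer O) (c : ℕ), ∀ n,
    (∀ k cfg, M.after n k = some cfg → cfg.workHead < c * (Nat.log 2 n + 1)) ∧
    ∃ k cfg, M.after n k = some cfg ∧ M.step n cfg = none ∧ cfg.out = F n

/-- Functions in NC: computed by a log-space uniform family of circuits of polynomial size and
polylogarithmic depth. -/
def NCComputable {S T : Type} (f : List S → List T) : Prop :=
  ∃ C : ℕ → Circuit S T,
    (∃ c k : ℕ, ∀ n, (C n).size ≤ c * (n + 1) ^ k) ∧
    (∃ c k : ℕ, ∀ n, (C n).depth ≤ c * (Nat.log 2 n + 1) ^ k) ∧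
    LogSpaceComputable (fun n => (C n).encode) ∧
    ∀ x, (C x.length).eval x = f x

/-- `|f(x)| = O(|x|)`. -/
def LinearSize {S T : Type} (f : List S → List T) : Prop :=
  ∃ c : ℕ, ∀ x, (f x).length ≤ c * (x.length + 1)

/-! ### Optimization problems, approximation and L-reductions -/

inductive Goal
  | min
  | max

/-- An optimization problem whose inputs consist of a data part `D` and a problem part `P`.
Feasible solutions are words with a positive measure, and every instance has an optimum solution. -/
structure OptProblem (S : Type) where
  goal : Goal
  /-- `P` is a problem instance defined on `D` -/
  IsInstance : List S → List S → Prop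
  /-- the feasible solutions -/
  sol : List S → List S → Set (List S)
  /-- the objective function -/
  measure : List S → List S → List S → ℝ
  measure_pos : ∀ D P, IsInstance D P → ∀ y ∈ sol D P, 0 < measure D P y
  exists_optimum : ∀ D P, IsInstance D P → ∃ y ∈ sol D P, ∀ z ∈ sol D P,
    match goal with
    | .min => measure D P y ≤ measure D P z
    | .max => measure D P z ≤ measure D P y

namespace OptProblem

variable {S : Type}

/-- The measure of an optimum solution. -/
noncomputable def opt (X : OptProblem S) (D P : List S) : ℝ :=
  match X.goal with
  | .min => sInf (X.measure D P '' X.sol D P)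
  | .max => sSup (X.measure D P '' X.sol D P)

/-- The approximation ratio of a feasible solution. -/
noncomputable def ratio (X : OptProblem S) (D P y : List S) : ℝ :=
  max (X.measure D P y / X.opt D P) (X.opt D P / X.measure D P y)

/-- There is a pseudo-sublinear-time `r`-approximation algorithm: a polynomial-time preprocessing
of the data part, and a RATM that, from the preprocessed data part and the problem part of any
instance, computes in time `o(|D|)` a feasible solution of approximation ratio at most `r`. -/
def HasPsTApprox (X : OptProblem S) (r : ℝ) : Prop :=
  ∃ (E : Type) (_ : Fintype E) (Pi : List S → List E) (M : RATM E S S) (t : ℕ → ℕ),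
    PTimeComputable Pi ∧ IsSublinear t ∧
      ∀ D P, X.IsInstance D P →
        ∃ y ∈ X.sol D P, M.OutputsWithin (Pi D) P y (t D.length) ∧ X.ratio D P y ≤ r

end OptProblem

/-- Pseudo-sublinear-time L-reducibility of `X` to `Y` with parameters `α` and `β`. -/
def PsTLReducible {S T : Type} (X : OptProblem S) (Y : OptProblem T) (α β : ℝ) : Prop :=
  ∃ (A : Type) (_ : Fintype A) (f₁ : List S → List T) (f₂ : List S → List A)
    (g : List A → List S → List T) (h : List A → List T → List S),
    NCComputable f₁ ∧ LinearSize f₁ ∧ NCComputable f₂ ∧ LinearSize f₂ ∧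
    PsTComputable g ∧ PsTComputable h ∧
    ∀ D P, X.IsInstance D P →
      Y.IsInstance (f₁ D) (g (f₂ D) P) ∧
      Y.opt (f₁ D) (g (f₂ D) P) ≤ α * X.opt D P ∧
      ∀ y ∈ Y.sol (f₁ D) (g (f₂ D) P),
        h (f₂ D) y ∈ X.sol D P ∧
        |X.opt D P - X.measure D P (h (f₂ D) y)| ≤
          β * |Y.opt (f₁ D) (g (f₂ D) P) - Y.measure (f₁ D) (g (f₂ D) P) y|

end SublinearTime

namespace SublinearTime

/-! ### Structured programs over stacks -/

/-! The algorithm for the source problem computes `P' = g (f₂ D) P`, runs the given algorithm for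
the target on `f₁ D` and `P'` to obtain `y`, and returns `h (f₂ D) y`. A ratio of at most `1 + δ`
bounds the absolute error of `y` by `δ` times the target optimum
(`OptProblem.abs_opt_sub_measure_le`). The L-reduction multiplies this error by at most `β` and
relates the optima by `α`, so the result is off by at most `ε = α * β * δ` times the source optimum.
For minimization this means `measure ≤ (1 + ε) * opt`. For maximization it means `measure ≥ (1 - ε)
* opt`, and `1 / (1 - ε) = 1 + ε / (1 - ε)`.

Most of the work shows that this is a pseudo-sublinear-time algorithm in the given machine models.
There are three points.

The preprocessing writes three words on parallel tracks: those belonging to `g` and `h`, computed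
from `f₂ D`, and that of the target algorithm, computed from `f₁ D`. Polynomial time must therefore
be closed under composition and pairing, and NC must be contained in P. Closure is proved for the
structured language `Prog`, which is translated to and from stack machines
(`PolyTimeOn.pTimeComputable`, `PTimeComputable.polyTimeOn`). For NC (`NCComputable.polyTimeOn`), a
halting log-space machine runs for polynomially many steps since it cannot repeat a configuration;
it is simulated to write down the circuit, which is then evaluated in one pass over its description.

Random-access machines must be composable with linear overhead (`RATM.OutputsWithin.comp`). The
output tape of the first machine serves as the problem part of the second. A unary clock, kept while
the first machine runs, measures how far its index tapes have to be rewound and erased.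

The running times are `o` of `|f₁ D|` and `|f₂ D|`, which are `O(|D|)`; taking the maximum over all
lengths in question keeps the bound sublinear (`IsSublinear.maxTime`). -/

/-- Structured programs that act on stacks over the alphabets `Γ k` and on a memory `σ`. -/
inductive Prog {K : Type} (Γ : K → Type) (σ : Type) : Type 1
  | push (k : K) (f : σ → Option (Γ k))
  | peek (k : K) (f : σ → Option (Γ k) → σ)
  | pop (k : K) (f : σ → Option (Γ k) → σ)
  | load (f : σ → σ)
  | seq (p q : Prog Γ σ)
  | switch {ι : Type} [Fintype ι] (f : σ → ι) (p : ι → Prog Γ σ)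
  | loop (b : σ → Bool) (p : Prog Γ σ)

namespace Prog

variable {K : Type} {Γ : K → Type} {σ : Type}

/-- The contents of all stacks. -/
abbrev Stacks (Γ : K → Type) : Type := ∀ k, List (Γ k)

/-! ### Timed execution and weakest preconditions. -/

section Semantics

variable [DecidableEq K]

/-- `Exec p v S v' S' n`: started with memory `v` and stacks `S`, the program `p` ends after `n`
steps with memory `v'` and stacks `S'`. -/
inductive Exec : Prog Γ σ → σ → Stacks Γ → σ → Stacks Γ → ℕ → Prop
  | push {k f v S} : Exec (.push k f) v S v (Function.update S k ((f v).toList ++ S k)) 1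
  | peek {k f v S} : Exec (.peek k f) v S (f v (S k).head?) S 1
  | pop {k f v S} : Exec (.pop k f) v S (f v (S k).head?) (Function.update S k (S k).tail) 1
  | load {f v S} : Exec (.load f) v S (f v) S 1
  | seq {p q v S v' S' v'' S'' m n} : Exec p v S v' S' m → Exec q v' S' v'' S'' n →
      Exec (.seq p q) v S v'' S'' (m + n)
  | switch {ι : Type} {_ : Fintype ι} {f : σ → ι} {p : ι → Prog Γ σ} {v S v' S' n} :
      Exec (p (f v)) v S v' S' n → Exec (.switch f p) v S v' S' (n + 1)
  | loop_done {b p v S} : b v = false → Exec (.loop b p) v S v S 1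
  | loop_step {b p v S v' S' v'' S'' m n} : b v = true → Exec p v S v' S' m →
      Exec (.loop b p) v' S' v'' S'' n → Exec (.loop b p) v S v'' S'' (m + n + 1)

/-- Started with memory `v` and stacks `S` at time `t`, the program ends in a situation that
satisfies `Q`. -/
def wp (p : Prog Γ σ) (Q : σ → Stacks Γ → ℕ → Prop) (v : σ) (S : Stacks Γ) (t : ℕ) : Prop :=
  ∃ v' S' n, Exec p v S v' S' n ∧ Q v' S' (t + n)

variable {Q Q' : σ → Stacks Γ → ℕ → Prop} {v : σ} {S : Stacks Γ} {t : ℕ}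

theorem wp.mono {p : Prog Γ σ} (h : wp p Q v S t) (hQ : ∀ v S t, Q v S t → Q' v S t) :
    wp p Q' v S t :=
  let ⟨v', S', n, h₁, h₂⟩ := h
  ⟨v', S', n, h₁, hQ _ _ _ h₂⟩

theorem wp_push {k : K} {f : σ → Option (Γ k)} :
    wp (.push k f) Q v S t ↔ Q v (Function.update S k ((f v).toList ++ S k)) (t + 1) :=
  ⟨fun ⟨_, _, _, h, hQ⟩ => by cases h; exact hQ, fun h => ⟨_, _, _, .push, h⟩⟩

theorem wp_peek {k : K} {f : σ → Option (Γ k) → σ} :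
    wp (.peek k f) Q v S t ↔ Q (f v (S k).head?) S (t + 1) :=
  ⟨fun ⟨_, _, _, h, hQ⟩ => by cases h; exact hQ, fun h => ⟨_, _, _, .peek, h⟩⟩

theorem wp_pop {k : K} {f : σ → Option (Γ k) → σ} :
    wp (.pop k f) Q v S t ↔ Q (f v (S k).head?) (Function.update S k (S k).tail) (t + 1) :=
  ⟨fun ⟨_, _, _, h, hQ⟩ => by cases h; exact hQ, fun h => ⟨_, _, _, .pop, h⟩⟩

theorem wp_load {f : σ → σ} : wp (.load f) Q v S t ↔ Q (f v) S (t + 1) :=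
  ⟨fun ⟨_, _, _, h, hQ⟩ => by cases h; exact hQ, fun h => ⟨_, _, _, .load, h⟩⟩

theorem wp_seq {p q : Prog Γ σ} : wp (.seq p q) Q v S t ↔ wp p (wp q Q) v S t := by
  constructor
  · rintro ⟨v', S', n, h, hQ⟩
    cases h with
    | seq h₁ h₂ => exact ⟨_, _, _, h₁, _, _, _, h₂, by rwa [add_assoc]⟩
  · rintro ⟨v', S', n, h₁, v'', S'', m, h₂, hQ⟩
    exact ⟨_, _, _, h₁.seq h₂, by rwa [← add_assoc]⟩

theorem wp_switch {ι : Type} [Fintype ι] {f : σ → ι} {p : ι → Prog Γ σ} :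
    wp (.switch f p) Q v S t ↔ wp (p (f v)) Q v S (t + 1) := by
  constructor
  · rintro ⟨v', S', n, h, hQ⟩
    cases h with
    | switch h => exact ⟨_, _, _, h, by rwa [add_assoc, add_comm 1]⟩
  · rintro ⟨v', S', n, h, hQ⟩
    exact ⟨_, _, _, .switch h, by rwa [add_comm n 1, ← add_assoc]⟩

/-- Only one test is unrolled, so termination is always supplied by an induction at the place of
use. The final, failing test costs a step too. -/
theorem wp_loop {b : σ → Bool} {p : Prog Γ σ} :
    wp (.loop b p) Q v S t ↔
      if b v then wp p (wp (.loop b p) Q) v S (t + 1) else Q v S (t + 1) := by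
  constructor
  · rintro ⟨v', S', n, h, hQ⟩
    cases h with
    | loop_done hb => simpa [hb] using hQ
    | @loop_step _ _ _ _ _ _ _ _ m n hb h₁ h₂ =>
      rw [if_pos hb]
      exact ⟨_, _, _, h₁, _, _, _, h₂, by rwa [show t + 1 + m + n = t + (m + n + 1) by ring]⟩
  · intro h
    split_ifs at h with hb
    · obtain ⟨v', S', m, h₁, v'', S'', n, h₂, hQ⟩ := h
      exact ⟨_, _, _, .loop_step hb h₁ h₂,
        by rwa [show t + (m + n + 1) = t + 1 + m + n by ring]⟩
    · exact ⟨_, _, _, .loop_done (by simpa using hb), h⟩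

end Semantics

/-! ### Compilation to stack machines -/

/-- The program points of a program. -/
def Lab : Prog Γ σ → Type
  | .push _ _ => Unit
  | .peek _ _ => Unit
  | .pop _ _ => Unit
  | .load _ => Unit
  | .seq p q => Lab p ⊕ Lab q
  | @Prog.switch _ _ _ ι _ _ p => Option (Σ i : ι, Lab (p i))
  | .loop _ p => Option (Lab p)

theorem finite_lab (p : Prog Γ σ) : Finite (Lab p) := by
  induction p with
  | push | peek | pop | load => exact inferInstanceAs (Finite Unit)
  | seq p q hp hq => exact inferInstanceAs (Finite (Lab p ⊕ Lab q))
  | @switch ι _ f p hp => exact inferInstanceAs (Finite (Option (Σ i : ι, Lab (p i))))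
  | loop b p hp => exact inferInstanceAs (Finite (Option (Lab p)))

/-- The program point at which a program starts. -/
def entry : (p : Prog Γ σ) → Lab p
  | .push _ _ => ()
  | .peek _ _ => ()
  | .pop _ _ => ()
  | .load _ => ()
  | .seq p _ => .inl (entry p)
  | @Prog.switch _ _ _ _ _ _ _ => none
  | .loop _ _ => none

open Classical in
/-- The statements of a stack machine that runs a program and then goes to the label `exit`. The
program points of the program are identified with labels by `emb`. -/
noncomputable def code {Λ : Type} :
    (p : Prog Γ σ) → (Lab p → Λ) → Λ → Lab p → Turing.TM2.Stmt Γ Λ σ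
  | .push k f, _, exit, _ =>
    if h : Nonempty (Γ k) then
      .branch (fun v => (f v).isSome)
        (.push k (fun v => (f v).getD h.some) (.goto fun _ => exit)) (.goto fun _ => exit)
    else .goto fun _ => exit
  | .peek k f, _, exit, _ => .peek k f (.goto fun _ => exit)
  | .pop k f, _, exit, _ => .pop k f (.goto fun _ => exit)
  | .load f, _, exit, _ => .load f (.goto fun _ => exit)
  | .seq p _, emb, _, .inl l => code p (emb ∘ .inl) (emb (.inr (entry _))) l
  | .seq _ q, emb, exit, .inr l => code q (emb ∘ .inr) exit l
  | @Prog.switch _ _ _ _ _ f _, emb, _, none =>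
    .goto fun v => emb (some ⟨f v, entry _⟩)
  | @Prog.switch _ _ _ _ _ _ p, emb, exit, some ⟨i, l⟩ =>
    code (p i) (fun l => emb (some ⟨i, l⟩)) exit l
  | .loop b p, emb, exit, none =>
    .branch b (.goto fun _ => emb (some (entry p))) (.goto fun _ => exit)
  | .loop _ p, emb, _, some l => code p (fun l => emb (some l)) (emb none) l

/-! ### Correctness of the compilation. -/

section Machines

variable [DecidableEq K]

/-- Every elementary instruction, switch and loop test owns one label, so the machine takes exactly
the counted number of steps. The exit label and the embedding of labels are arbitrary because
subprograms are compiled with different ones: a loop body exits to the label of the test. -/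
theorem Exec.iterate_step {Λ : Type} {m : Λ → Turing.TM2.Stmt Γ Λ σ} {p : Prog Γ σ}
    {v v' : σ} {S S' : Stacks Γ} {n : ℕ} (h : Exec p v S v' S' n) (emb : Lab p → Λ) (exit : Λ)
    (hm : ∀ l, m (emb l) = code p emb exit l) :
    (flip Bind.bind (Turing.TM2.step m))^[n] (some ⟨some (emb (entry p)), v, S⟩) =
      some ⟨some exit, v', S'⟩ := by
  have first (p : Prog Γ σ) (v : σ) (S : Stacks Γ) (emb : Lab p → Λ) (exit : Λ)
      (hm : ∀ l, m (emb l) = code p emb exit l) :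
      flip Bind.bind (Turing.TM2.step m) (some ⟨some (emb (entry p)), v, S⟩) =
        some (Turing.TM2.stepAux (code p emb exit (entry p)) v S) := by
    simp [flip, hm]
  induction h generalizing exit with
  | @push k f v S =>
    rw [Function.iterate_one, first _ _ _ _ _ hm]
    -- A stack machine must push some symbol for every memory, so `code` uses an arbitrary one
    -- behind a branch. Over an empty alphabet `f v` can only be `none`.
    by_cases hk : Nonempty (Γ k)
    · cases hf : f v <;> simp [code, hk, hf]
    · have : f v = none := by
        cases hf : f v with
        | none => rfl
        | some a => exact absurd ⟨a⟩ hk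
      simp [code, hk, this]
  | peek => rw [Function.iterate_one, first _ _ _ _ _ hm]; simp [code]
  | pop => rw [Function.iterate_one, first _ _ _ _ _ hm]; simp [code]
  | load => rw [Function.iterate_one, first _ _ _ _ _ hm]; simp [code]
  | @seq p q v S v' S' v'' S'' m n h₁ h₂ ih₁ ih₂ =>
    rw [add_comm, Function.iterate_add_apply]
    refine Eq.trans (congrArg _ (ih₁ (fun l => emb (.inl l)) (emb (.inr (entry q)))
      fun l => hm (.inl l))) ?_
    exact ih₂ (fun l => emb (.inr l)) exit fun l => hm (.inr l)
  | @switch ι _ f p v S v' S' n h ih =>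
    rw [Function.iterate_succ_apply, first _ _ _ _ _ hm]
    exact ih (fun l => emb (some ⟨_, l⟩)) exit fun l => hm (some ⟨_, l⟩)
  | loop_done hb => rw [Function.iterate_one, first _ _ _ _ _ hm]; simp [entry, code, hb]
  | @loop_step b p v S v' S' v'' S'' _ n hb h₁ h₂ ih₁ ih₂ =>
    rw [add_right_comm, add_comm, Function.iterate_add_apply, Function.iterate_succ_apply,
      first _ _ _ _ _ hm]
    simp only [entry, code, Turing.TM2.stepAux, hb, cond_true]
    rw [ih₁ (fun l => emb (some l)) (emb none) fun l => hm (some l)]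
    exact ih₂ emb exit hm

/-! ### Stack machines as programs -/

/-- The program that executes a statement of a stack machine. The memory also contains the label of
the next statement. -/
def ofStmt {Λ : Type} : Turing.TM2.Stmt Γ Λ σ → Prog Γ (Option Λ × σ)
  | .push k f q => .seq (.push k fun v => some (f v.2)) (ofStmt q)
  | .peek k f q => .seq (.peek k fun v a => (v.1, f v.2 a)) (ofStmt q)
  | .pop k f q => .seq (.pop k fun v a => (v.1, f v.2 a)) (ofStmt q)
  | .load f q => .seq (.load fun v => (v.1, f v.2)) (ofStmt q)
  | .branch f p q => .switch (fun v => f v.2) fun b => cond b (ofStmt p) (ofStmt q)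
  | .goto l => .load fun v => (some (l v.2), v.2)
  | .halt => .load fun v => (none, v.2)

/-- An upper bound for the number of steps of `ofStmt q`. -/
def stmtCost {Λ : Type} : Turing.TM2.Stmt Γ Λ σ → ℕ
  | .push _ _ q => stmtCost q + 1
  | .peek _ _ q => stmtCost q + 1
  | .pop _ _ q => stmtCost q + 1
  | .load _ q => stmtCost q + 1
  | .branch _ p q => max (stmtCost p) (stmtCost q) + 1
  | .goto _ => 1
  | .halt => 1

/-- One step of a stack machine runs a whole statement. A statement branches but never loops, so
structural induction bounds its cost. -/
theorem wp_ofStmt {Λ : Type} (q : Turing.TM2.Stmt Γ Λ σ) (l : Option Λ) (v : σ) (S : Stacks Γ)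
    (t : ℕ) : wp (ofStmt q) (fun w S' t' => w.1 = (Turing.TM2.stepAux q v S).l ∧
      w.2 = (Turing.TM2.stepAux q v S).var ∧ S' = (Turing.TM2.stepAux q v S).stk ∧
      t' ≤ t + stmtCost q) (l, v) S t := by
  induction q generalizing v S t with
  | push k f q ih =>
    simp only [ofStmt, wp_seq, wp_push, Turing.TM2.stepAux, stmtCost]
    exact (ih _ _ _).mono fun _ _ _ h => ⟨h.1, h.2.1, h.2.2.1, by omega⟩
  | peek k f q ih =>
    simp only [ofStmt, wp_seq, wp_peek, Turing.TM2.stepAux, stmtCost]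
    exact (ih _ _ _).mono fun _ _ _ h => ⟨h.1, h.2.1, h.2.2.1, by omega⟩
  | pop k f q ih =>
    simp only [ofStmt, wp_seq, wp_pop, Turing.TM2.stepAux, stmtCost]
    exact (ih _ _ _).mono fun _ _ _ h => ⟨h.1, h.2.1, h.2.2.1, by omega⟩
  | load f q ih =>
    simp only [ofStmt, wp_seq, wp_load, Turing.TM2.stepAux, stmtCost]
    exact (ih _ _ _).mono fun _ _ _ h => ⟨h.1, h.2.1, h.2.2.1, by omega⟩
  | branch f p q ihp ihq =>
    simp only [ofStmt, wp_switch, Turing.TM2.stepAux, stmtCost]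
    cases f v
    · exact (ihq _ _ _).mono fun _ _ _ h => ⟨h.1, h.2.1, h.2.2.1, by omega⟩
    · exact (ihp _ _ _).mono fun _ _ _ h => ⟨h.1, h.2.1, h.2.2.1, by omega⟩
  | goto l => simp [ofStmt, wp_load, stmtCost]
  | halt => simp [ofStmt, wp_load, stmtCost]

/-- The program that runs a stack machine from the label stored in the memory. -/
def ofMachine {Λ : Type} [Fintype Λ] (m : Λ → Turing.TM2.Stmt Γ Λ σ) : Prog Γ (Option Λ × σ) :=
  .loop (fun v => v.1.isSome) <|
    .switch Prod.fst fun l : Option Λ => l.elim (.load id) fun l => ofStmt (m l)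

/-- Each step costs at most `N` for the statement, plus two for the loop test and the dispatch on
the label. The last unit is for the test that finds the label `none`. -/
theorem wp_ofMachine {Λ : Type} [Fintype Λ] (m : Λ → Turing.TM2.Stmt Γ Λ σ) {N : ℕ}
    (hN : ∀ l, stmtCost (m l) ≤ N) (n : ℕ) (l : Option Λ) (v : σ) (S : Stacks Γ) (t : ℕ)
    {v' : σ} {S' : Stacks Γ}
    (h : (flip Bind.bind (Turing.TM2.step m))^[n] (some ⟨l, v, S⟩) = some ⟨none, v', S'⟩) :
    wp (ofMachine m) (fun w T t' => w = (none, v') ∧ T = S' ∧ t' ≤ t + n * (N + 2) + 1)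
      (l, v) S t := by
  induction n generalizing l v S t with
  | zero =>
    simp only [Function.iterate_zero, id_eq, Option.some.injEq, Turing.TM2.Cfg.mk.injEq] at h
    obtain ⟨rfl, rfl, rfl⟩ := h
    rw [ofMachine, wp_loop]
    simp
  | succ n ih =>
    rw [Function.iterate_succ_apply] at h
    cases l with
    | none =>
      exfalso
      have h₀ : ∀ n, (flip Bind.bind (Turing.TM2.step m))^[n] none = none := fun n => by
        induction n with
        | zero => rfl
        | succ n ih => rw [Function.iterate_succ_apply]; exact ih
      have h₁ : flip Bind.bind (Turing.TM2.step m) (some ⟨none, v, S⟩) = none := rfl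
      rw [h₁, h₀] at h
      cases h
    | some l =>
      rw [ofMachine, wp_loop]
      simp only [Option.isSome_some, if_true, wp_switch, Option.elim_some]
      refine (wp_ofStmt (m l) (some l) v S _).mono ?_
      rintro ⟨w₁, w₂⟩ T t' ⟨h₁, h₂, h₃, h₄⟩
      have h₅ : flip Bind.bind (Turing.TM2.step m) (some ⟨some l, v, S⟩) =
          some ⟨w₁, w₂, T⟩ := by
        simp only at h₁ h₂
        rw [h₁, h₂, h₃]; rfl
      rw [h₅] at h
      refine (ih _ _ _ t' h).mono ?_
      rintro w T t'' ⟨h₆, h₇, h₈⟩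
      refine ⟨h₆, h₇, ?_⟩
      have := hN l
      rw [add_mul]
      omega

end Machines

/-! ### Programs on more stacks -/

/-- A program on the stacks `i k` only, with memory `σ`, as a program on all stacks with a memory
that contains an additional part. -/
def lift {K' σ' τ : Type} (Γ' : K' → Type) (i : K → K') (e : σ' ≃ σ × τ) :
    Prog (fun k => Γ' (i k)) σ → Prog Γ' σ'
  | .push k f => .push (i k) fun v => f (e v).1
  | .peek k f => .peek (i k) fun v a => e.symm (f (e v).1 a, (e v).2)
  | .pop k f => .pop (i k) fun v a => e.symm (f (e v).1 a, (e v).2)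
  | .load f => .load fun v => e.symm (f (e v).1, (e v).2)
  | .seq p q => .seq (lift Γ' i e p) (lift Γ' i e q)
  | @Prog.switch _ _ _ _ _ f p => .switch (fun v => f (e v).1) fun j => lift Γ' i e (p j)
  | .loop b p => .loop (fun v => b (e v).1) (lift Γ' i e p)

/-- The stacks `i k` are replaced by the stacks `T`. -/
noncomputable def overwrite {K' : Type} {Γ' : K' → Type} (i : K → K') (S : Stacks Γ')
    (T : Stacks fun k => Γ' (i k)) : Stacks Γ' := by
  classical
  exact fun k' => if h : ∃ k, i k = k' then h.choose_spec ▸ T h.choose else S k'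

section Overwrite

variable {K' : Type} {Γ' : K' → Type} {i : K → K'}

theorem overwrite_apply (hi : Function.Injective i) (S : Stacks Γ')
    (T : Stacks fun k => Γ' (i k)) (k : K) : overwrite i S T (i k) = T k := by
  have h : ∃ j, i j = i k := ⟨k, rfl⟩
  rw [overwrite, dif_pos h]
  -- The chosen preimage equals `k` only propositionally, so the cast is removed after generalizing
  -- over it.
  have aux : ∀ (j : K) (hj : j = k) (e : i j = i k), (e ▸ T j : List (Γ' (i k))) = T k := by
    rintro j rfl e; rfl
  exact aux _ (hi h.choose_spec) _

theorem overwrite_of_notMem (S : Stacks Γ') (T : Stacks fun k => Γ' (i k)) {k' : K'}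
    (h : ∀ k, i k ≠ k') : overwrite i S T k' = S k' := by
  rw [overwrite, dif_neg (by simpa using h)]

theorem overwrite_self (hi : Function.Injective i) (S : Stacks Γ') :
    overwrite i S (fun k => S (i k)) = S := by
  funext k'
  by_cases h : ∃ k, i k = k'
  · obtain ⟨k, rfl⟩ := h
    rw [overwrite_apply hi]
  · exact overwrite_of_notMem _ _ (by simpa using h)

theorem overwrite_update [DecidableEq K] [DecidableEq K'] (hi : Function.Injective i) (S : Stacks Γ')
    (T : Stacks fun k => Γ' (i k)) (k : K) (l : List (Γ' (i k))) :
    Function.update (overwrite i S T) (i k) l = overwrite i S (Function.update T k l) := by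
  funext k'
  by_cases h : ∃ j, i j = k'
  · obtain ⟨j, rfl⟩ := h
    rw [overwrite_apply hi]
    by_cases hj : j = k
    · subst hj; simp
    · rw [Function.update_of_ne hj, Function.update_of_ne (fun h => hj (hi h)),
        overwrite_apply hi]
  · have h' : ∀ j, i j ≠ k' := by simpa using h
    rw [overwrite_of_notMem _ _ h', Function.update_of_ne (h' k).symm, overwrite_of_notMem _ _ h']

end Overwrite

/-- A frame rule: the lifted program touches only the stacks in the range of `i` and the first part
of the memory, at the same cost. -/
theorem Exec.lift {K' σ' τ : Type} [DecidableEq K] [DecidableEq K'] {Γ' : K' → Type} {i : K → K'}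
    (hi : Function.Injective i) (e : σ' ≃ σ × τ) {p : Prog (fun k => Γ' (i k)) σ} {v v' : σ}
    {T T' : Stacks fun k => Γ' (i k)} {n : ℕ} (h : Exec p v T v' T' n) (w : τ) (S : Stacks Γ') :
    Exec (lift Γ' i e p) (e.symm (v, w)) (overwrite i S T) (e.symm (v', w)) (overwrite i S T') n := by
  induction h with
  | @push k f v T =>
    have := Exec.push (k := i k) (f := fun v => f (e v).1) (v := e.symm (v, w))
      (S := overwrite i S T)
    simpa [Prog.lift, overwrite_apply hi, overwrite_update hi] using this
  | @peek k f v T =>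
    have := Exec.peek (k := i k) (f := fun v a => e.symm (f (e v).1 a, (e v).2))
      (v := e.symm (v, w)) (S := overwrite i S T)
    simpa [Prog.lift, overwrite_apply hi, overwrite_update hi] using this
  | @pop k f v T =>
    have := Exec.pop (k := i k) (f := fun v a => e.symm (f (e v).1 a, (e v).2))
      (v := e.symm (v, w)) (S := overwrite i S T)
    simpa [Prog.lift, overwrite_apply hi, overwrite_update hi] using this
  | @load f v T =>
    have := Exec.load (f := fun v => e.symm (f (e v).1, (e v).2))
      (v := e.symm (v, w)) (S := overwrite i S T)
    simpa [Prog.lift] using this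
  | seq _ _ ih₁ ih₂ => exact ih₁.seq ih₂
  | @switch ι _ f p v T v' T' n h ih =>
    refine Exec.switch (f := fun v => f (e v).1) ?_
    simpa using ih
  | @loop_done b p v S hb =>
    exact Exec.loop_done (b := fun v => b (e v).1) (by simpa using hb)
  | @loop_step b p v S v' S' v'' S'' m n hb _ _ ih₁ ih₂ =>
    exact Exec.loop_step (b := fun v => b (e v).1) (by simpa using hb) ih₁ ih₂

end Prog

/-! ### Iteration over a stack, and calls of programs on other stacks. -/

namespace Prog

variable {K : Type} {Γ : K → Type} {σ : Type} [DecidableEq K]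

/-- The stack `k` has content `l`, all other stacks are empty. -/
def single (k : K) (l : List (Γ k)) : Stacks Γ := Function.update (fun _ => []) k l

@[simp] theorem single_self (k : K) (l : List (Γ k)) : single k l k = l := by simp [single]

theorem single_of_ne {k k' : K} (h : k' ≠ k) (l : List (Γ k)) : single k l k' = [] := by
  simp [single, h]

@[simp] theorem update_single (k : K) (l l' : List (Γ k)) :
    Function.update (single k l) k l' = single k l' := by
  simp [single]

@[simp] theorem single_nil (k : K) : single (Γ := Γ) k [] = fun _ => [] := by
  simp [single]

theorem update_empty (k : K) (l : List (Γ k)) :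
    Function.update (fun _ => [] : Stacks Γ) k l = single k l := rfl

/-- Runs `body` for all symbols of a stack, from the top to the bottom; each symbol is put into the
memory by `set` after it has been removed from the stack. -/
def forEach (k : K) (set : Option (Γ k) → σ → σ) (b : σ → Bool) (body : Prog Γ σ) : Prog Γ σ :=
  .seq (.pop k fun v a => set a v) (.loop b (.seq body (.pop k fun v a => set a v)))

variable {Q : σ → Stacks Γ → ℕ → Prop} {v : σ} {S : Stacks Γ} {t : ℕ}

theorem wp_forEach_nil {k : K} {set : Option (Γ k) → σ → σ} {b : σ → Bool} {body : Prog Γ σ}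
    (hb : b (set none v) = false) (hS : S k = []) (hQ : Q (set none v) S (t + 2)) :
    wp (forEach k set b body) Q v S t := by
  rw [forEach, wp_seq, wp_pop, wp_loop]
  have : Function.update S k [] = S := by rw [← hS, Function.update_eq_self]
  simpa [hS, hb, this] using hQ

/-- The pop that ends the loop body, together with the rest of the loop, is again a `forEach`; hence
the induction runs on the content of the stack alone. The two steps are the pop and the test. -/
theorem wp_forEach_cons {k : K} {set : Option (Γ k) → σ → σ} {b : σ → Bool} {body : Prog Γ σ}
    {a : Γ k} {l : List (Γ k)} (hb : b (set (some a) v) = true) (hS : S k = a :: l)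
    (hQ : wp body (wp (forEach k set b body) Q) (set (some a) v) (Function.update S k l) (t + 2)) :
    wp (forEach k set b body) Q v S t := by
  rw [forEach, wp_seq, wp_pop, wp_loop]
  simp only [hS, List.head?_cons, hb, if_true, List.tail_cons, wp_seq]
  exact hQ.mono fun v S t h => by rwa [forEach, wp_seq] at h

/-- Moves a stack to another stack; the order of the symbols is reversed. -/
def move (k k' : K) (set : Option (Γ k) → σ → σ) (b : σ → Bool) (out : σ → Option (Γ k')) :
    Prog Γ σ :=
  forEach k set b (.push k' out)

/-- Each symbol costs a pop, a test and a push. Since `set` overwrites its earlier effect, the final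
memory does not depend on the symbols seen. With `conv` constantly `none` the program just empties a
stack. -/
theorem wp_move {k k' : K} {set : Option (Γ k) → σ → σ} {b : σ → Bool} {out : σ → Option (Γ k')}
    (hk : k ≠ k') (conv : Γ k → Option (Γ k')) (hb : ∀ a v, b (set a v) = a.isSome)
    (hset : ∀ a a' v, set a (set a' v) = set a v)
    (hout : ∀ a v, out (set (some a) v) = conv a)
    (hQ : Q (set none v) (Function.update (Function.update S k []) k'
      (((S k).filterMap conv).reverse ++ S k')) (t + (3 * (S k).length + 2))) :
    wp (move k k' set b out) Q v S t := by
  obtain ⟨l, hl⟩ : ∃ l, S k = l := ⟨_, rfl⟩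
  induction l generalizing v S t with
  | nil =>
    refine wp_forEach_nil (by simp [hb]) hl ?_
    have h : Function.update S k [] = S := by rw [← hl, Function.update_eq_self]
    simpa [hl, h] using hQ
  | cons a l ih =>
    refine wp_forEach_cons (by simp [hb]) hl ?_
    rw [wp_push]
    refine ih ?_ ?_
    · rw [hset, hout, Function.update_of_ne hk, Function.update_self,
        Function.update_of_ne hk.symm, Function.update_self, Function.update_comm hk.symm,
        Function.update_idem, Function.update_idem]
      rw [hl] at hQ
      have h₁ : t + 2 + 1 + (3 * l.length + 2) = t + (3 * (a :: l).length + 2) := by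
        rw [List.length_cons]; ring
      have h₂ : (l.filterMap conv).reverse ++ ((conv a).toList ++ S k') =
          ((a :: l).filterMap conv).reverse ++ S k' := by
        cases h : conv a <;> simp [h]
      rwa [h₁, h₂]
    · rw [Function.update_of_ne hk, Function.update_self]

/-- The form in which a subprogram is called: execution does not depend on the starting time, so a
bound proved from time `0` is added to the current time. -/
theorem wp_lift {K' σ' τ : Type} [DecidableEq K'] {Γ' : K' → Type} {i : K → K'}
    (hi : Function.Injective i) (e : σ' ≃ σ × τ) {p : Prog (fun k => Γ' (i k)) σ} {v v' : σ}
    {T T' : Stacks fun k => Γ' (i k)} {n : ℕ} {w : τ} {S : Stacks Γ'} {t : ℕ}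
    (h : wp p (fun a b c => a = v' ∧ b = T' ∧ c ≤ n) v T 0) {w' : σ'} (hw : w' = e.symm (v, w))
    (hS : ∀ k, S (i k) = T k) {Q : σ' → Stacks Γ' → ℕ → Prop}
    (hQ : ∀ t' ≤ t + n, Q (e.symm (v', w)) (overwrite i S T') t') :
    wp (lift Γ' i e p) Q w' S t := by
  obtain ⟨_, _, m, h, rfl, rfl, hm⟩ := h
  refine ⟨_, _, m, ?_, hQ _ (by omega)⟩
  have := h.lift hi e w S
  have h₀ : overwrite i S T = S := by
    rw [show T = fun k => S (i k) from funext fun k => (hS k).symm, overwrite_self hi]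
  rwa [h₀, ← hw] at this

end Prog

open Prog

/-! ### Machines that compute word functions -/

/-- A program with designated stacks for input and output and with an initial memory. -/
structure Machine (A B : Type) : Type 1 where
  K : Type
  [decK : DecidableEq K]
  [finK : Fintype K]
  k₀ : K
  k₁ : K
  Γ : K → Type
  eA : Γ k₀ ≃ A
  eB : Γ k₁ ≃ B
  σ : Type
  [finσ : Fintype σ]
  init : σ
  prog : Prog Γ σ

attribute [instance] Machine.decK Machine.finK Machine.finσ

/-- On input `u` the machine ends within time `T` with output `v`, with its initial memory, and
with all other stacks empty. -/
def Machine.Outputs {A B : Type} (M : Machine A B) (u : List A) (v : List B) (T : ℕ) : Prop :=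
  wp M.prog (fun w S t => w = M.init ∧ S = single M.k₁ (v.map M.eB.symm) ∧ t ≤ T) M.init
    (single M.k₀ (u.map M.eA.symm)) 0

/-- The words `b x` can be computed from the words `a x` in time polynomial in `sz x`. -/
def PolyTimeOn {X A B : Type} (sz : X → ℕ) (a : X → List A) (b : X → List B) : Prop :=
  ∃ (M : Machine A B) (p : Polynomial ℕ), ∀ x, M.Outputs (a x) (b x) (p.eval (sz x))

theorem eval_mono (p : Polynomial ℕ) : Monotone fun n => p.eval n := by
  intro m n h
  simp only [Polynomial.eval_eq_sum, Polynomial.sum]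
  gcongr

theorem Machine.Outputs.mono {A B : Type} {M : Machine A B} {u : List A} {v : List B} {T T' : ℕ}
    (h : M.Outputs u v T) (hT : T ≤ T') : M.Outputs u v T' :=
  wp.mono h fun _ _ _ h => ⟨h.1, h.2.1, h.2.2.trans hT⟩

/-- The additional label `none` carries the halt statement and accounts for the one extra step.
`Machine.Outputs` already demands the final memory and stacks that a halted machine has to show. -/
theorem PolyTimeOn.pTimeComputable {A B : Type} [Fintype A] {f : List A → List B}
    (h : PolyTimeOn List.length id f) : PTimeComputable f := by
  classical
  obtain ⟨M, p, h⟩ := h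
  have hfin := finite_lab M.prog
  let tm : Turing.FinTM2 :=
    { K := M.K
      k₀ := M.k₀
      k₁ := M.k₁
      Γ := M.Γ
      Λ := Option (Lab M.prog)
      main := some (entry M.prog)
      ΛFin := Fintype.ofFinite _
      σ := M.σ
      initialState := M.init
      Γk₀Fin := Fintype.ofEquiv A M.eA.symm
      m := fun l => l.elim .halt (code M.prog some none) }
  have hinit (k : M.K) (l : List (M.Γ k)) : (fun k' => @dite (List (M.Γ k')) (k' = k)
      (M.decK k' k) (fun h => by rw [h]; exact l) fun _ => []) = single k l := by
    funext k'
    by_cases hk : k' = k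
    · subst hk; simp
    · simp [hk, single_of_ne]
  refine ⟨{ tm := tm, inputAlphabet := M.eA, outputAlphabet := M.eB, time := p + 1,
            outputsFun := fun a => Classical.choice ?_ }⟩
  obtain ⟨_, _, n, hex, rfl, rfl, hn⟩ := h a
  have := hex.iterate_step (m := tm.m) some none fun l => rfl
  refine ⟨⟨⟨n + 1, ?_⟩, by simpa using hn⟩⟩
  rw [add_comm, Function.iterate_add_apply, Function.iterate_one]
  have h₀ : Turing.initList tm (List.map M.eA.invFun (id a)) =
      ⟨some (some (entry M.prog)), M.init, single M.k₀ (List.map M.eA.symm a)⟩ := by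
    rw [← hinit]; rfl
  have h₁ : Option.map (Turing.haltList tm) (some (List.map M.eB.invFun (id (f a)))) =
      some ⟨none, M.init, single M.k₁ (List.map M.eB.symm (f a))⟩ := by
    rw [← hinit]; rfl
  rw [h₀]
  refine Eq.trans (congrArg _ this) (Eq.trans ?_ h₁.symm)
  rfl

/-- The size is measured in a parameter `x` rather than in the input word, so that time bounds of
successive stages all refer to the original input. There are finitely many statements, whence a
common cost bound `N`. -/
theorem PTimeComputable.polyTimeOn {A B X : Type} {f : List A → List B} (h : PTimeComputable f)
    {sz : X → ℕ} {a : X → List A} (q : Polynomial ℕ) (hq : ∀ x, (a x).length ≤ q.eval (sz x)) :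
    PolyTimeOn sz a fun x => f (a x) := by
  obtain ⟨⟨⟨tm, e₀, e₁⟩, p, hf⟩⟩ := h
  let _ := tm.ΛFin
  let _ := tm.kFin
  let _ := tm.σFin
  have hinit (k : tm.K) (l : List (tm.Γ k)) : (fun k' => @dite (List (tm.Γ k')) (k' = k)
      (tm.kDecidableEq k' k) (fun h => by rw [h]; exact l) fun _ => []) = single k l := by
    funext k'
    by_cases hk : k' = k
    · subst hk; simp
    · simp [hk, single_of_ne]
  obtain ⟨N, hN⟩ : ∃ N, ∀ l, stmtCost (tm.m l) ≤ N :=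
    ⟨Finset.univ.sup fun l => stmtCost (tm.m l), fun l =>
      Finset.le_sup (f := fun l => stmtCost (tm.m l)) (Finset.mem_univ l)⟩
  let M : Machine A B :=
    { K := tm.K
      k₀ := tm.k₀
      k₁ := tm.k₁
      Γ := tm.Γ
      eA := e₀
      eB := e₁
      σ := Option tm.Λ × tm.σ
      init := (none, tm.initialState)
      prog := .seq (.load fun v => (some tm.main, v.2)) (ofMachine tm.m) }
  refine ⟨M, p.comp q * Polynomial.C (N + 2) + 2, fun x => ?_⟩
  obtain ⟨⟨n, hn⟩, hle⟩ := hf (a x)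
  have h₀ : Turing.initList tm (List.map e₀.invFun (id (a x))) =
      ⟨some tm.main, tm.initialState, single tm.k₀ (List.map e₀.symm (a x))⟩ := by
    rw [← hinit]; rfl
  have h₁ : Option.map (Turing.haltList tm) (some (List.map e₁.invFun (id (f (a x))))) =
      some ⟨none, tm.initialState, single tm.k₁ (List.map e₁.symm (f (a x)))⟩ := by
    rw [← hinit]; rfl
  rw [h₁, h₀] at hn
  rw [Machine.Outputs, wp_seq, wp_load]
  refine (wp_ofMachine tm.m hN n _ _ _ _ hn).mono ?_
  rintro w T t' ⟨rfl, rfl, ht⟩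
  refine ⟨rfl, rfl, ht.trans ?_⟩
  have : n ≤ p.eval (q.eval (sz x)) := hle.trans (eval_mono p (hq x))
  have := Nat.mul_le_mul_right (N + 2) this
  simp only [Polynomial.eval_add, Polynomial.eval_mul, Polynomial.eval_comp, Polynomial.eval_C,
    Polynomial.eval_ofNat]
  omega

open Prog

/-! ### Closure properties of polynomial-time computability -/

section Triple

variable {K₁ K₂ K₃ : Type} {Γ₁ : K₁ → Type} {Γ₂ : K₂ → Type} {Γ₃ : K₃ → Type}

/-- The alphabets of three groups of stacks. -/
@[reducible] def triΓ (Γ₁ : K₁ → Type) (Γ₂ : K₂ → Type) (Γ₃ : K₃ → Type) : K₁ ⊕ K₂ ⊕ K₃ → Type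
  | .inl k => Γ₁ k
  | .inr (.inl k) => Γ₂ k
  | .inr (.inr k) => Γ₃ k

/-- The contents of three groups of stacks. -/
def tri (S₁ : Stacks Γ₁) (S₂ : Stacks Γ₂) (S₃ : Stacks Γ₃) : Stacks (triΓ Γ₁ Γ₂ Γ₃)
  | .inl k => S₁ k
  | .inr (.inl k) => S₂ k
  | .inr (.inr k) => S₃ k

variable {S₁ T₁ : Stacks Γ₁} {S₂ T₂ : Stacks Γ₂} {S₃ : Stacks Γ₃}

@[simp] theorem tri_one (k : K₁) : tri S₁ S₂ S₃ (.inl k) = S₁ k := rfl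
@[simp] theorem tri_two (k : K₂) : tri S₁ S₂ S₃ (.inr (.inl k)) = S₂ k := rfl
@[simp] theorem tri_three (k : K₃) : tri S₁ S₂ S₃ (.inr (.inr k)) = S₃ k := rfl

theorem overwrite_tri_one :
    overwrite (Γ' := triΓ Γ₁ Γ₂ Γ₃) Sum.inl (tri S₁ S₂ S₃) T₁ = tri T₁ S₂ S₃ := by
  funext k
  rcases k with k | k | k
  · exact overwrite_apply (Γ' := triΓ Γ₁ Γ₂ Γ₃) Sum.inl_injective _ _ k
  all_goals exact overwrite_of_notMem _ _ (by simp)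

theorem inr_inl_injective : Function.Injective (fun k : K₂ => (.inr (.inl k) : K₁ ⊕ K₂ ⊕ K₃)) :=
  fun a b h => by simpa using h

theorem overwrite_tri_two : overwrite (Γ' := triΓ Γ₁ Γ₂ Γ₃) (fun k => .inr (.inl k))
    (tri S₁ S₂ S₃) T₂ = tri S₁ T₂ S₃ := by
  funext k
  rcases k with k | k | k
  · exact overwrite_of_notMem _ _ (by simp)
  · exact overwrite_apply (Γ' := triΓ Γ₁ Γ₂ Γ₃) inr_inl_injective _ _ k
  · exact overwrite_of_notMem _ _ (by simp)

variable [DecidableEq K₁] [DecidableEq K₂] [DecidableEq K₃]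

@[simp] theorem update_tri_one (k : K₁) (l : List (Γ₁ k)) :
    Function.update (tri S₁ S₂ S₃) (.inl k) l = tri (Function.update S₁ k l) S₂ S₃ := by
  funext j
  rcases j with j | j | j
  · by_cases h : j = k
    · subst h; simp
    · rw [Function.update_of_ne (by simpa using h)]
      simp [h]
  all_goals simp

@[simp] theorem update_tri_two (k : K₂) (l : List (Γ₂ k)) :
    Function.update (tri S₁ S₂ S₃) (.inr (.inl k)) l = tri S₁ (Function.update S₂ k l) S₃ := by
  funext j
  rcases j with j | j | j
  · simp
  · by_cases h : j = k
    · subst h; simp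
    · rw [Function.update_of_ne (by simpa using h)]
      simp [h]
  · simp

@[simp] theorem update_tri_three (k : K₃) (l : List (Γ₃ k)) :
    Function.update (tri S₁ S₂ S₃) (.inr (.inr k)) l = tri S₁ S₂ (Function.update S₃ k l) := by
  funext j
  rcases j with j | j | j
  · simp
  · simp
  · by_cases h : j = k
    · subst h; simp
    · rw [Function.update_of_ne (by simpa using h)]
      simp [h]

theorem single_tri_one (k : K₁) (l : List (Γ₁ k)) :
    (single (.inl k) l : Stacks (triΓ Γ₁ Γ₂ Γ₃)) =
      tri (single k l) (fun _ => []) (fun _ => []) := by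
  have : (fun _ => [] : Stacks (triΓ Γ₁ Γ₂ Γ₃)) =
    tri (fun _ => []) (fun _ => []) (fun _ => []) := by
    funext j; rcases j with j | j | j <;> rfl
  rw [single, this]
  exact update_tri_one k l

theorem single_tri_two (k : K₂) (l : List (Γ₂ k)) :
    (single (.inr (.inl k)) l : Stacks (triΓ Γ₁ Γ₂ Γ₃)) =
      tri (fun _ => []) (single k l) (fun _ => []) := by
  have : (fun _ => [] : Stacks (triΓ Γ₁ Γ₂ Γ₃)) =
    tri (fun _ => []) (fun _ => []) (fun _ => []) := by
    funext j; rcases j with j | j | j <;> rfl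
  rw [single, this]
  exact update_tri_two k l

theorem single_tri_three (k : K₃) (l : List (Γ₃ k)) :
    (single (.inr (.inr k)) l : Stacks (triΓ Γ₁ Γ₂ Γ₃)) =
      tri (fun _ => []) (fun _ => []) (single k l) := by
  have : (fun _ => [] : Stacks (triΓ Γ₁ Γ₂ Γ₃)) =
    tri (fun _ => []) (fun _ => []) (fun _ => []) := by
    funext j; rcases j with j | j | j <;> rfl
  rw [single, this]
  exact update_tri_three k l

end Triple

/-- A memory that contains the memories of two machines and a third part. -/
def swapFirst (α β γ : Type) : α × β × γ ≃ β × α × γ where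
  toFun v := (v.2.1, v.1, v.2.2)
  invFun v := (v.2.1, v.1, v.2.2)
  left_inv _ := rfl
  right_inv _ := rfl

variable {A B C X : Type}

section Call

variable {K₁ K₂ K₃ : Type} [DecidableEq K₁] [DecidableEq K₂] [DecidableEq K₃]
  {Γ₁ : K₁ → Type} {Γ₂ : K₂ → Type} {Γ₃ : K₃ → Type} {α ρ : Type}

theorem Machine.Outputs.wp_one {M : Machine A B} {u : List A} {v : List B}
    {T : ℕ} (h : M.Outputs u v T) {S₂ : Stacks Γ₂} {S₃ : Stacks Γ₃} {w : ρ} {t : ℕ}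
    {Q : M.σ × ρ → Stacks (triΓ M.Γ Γ₂ Γ₃) → ℕ → Prop}
    (hQ : ∀ t' ≤ t + T, Q (M.init, w) (tri (single M.k₁ (v.map M.eB.symm)) S₂ S₃) t') :
    wp (lift (triΓ M.Γ Γ₂ Γ₃) Sum.inl (Equiv.refl _) M.prog) Q (M.init, w)
      (tri (single M.k₀ (u.map M.eA.symm)) S₂ S₃) t := by
  refine wp_lift (Γ' := triΓ M.Γ Γ₂ Γ₃) Sum.inl_injective _ h (w := w) rfl (fun _ => rfl) ?_
  intro t' ht
  have := hQ t' ht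
  rwa [← overwrite_tri_one] at this

theorem Machine.Outputs.wp_two {M : Machine A B} {u : List A} {v : List B}
    {T : ℕ} (h : M.Outputs u v T) {S₁ : Stacks Γ₁} {S₃ : Stacks Γ₃} {x : α} {w : ρ} {t : ℕ}
    {Q : α × M.σ × ρ → Stacks (triΓ Γ₁ M.Γ Γ₃) → ℕ → Prop}
    (hQ : ∀ t' ≤ t + T, Q (x, M.init, w) (tri S₁ (single M.k₁ (v.map M.eB.symm)) S₃) t') :
    wp (lift (triΓ Γ₁ M.Γ Γ₃) (fun k => .inr (.inl k)) (swapFirst α M.σ ρ) M.prog) Q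
      (x, M.init, w) (tri S₁ (single M.k₀ (u.map M.eA.symm)) S₃) t := by
  refine wp_lift (Γ' := triΓ Γ₁ M.Γ Γ₃) inr_inl_injective _ h (w := (x, w)) rfl (fun _ => rfl) ?_
  intro t' ht
  have := hQ t' ht
  rwa [← overwrite_tri_two] at this

end Call

/-- Runs `M` and then `N` on the output of `M`. -/
def Machine.comp [Fintype B] (M : Machine A B) (N : Machine B C) : Machine A C where
  K := M.K ⊕ N.K ⊕ Unit
  k₀ := .inl M.k₀
  k₁ := .inr (.inl N.k₁)
  Γ := triΓ M.Γ N.Γ fun _ => B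
  eA := M.eA
  eB := N.eB
  σ := M.σ × N.σ × Option B
  init := (M.init, N.init, none)
  prog := .seq (lift (triΓ M.Γ N.Γ fun _ => B) Sum.inl (Equiv.refl _) M.prog) <|
    .seq (move (.inl M.k₁) (.inr (.inr ())) (fun a v => (v.1, v.2.1, a.map M.eB))
      (fun v => v.2.2.isSome) fun v => v.2.2) <|
    .seq (move (.inr (.inr ())) (.inr (.inl N.k₀)) (fun a v => (v.1, v.2.1, a))
      (fun v => v.2.2.isSome) fun v => v.2.2.map N.eA.symm) <|
    lift (triΓ M.Γ N.Γ fun _ => B) (fun k => .inr (.inl k)) (swapFirst M.σ N.σ _) N.prog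

theorem filterMap_some_comp {α β : Type} (f : α → β) (l : List α) :
    l.filterMap (fun a => some (f a)) = l.map f := by
  induction l <;> simp_all

/-- The intermediate word passes through an auxiliary stack, because each move reverses it; the two
moves cost `3 * v.length + 2` each. -/
theorem Machine.Outputs.comp [Fintype B] {M : Machine A B} {N : Machine B C} {u : List A}
    {v : List B} {w : List C} {T T' : ℕ} (h : M.Outputs u v T) (h' : N.Outputs v w T') :
    (M.comp N).Outputs u w (T + T' + 6 * v.length + 4) := by
  rw [Machine.Outputs, Machine.comp, single_tri_one, wp_seq]
  refine h.wp_one fun t₁ ht₁ => ?_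
  rw [wp_seq]
  refine wp_move (by simp) (fun a => some (M.eB a)) (by simp) (by simp) (by simp) ?_
  rw [wp_seq]
  refine wp_move (by simp) (fun a => some (N.eA.symm a)) (by simp) (by simp) (by simp) ?_
  simp only [update_tri_one, tri_one, update_single, single_self, tri_three,
    update_tri_three, Function.update_self, update_tri_two, tri_two,
    filterMap_some_comp, List.map_map, List.append_nil, List.map_reverse, List.reverse_reverse,
    single_nil, update_empty, List.length_reverse, List.length_map]
  have h₁ : N.eA.symm ∘ M.eB ∘ M.eB.symm = N.eA.symm := by funext; simp
  rw [h₁]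
  refine h'.wp_two fun t₂ ht₂ => ⟨rfl, ?_, ?_⟩
  · rw [single_tri_two]
  · omega

theorem PolyTimeOn.comp [Fintype B] {sz : X → ℕ} {a : X → List A} {b : X → List B}
    {c : X → List C} (h : PolyTimeOn sz a b) (h' : PolyTimeOn sz b c) (q : Polynomial ℕ)
    (hq : ∀ x, (b x).length ≤ q.eval (sz x)) : PolyTimeOn sz a c := by
  obtain ⟨M, p, hM⟩ := h
  obtain ⟨N, p', hN⟩ := h'
  refine ⟨M.comp N, p + p' + 6 * q + 4, fun x => ((hM x).comp (hN x)).mono ?_⟩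
  have := hq x
  simp only [Polynomial.eval_add, Polynomial.eval_mul, Polynomial.eval_ofNat]
  omega

/-! ### Pairing -/

/-- Two words written on top of each other. -/
def zipOpt (u : List A) (v : List B) : List (Option A × Option B) := List.zipWithAll Prod.mk u v

theorem getElem?_zipOpt (u : List A) (v : List B) (i : ℕ) :
    (zipOpt u v)[i]? = match u[i]?, v[i]? with
      | none, none => none
      | a, b => some (a, b) := by
  rw [zipOpt, List.getElem?_zipWithAll]
  cases u[i]? <;> cases v[i]? <;> rfl

theorem length_zipOpt_le (u : List A) (v : List B) :
    (zipOpt u v).length ≤ u.length + v.length := by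
  induction u generalizing v with
  | nil => cases v <;> simp [zipOpt]
  | cons a u ih =>
    cases v with
    | nil => simp [zipOpt]
    | cons b v =>
      have := ih v
      simp only [zipOpt, List.zipWithAll_cons_cons, List.length_cons] at this ⊢
      omega

/-- The additional stacks of the machine `Machine.zip`. -/
inductive ZipStack
  | inp
  | tmp
  | res
  | out
  deriving DecidableEq

instance : Fintype ZipStack :=
  ⟨{.inp, .tmp, .res, .out}, fun k => by cases k <;> decide⟩

/-- The alphabets of the additional stacks of the machine `Machine.zip`. -/
@[reducible] def ZipStack.Γ (A B C : Type) : ZipStack → Type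
  | inp => A
  | tmp => A
  | res => Option B × Option C
  | out => Option B × Option C

/-- The contents of the additional stacks of the machine `Machine.zip`. -/
def ZipStack.stk (l₁ l₂ : List A) (l₃ l₄ : List (Option B × Option C)) : Stacks (Γ A B C)
  | inp => l₁
  | tmp => l₂
  | res => l₃
  | out => l₄

section

variable (l₁ l₂ : List A) (l₃ l₄ : List (Option B × Option C))

@[simp] theorem ZipStack.stk_inp : stk l₁ l₂ l₃ l₄ inp = l₁ := rfl
@[simp] theorem ZipStack.stk_tmp : stk l₁ l₂ l₃ l₄ tmp = l₂ := rfl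
@[simp] theorem ZipStack.stk_res : stk l₁ l₂ l₃ l₄ res = l₃ := rfl
@[simp] theorem ZipStack.stk_out : stk l₁ l₂ l₃ l₄ out = l₄ := rfl

@[simp] theorem ZipStack.update_inp (l) :
    Function.update (stk l₁ l₂ l₃ l₄) inp l = stk l l₂ l₃ l₄ := by
  funext k; cases k <;> simp

@[simp] theorem ZipStack.update_tmp (l) :
    Function.update (stk l₁ l₂ l₃ l₄) tmp l = stk l₁ l l₃ l₄ := by
  funext k; cases k <;> simp

@[simp] theorem ZipStack.update_res (l) :
    Function.update (stk l₁ l₂ l₃ l₄) res l = stk l₁ l₂ l l₄ := by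
  funext k; cases k <;> simp

@[simp] theorem ZipStack.update_out (l) :
    Function.update (stk l₁ l₂ l₃ l₄) out l = stk l₁ l₂ l₃ l := by
  funext k; cases k <;> simp

theorem ZipStack.single_inp : (single inp l₁ : Stacks (Γ A B C)) = stk l₁ [] [] [] := by
  funext k; cases k <;> simp [single]

theorem ZipStack.single_out : (single out l₄ : Stacks (Γ A B C)) = stk [] [] [] l₄ := by
  funext k; cases k <;> simp [single]

end

/-- The memory of the machine `Machine.zip` beside those of the given machines. -/
structure ZipMem (A B C : Type) where
  a : Option A
  b : Option B
  c : Option C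
  bc : Option (Option B × Option C)

instance [Finite A] [Finite B] [Finite C] : Finite (ZipMem A B C) :=
  Finite.of_injective (fun m => (m.a, m.b, m.c, m.bc)) fun x y h => by
    cases x; cases y; simpa using h

noncomputable instance [Finite A] [Finite B] [Finite C] : Fintype (ZipMem A B C) :=
  Fintype.ofFinite _

/-- Distributes the input to two machines. -/
def zipCopy (M : Machine A B) (N : Machine A C) :
    Prog (triΓ M.Γ N.Γ (ZipStack.Γ A B C)) (M.σ × N.σ × ZipMem A B C) :=
  .seq (move (.inr (.inr .inp)) (.inr (.inr .tmp)) (fun a v => (v.1, v.2.1, {v.2.2 with a := a}))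
    (fun v => v.2.2.a.isSome) fun v => v.2.2.a) <|
  forEach (.inr (.inr .tmp)) (fun a v => (v.1, v.2.1, {v.2.2 with a := a}))
    (fun v => v.2.2.a.isSome) <|
    .seq (.push (.inl M.k₀) fun v => v.2.2.a.map M.eA.symm)
      (.push (.inr (.inl N.k₀)) fun v => v.2.2.a.map N.eA.symm)

/-- Removes the first symbols of the outputs of two machines. -/
def zipPop (M : Machine A B) (N : Machine A C) :
    Prog (triΓ M.Γ N.Γ (ZipStack.Γ A B C)) (M.σ × N.σ × ZipMem A B C) :=
  .seq (.pop (.inl M.k₁) fun v b => (v.1, v.2.1, {v.2.2 with b := b.map M.eB}))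
    (.pop (.inr (.inl N.k₁)) fun v c => (v.1, v.2.1, {v.2.2 with c := c.map N.eB}))

/-- Pairs the outputs of two machines. -/
def zipPair (M : Machine A B) (N : Machine A C) :
    Prog (triΓ M.Γ N.Γ (ZipStack.Γ A B C)) (M.σ × N.σ × ZipMem A B C) :=
  .seq (zipPop M N) <| .loop (fun v => v.2.2.b.isSome || v.2.2.c.isSome) <|
    .seq (.push (.inr (.inr .res)) fun v => some (v.2.2.b, v.2.2.c)) (zipPop M N)

/-- The machine that outputs the outputs of `M` and `N`, written on top of each other. -/
noncomputable def Machine.zip [Fintype A] [Fintype B] [Fintype C] (M : Machine A B)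
    (N : Machine A C) : Machine A (Option B × Option C) where
  K := M.K ⊕ N.K ⊕ ZipStack
  k₀ := .inr (.inr .inp)
  k₁ := .inr (.inr .out)
  Γ := triΓ M.Γ N.Γ (ZipStack.Γ A B C)
  eA := Equiv.refl _
  eB := Equiv.refl _
  σ := M.σ × N.σ × ZipMem A B C
  init := (M.init, N.init, ⟨none, none, none, none⟩)
  prog := .seq (zipCopy M N) <|
    .seq (lift (triΓ M.Γ N.Γ (ZipStack.Γ A B C)) Sum.inl (Equiv.refl _) M.prog) <|
    .seq (lift (triΓ M.Γ N.Γ (ZipStack.Γ A B C)) (fun k => .inr (.inl k))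
      (swapFirst M.σ N.σ _) N.prog) <|
    .seq (zipPair M N) <|
    move (.inr (.inr .res)) (.inr (.inr .out)) (fun a v => (v.1, v.2.1, {v.2.2 with bc := a}))
      (fun v => v.2.2.bc.isSome) fun v => v.2.2.bc

section Zip

variable {M : Machine A B} {N : Machine A C}
  {Q : M.σ × N.σ × ZipMem A B C → Stacks (triΓ M.Γ N.Γ (ZipStack.Γ A B C)) → ℕ → Prop}

theorem wp_zipCopy {u : List A} {t : ℕ}
    (hQ : Q (M.init, N.init, ⟨none, none, none, none⟩)
      (tri (single M.k₀ (u.map M.eA.symm)) (single N.k₀ (u.map N.eA.symm))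
        (ZipStack.stk [] [] [] [])) (t + (7 * u.length + 4))) :
    wp (zipCopy M N) Q (M.init, N.init, ⟨none, none, none, none⟩)
      (tri (fun _ => []) (fun _ => []) (ZipStack.stk u [] [] [])) t := by
  rw [zipCopy, wp_seq]
  refine wp_move (by simp) some (by simp) (by simp) (by simp) ?_
  simp only [update_tri_three, tri_three, ZipStack.update_inp, ZipStack.update_tmp,
    ZipStack.stk_inp, ZipStack.stk_tmp, List.filterMap_some, List.append_nil]
  -- Generalized over the part `w` that has already been distributed to both input stacks.
  have key : ∀ (l w : List A) (a : Option A) (t : ℕ),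
      Q (M.init, N.init, ⟨none, none, none, none⟩)
        (tri (single M.k₀ ((l.reverse ++ w).map M.eA.symm))
          (single N.k₀ ((l.reverse ++ w).map N.eA.symm)) (ZipStack.stk [] [] [] []))
        (t + (4 * l.length + 2)) →
      wp (forEach (.inr (.inr .tmp)) (fun a v => (v.1, v.2.1, {v.2.2 with a := a}))
        (fun v => v.2.2.a.isSome) <|
        .seq (.push (.inl M.k₀) fun v => v.2.2.a.map M.eA.symm)
          (.push (.inr (.inl N.k₀)) fun v => v.2.2.a.map N.eA.symm)) Q
        (M.init, N.init, ⟨a, none, none, none⟩)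
        (tri (single M.k₀ (w.map M.eA.symm)) (single N.k₀ (w.map N.eA.symm))
          (ZipStack.stk [] l [] [])) t := by
    intro l
    induction l with
    | nil => exact fun w a t h => wp_forEach_nil rfl rfl h
    | cons b l ih =>
      intro w a t h
      refine wp_forEach_cons rfl rfl ?_
      simp only [wp_seq, wp_push, update_tri_three, ZipStack.update_tmp, Option.map_some,
        Option.toList_some, tri_one, single_self, update_tri_one, update_single, tri_two,
        update_tri_two, List.cons_append, List.nil_append]
      refine ih (b :: w) _ _ ?_
      convert h using 1
      · simp
      · simp; ring
  have := key u.reverse [] none (t + (3 * u.length + 2))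
  simp only [List.reverse_reverse, List.append_nil, List.length_reverse, List.map_nil,
    single_nil] at this
  refine this ?_
  convert hQ using 1
  ring

theorem wp_zipPop {v : List B} {w : List C} {t : ℕ} {m : ZipMem A B C}
    {S : Stacks (ZipStack.Γ A B C)} :
    wp (zipPop M N) Q (M.init, N.init, m)
      (tri (single M.k₁ (v.map M.eB.symm)) (single N.k₁ (w.map N.eB.symm)) S) t ↔
    Q (M.init, N.init, { m with b := v.head?, c := w.head? })
      (tri (single M.k₁ (v.tail.map M.eB.symm)) (single N.k₁ (w.tail.map N.eB.symm)) S)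
        (t + 2) := by
  simp only [zipPop, wp_seq, wp_pop, tri_one, single_self, update_tri_one, update_single, tri_two,
    update_tri_two, List.head?_map, Option.map_map, List.map_tail]
  have h₁ : M.eB ∘ M.eB.symm = id := by funext; simp
  have h₂ : N.eB ∘ N.eB.symm = id := by funext; simp
  rw [h₁, h₂, Option.map_id, Option.map_id]
  rfl

theorem zipOpt_eq_cons {v : List B} {w : List C} (h : v.length + w.length ≠ 0) :
    zipOpt v w = (v.head?, w.head?) :: zipOpt v.tail w.tail := by
  rcases v with _ | ⟨x, v⟩ <;> rcases w with _ | ⟨y, w⟩ <;> simp_all [zipOpt]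

/-- The induction is on the total length, since either word may end first; an exhausted stack then
yields `none`, as in `zipOpt`. -/
theorem wp_zipPair (v : List B) (w : List C) {t : ℕ} {l : List (Option B × Option C)}
    {b : Option B} {c : Option C}
    (hQ : ∀ t' ≤ t + 4 * (v.length + w.length) + 3, Q (M.init, N.init, ⟨none, none, none, none⟩)
      (tri (fun _ => []) (fun _ => []) (ZipStack.stk [] [] ((zipOpt v w).reverse ++ l) [])) t') :
    wp (zipPair M N) Q (M.init, N.init, ⟨none, b, c, none⟩)
      (tri (single M.k₁ (v.map M.eB.symm)) (single N.k₁ (w.map N.eB.symm))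
        (ZipStack.stk [] [] l [])) t := by
  generalize hn : v.length + w.length = n at hQ
  induction n using Nat.strong_induction_on generalizing v w t l b c with
  | _ n ih =>
    rw [zipPair, wp_seq, wp_zipPop, wp_loop]
    by_cases h : v.length + w.length = 0
    · have hv : v = [] := List.length_eq_zero_iff.1 (by omega)
      have hw : w = [] := List.length_eq_zero_iff.1 (by omega)
      subst hv hw
      simpa [zipOpt] using hQ (t + 3) (by omega)
    · have hb : (v.head?.isSome || w.head?.isSome) = true := by
        rcases v with _ | ⟨x, v⟩ <;> rcases w with _ | ⟨y, w⟩ <;> simp_all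
      have hl : v.tail.length + w.tail.length < n := by
        rcases v with _ | ⟨x, v⟩ <;> rcases w with _ | ⟨y, w⟩ <;> simp_all <;> omega
      -- After the push, the remaining pops and loop form `zipPair` again, now on the tails.
      rw [if_pos hb, wp_seq, wp_push, ← wp_seq]
      simp only [update_tri_three, tri_three, ZipStack.update_res, ZipStack.stk_res,
        Option.toList_some, List.cons_append, List.nil_append]
      refine ih _ hl v.tail w.tail rfl fun t' ht' => ?_
      have := hQ t' (by omega)
      rw [zipOpt_eq_cons h] at this
      simpa using this

theorem Machine.Outputs.zip [Fintype A] [Fintype B] [Fintype C] {u : List A} {v : List B}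
    {w : List C} {T T' : ℕ} (h : M.Outputs u v T) (h' : N.Outputs u w T') :
    (M.zip N).Outputs u (zipOpt v w) (T + T' + 7 * u.length + 7 * (v.length + w.length) + 9) := by
  have e₀ : (single (.inr (.inr .inp)) u : Stacks (triΓ M.Γ N.Γ (ZipStack.Γ A B C))) =
      tri (fun _ => []) (fun _ => []) (ZipStack.stk u [] [] []) :=
    (single_tri_three (Γ₃ := ZipStack.Γ A B C) .inp u).trans (by rw [ZipStack.single_inp])
  rw [Machine.Outputs, show u.map (M.zip N).eA.symm = u from List.map_id u,
    show (zipOpt v w).map (M.zip N).eB.symm = zipOpt v w from List.map_id _]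
  change wp (.seq (zipCopy M N) _) _ (M.init, N.init, ⟨none, none, none, none⟩)
    (single (.inr (.inr .inp)) u) 0
  rw [e₀]
  refine wp_seq.2 ?_
  refine wp_zipCopy ?_
  refine wp_seq.2 ?_
  refine h.wp_one fun t₁ ht₁ => ?_
  refine wp_seq.2 ?_
  refine h'.wp_two fun t₂ ht₂ => ?_
  refine wp_seq.2 ?_
  refine wp_zipPair v w fun t₃ ht₃ => ?_
  refine wp_move (by simp) some (by simp) (by simp) (by simp) ?_
  have := length_zipOpt_le v w
  refine ⟨rfl, ?_, ?_⟩
  · refine Eq.trans ?_ (single_tri_three (K₁ := M.K) (K₂ := N.K) _ _).symm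
    rw [ZipStack.single_out]
    simp
    rfl
  · simp only [tri_three, ZipStack.stk_res, List.append_nil, List.length_reverse]
    omega

end Zip

theorem PolyTimeOn.zip [Fintype A] [Fintype B] [Fintype C] {sz : X → ℕ} {a : X → List A}
    {b : X → List B} {c : X → List C} (h : PolyTimeOn sz a b) (h' : PolyTimeOn sz a c)
    (q q₁ q₂ : Polynomial ℕ) (hq : ∀ x, (a x).length ≤ q.eval (sz x))
    (hq₁ : ∀ x, (b x).length ≤ q₁.eval (sz x)) (hq₂ : ∀ x, (c x).length ≤ q₂.eval (sz x)) :
    PolyTimeOn sz a fun x => zipOpt (b x) (c x) := by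
  obtain ⟨M, p, hM⟩ := h
  obtain ⟨N, p', hN⟩ := h'
  refine ⟨M.zip N, p + p' + 7 * q + 7 * (q₁ + q₂) + 9, fun x => ((hM x).zip (hN x)).mono ?_⟩
  have := hq x
  have := hq₁ x
  have := hq₂ x
  simp only [Polynomial.eval_add, Polynomial.eval_mul, Polynomial.eval_ofNat]
  omega

open Prog

/-! ### Evaluation of circuits from their descriptions -/

section Evaluator

variable {S T : Type}

instance [Finite S] [Finite T] : Finite (Token S T) := by
  let f : Token S T → Option (Option (S ⊕ Bool)) ⊕ Option (Option (Option T)) := fun c =>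
    match c with
    | .tick => .inl none
    | .comma => .inl (some none)
    | .input a => .inl (some (some (.inl a)))
    | .const b => .inl (some (some (.inr b)))
    | .neg => .inr none
    | .conj => .inr (some none)
    | .disj => .inr (some (some none))
    | .output a => .inr (some (some (some a)))
  exact Finite.of_injective f fun a b h => by cases a <;> cases b <;> simp_all [f]

noncomputable instance [Finite S] [Finite T] : Fintype (Token S T) := Fintype.ofFinite _

/-- The state of the evaluation of a description of a circuit: the pending operation, its first
argument if this has been read, the values of the gates and the input symbols behind and (in reverse
order) before the place reached by the current argument, and the output, in reverse order. -/
@[ext] structure EvalState (S T : Type) where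
  op : Option (Token S T)
  arg : Bool
  val : List Bool
  valR : List Bool
  sym : List S
  symR : List S
  out : List T

namespace EvalState

/-- The state before an operation. -/
def base (x : List S) (v : List Bool) (out : List T) : EvalState S T := ⟨none, false, v, [], x, [], out⟩

open Classical in
/-- The value of the gate given by an operation, if it is a gate. -/
noncomputable def gateValue (op : Option (Token S T)) (arg : Bool) (b : Option Bool)
    (s : Option S) : Option Bool :=
  match op with
  | some (.input a) => some (decide (s = some a))
  | some (.const b) => some b
  | some .neg => some (!b.getD false)
  | some .conj => some (arg && b.getD false)
  | some .disj => some (arg || b.getD false)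
  | _ => none

/-- The symbol output by an operation. -/
def outSymbol (op : Option (Token S T)) (b : Option Bool) : Option T :=
  match op with
  | some (.output a) => if b.getD false then some a else none
  | _ => none

/-- Ends the pending operation. -/
noncomputable def finish (st : EvalState S T) : EvalState S T where
  op := none
  arg := false
  val := st.valR.reverse ++ st.val ++ (gateValue st.op st.arg st.val.head? st.sym.head?).toList
  valR := []
  sym := st.symR.reverse ++ st.sym
  symR := []
  out := (outSymbol st.op st.val.head?).toList ++ st.out

/-- The effect of a symbol of the description. -/
noncomputable def next (st : EvalState S T) : Token S T → EvalState S T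
  | .tick => { st with
      val := st.val.tail, valR := st.val.head?.toList ++ st.valR
      sym := st.sym.tail, symR := st.sym.head?.toList ++ st.symR }
  | .comma => { st with
      arg := st.val.head?.getD false
      val := st.valR.reverse ++ st.val, valR := []
      sym := st.symR.reverse ++ st.sym, symR := [] }
  | c => { st.finish with op := some c }

/-- Reading a number in unary walks along the values and the input symbols at once, so afterwards
the addressed entry is on top. Beyond the end nothing is on top, which agrees with the default
values in `Gate.value`. -/
theorem foldl_unary (n : ℕ) (st : EvalState S T) : (unary n).foldl next st =
    { st with
      val := st.val.drop n, valR := (st.val.take n).reverse ++ st.valR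
      sym := st.sym.drop n, symR := (st.sym.take n).reverse ++ st.symR } := by
  induction n generalizing st with
  | zero => simp [unary]
  | succ n ih =>
    have : (unary (n + 1) : List (Token S T)) = .tick :: unary n := rfl
    rw [this, List.foldl_cons, ih]
    ext1 <;> simp only [next]
    · cases st.val <;> simp
    · cases st.val <;> simp
    · cases st.sym <;> simp
    · cases st.sym <;> simp

/-- An operation takes effect only when the next one begins, because its unary argument has no end
mark. The invariant is therefore stated for `finish` of the state. -/
theorem finish_foldl_encode {x : List S} {v : List Bool} {out : List T} {st : EvalState S T}
    (h : st.finish = base x v out) (g : Gate S) :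
    (g.encode.foldl next st).finish = base x (v ++ [g.value x v]) out := by
  cases g <;>
    simp only [Gate.encode, List.foldl_cons, List.foldl_append, List.foldl_nil, next, h,
      foldl_unary] <;>
    simp [base, finish, gateValue, outSymbol, Gate.value, List.getD_eq_getElem?_getD]
  exact decide_eq_decide.2 (by rw [List.head?_drop])

theorem finish_foldl_gates {x : List S} {v : List Bool} {out : List T} {st : EvalState S T}
    (h : st.finish = base x v out) (gs : List (Gate S)) :
    ((gs.flatMap Gate.encode).foldl next st).finish =
      base x (gs.foldl (fun v g => v ++ [g.value x v]) v) out := by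
  induction gs generalizing v st with
  | nil => simpa using h
  | cons g gs ih =>
    rw [List.flatMap_cons, List.foldl_append, List.foldl_cons]
    exact ih (finish_foldl_encode h g)

theorem finish_foldl_outputs {x : List S} {v : List Bool} {out : List T} {st : EvalState S T}
    (h : st.finish = base x v out) (os : List (T × ℕ)) :
    ((os.flatMap fun o => .output o.1 :: unary o.2).foldl next st).finish =
      base x v ((os.filterMap fun o => if v.getD o.2 false then some o.1 else none).reverse ++
        out) := by
  induction os generalizing out st with
  | nil => simpa using h
  | cons o os ih =>
    rw [List.flatMap_cons, List.foldl_append]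
    have : (List.foldl next st (.output o.1 :: unary o.2)).finish =
        base x v ((if v.getD o.2 false then some o.1 else none).toList ++ out) := by
      simp only [List.foldl_cons, next, h, foldl_unary]
      simp [base, finish, gateValue, outSymbol, List.getD_eq_getElem?_getD]
    rw [ih this]
    cases hv : v.getD o.2 false <;> simp [hv, -List.getD_eq_getElem?_getD]

theorem finish_foldl_circuit (C : Circuit S T) (x : List S) :
    (C.encode.foldl next (base x [] [])).finish = base x (C.values x) (C.eval x).reverse := by
  have h : (base x [] [] : EvalState S T).finish = base x [] [] := by
    simp [base, finish, gateValue, outSymbol]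
  rw [Circuit.encode, List.foldl_append, finish_foldl_outputs (finish_foldl_gates h _),
    List.append_nil]
  rfl

/-- The number of symbols stored for the lookup of arguments. -/
def size (st : EvalState S T) : ℕ :=
  st.val.length + st.valR.length + st.sym.length + st.symR.length

theorem size_finish_le (st : EvalState S T) : st.finish.size ≤ st.size + 1 := by
  have : (gateValue st.op st.arg st.val.head? st.sym.head?).toList.length ≤ 1 := by
    cases gateValue st.op st.arg st.val.head? st.sym.head? <;> simp
  simp only [size, finish, List.length_append, List.length_reverse, List.length_nil]
  omega

/-- Ticks and commas only shift symbols between the lists; any other symbol finishes an operation,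
which adds at most one value. This bounds the cost of rewinding. -/
theorem size_next_le (st : EvalState S T) (c : Token S T) : (st.next c).size ≤ st.size + 1 := by
  have := st.size_finish_le
  cases c <;> try exact this
  · cases h : st.val <;> cases h' : st.sym <;> simp [next, size, h, h'] <;> omega
  · simp [next, size]
    omega

theorem length_out_finish_le (st : EvalState S T) :
    st.finish.out.length ≤ st.out.length + 1 := by
  have : (outSymbol st.op st.val.head?).toList.length ≤ 1 := by
    cases outSymbol st.op st.val.head? <;> simp
  simp only [finish, List.length_append]
  omega

end EvalState

/-! ### The evaluator as a stack program. -/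

/-- The stacks of the evaluator. -/
inductive EvalStack
  | inp
  | tokR
  | tok
  | val
  | valR
  | sym
  | symR
  | outR
  | out
  deriving DecidableEq

instance : Fintype EvalStack :=
  ⟨{.inp, .tokR, .tok, .val, .valR, .sym, .symR, .outR, .out}, fun k => by cases k <;> decide⟩

namespace EvalStack

/-- The alphabets of the stacks of the evaluator. -/
@[reducible] def Γ (S T : Type) : EvalStack → Type
  | inp => Option S × Option (Token S T)
  | tokR => Token S T
  | tok => Token S T
  | val => Bool
  | valR => Bool
  | sym => S
  | symR => S
  | outR => T
  | out => T

/-- The contents of the stacks of the evaluator. -/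
def stk (l₁ : List (Option S × Option (Token S T))) (l₂ l₃ : List (Token S T)) (l₄ l₅ : List Bool)
    (l₆ l₇ : List S) (l₈ l₉ : List T) : Stacks (Γ S T)
  | inp => l₁
  | tokR => l₂
  | tok => l₃
  | val => l₄
  | valR => l₅
  | sym => l₆
  | symR => l₇
  | outR => l₈
  | out => l₉

variable (l₁ : List (Option S × Option (Token S T))) (l₂ l₃ : List (Token S T)) (l₄ l₅ : List Bool)
  (l₆ l₇ : List S) (l₈ l₉ : List T)

@[simp] theorem stk_inp : stk l₁ l₂ l₃ l₄ l₅ l₆ l₇ l₈ l₉ inp = l₁ := rfl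
@[simp] theorem stk_tokR : stk l₁ l₂ l₃ l₄ l₅ l₆ l₇ l₈ l₉ tokR = l₂ := rfl
@[simp] theorem stk_tok : stk l₁ l₂ l₃ l₄ l₅ l₆ l₇ l₈ l₉ tok = l₃ := rfl
@[simp] theorem stk_val : stk l₁ l₂ l₃ l₄ l₅ l₆ l₇ l₈ l₉ val = l₄ := rfl
@[simp] theorem stk_valR : stk l₁ l₂ l₃ l₄ l₅ l₆ l₇ l₈ l₉ valR = l₅ := rfl
@[simp] theorem stk_sym : stk l₁ l₂ l₃ l₄ l₅ l₆ l₇ l₈ l₉ sym = l₆ := rfl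
@[simp] theorem stk_symR : stk l₁ l₂ l₃ l₄ l₅ l₆ l₇ l₈ l₉ symR = l₇ := rfl
@[simp] theorem stk_outR : stk l₁ l₂ l₃ l₄ l₅ l₆ l₇ l₈ l₉ outR = l₈ := rfl
@[simp] theorem stk_out : stk l₁ l₂ l₃ l₄ l₅ l₆ l₇ l₈ l₉ out = l₉ := rfl

@[simp] theorem update_inp (l) : Function.update (stk l₁ l₂ l₃ l₄ l₅ l₆ l₇ l₈ l₉) inp l =
    stk l l₂ l₃ l₄ l₅ l₆ l₇ l₈ l₉ := by
  funext k; cases k <;> simp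

@[simp] theorem update_tokR (l) : Function.update (stk l₁ l₂ l₃ l₄ l₅ l₆ l₇ l₈ l₉) tokR l =
    stk l₁ l l₃ l₄ l₅ l₆ l₇ l₈ l₉ := by
  funext k; cases k <;> simp

@[simp] theorem update_tok (l) : Function.update (stk l₁ l₂ l₃ l₄ l₅ l₆ l₇ l₈ l₉) tok l =
    stk l₁ l₂ l l₄ l₅ l₆ l₇ l₈ l₉ := by
  funext k; cases k <;> simp

@[simp] theorem update_val (l) : Function.update (stk l₁ l₂ l₃ l₄ l₅ l₆ l₇ l₈ l₉) val l =
    stk l₁ l₂ l₃ l l₅ l₆ l₇ l₈ l₉ := by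
  funext k; cases k <;> simp

@[simp] theorem update_valR (l) : Function.update (stk l₁ l₂ l₃ l₄ l₅ l₆ l₇ l₈ l₉) valR l =
    stk l₁ l₂ l₃ l₄ l l₆ l₇ l₈ l₉ := by
  funext k; cases k <;> simp

@[simp] theorem update_sym (l) : Function.update (stk l₁ l₂ l₃ l₄ l₅ l₆ l₇ l₈ l₉) sym l =
    stk l₁ l₂ l₃ l₄ l₅ l l₇ l₈ l₉ := by
  funext k; cases k <;> simp

@[simp] theorem update_symR (l) : Function.update (stk l₁ l₂ l₃ l₄ l₅ l₆ l₇ l₈ l₉) symR l =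
    stk l₁ l₂ l₃ l₄ l₅ l₆ l l₈ l₉ := by
  funext k; cases k <;> simp

@[simp] theorem update_outR (l) : Function.update (stk l₁ l₂ l₃ l₄ l₅ l₆ l₇ l₈ l₉) outR l =
    stk l₁ l₂ l₃ l₄ l₅ l₆ l₇ l l₉ := by
  funext k; cases k <;> simp

@[simp] theorem update_out (l) : Function.update (stk l₁ l₂ l₃ l₄ l₅ l₆ l₇ l₈ l₉) out l =
    stk l₁ l₂ l₃ l₄ l₅ l₆ l₇ l₈ l := by
  funext k; cases k <;> simp

theorem single_inp : (single inp l₁ : Stacks (Γ S T)) = stk l₁ [] [] [] [] [] [] [] [] := by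
  funext k; cases k <;> simp [single]

theorem single_out : (single out l₉ : Stacks (Γ S T)) = stk [] [] [] [] [] [] [] [] l₉ := by
  funext k; cases k <;> simp [single]

end EvalStack

/-- The memory of the evaluator. -/
structure EvalMem (S T : Type) where
  io : Option (Option S × Option (Token S T))
  tok : Option (Token S T)
  op : Option (Token S T)
  arg : Bool
  bit : Option Bool
  sym : Option S
  out : Option T
  res : Option Bool

instance [Finite S] [Finite T] : Finite (EvalMem S T) :=
  Finite.of_injective
    (fun m => (m.io, m.tok, m.op, m.arg, m.bit, m.sym, m.out, m.res)) fun x y h => by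
    cases x; cases y; simpa using h

noncomputable instance [Finite S] [Finite T] : Fintype (EvalMem S T) := Fintype.ofFinite _

/-- The program that returns to the beginning of the values and of the input. -/
def evalRewind : Prog (EvalStack.Γ S T) (EvalMem S T) :=
  .seq (move .valR .val (fun a v => { v with bit := a }) (fun v => v.bit.isSome) fun v => v.bit)
    (move .symR .sym (fun a v => { v with sym := a }) (fun v => v.sym.isSome) fun v => v.sym)

/-- The program that ends the pending operation. -/
noncomputable def evalFinish : Prog (EvalStack.Γ S T) (EvalMem S T) :=
  .seq (.peek .val fun v a => { v with bit := a }) <|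
  .seq (.peek .sym fun v a => { v with sym := a }) <|
  .seq (.push .outR fun v => EvalState.outSymbol v.op v.bit) <|
  .seq (.load fun v => { v with
    res := EvalState.gateValue v.op v.arg v.bit v.sym, op := none, arg := false, bit := none,
    sym := none }) <|
  .seq (move .val .valR (fun a v => { v with bit := a }) (fun v => v.bit.isSome) fun v => v.bit) <|
  .seq (.push .valR fun v => v.res) <|
  .seq (.load fun v => { v with res := none }) evalRewind

/-- The program that processes one symbol of the description of a circuit. -/
noncomputable def evalNext [Fintype S] [Fintype T] : Prog (EvalStack.Γ S T) (EvalMem S T) :=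
  .switch EvalMem.tok fun c => match c with
    | some .tick =>
      .seq (.pop .val fun v a => { v with bit := a }) <|
      .seq (.push .valR fun v => v.bit) <|
      .seq (.pop .sym fun v a => { v with sym := a }) <|
      .seq (.push .symR fun v => v.sym) <|
      .load fun v => { v with bit := none, sym := none }
    | some .comma =>
      .seq (.peek .val fun v a => { v with arg := a.getD false }) evalRewind
    | _ => .seq evalFinish (.load fun v => { v with op := v.tok })

namespace EvalState

/-- The memory of the evaluator in a given state. -/
def mem (st : EvalState S T) (c : Option (Token S T)) : EvalMem S T :=
  ⟨none, c, st.op, st.arg, none, none, none, none⟩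

/-- The stacks of the evaluator in a given state. -/
def contents (st : EvalState S T) (l : List (Token S T)) : Stacks (EvalStack.Γ S T) :=
  EvalStack.stk [] [] l st.val st.valR st.sym st.symR st.out []

end EvalState

section

variable {Q : EvalMem S T → Stacks (EvalStack.Γ S T) → ℕ → Prop} {t : ℕ}

theorem wp_evalRewind {c op : Option (Token S T)} {arg : Bool} {l : List (Token S T)}
    {l₁ l₂ : List Bool} {l₃ l₄ : List S} {l₅ : List T}
    (hQ : Q ⟨none, c, op, arg, none, none, none, none⟩
      (EvalStack.stk [] [] l (l₂.reverse ++ l₁) [] (l₄.reverse ++ l₃) [] l₅ [])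
      (t + (3 * l₂.length + 2) + (3 * l₄.length + 2))) :
    wp evalRewind Q ⟨none, c, op, arg, none, none, none, none⟩
      (EvalStack.stk [] [] l l₁ l₂ l₃ l₄ l₅ []) t := by
  rw [evalRewind, wp_seq]
  refine wp_move (by simp) some (by simp) (by simp) (by simp) ?_
  refine wp_move (by simp) some (by simp) (by simp) (by simp) ?_
  simpa using hQ

/-- A new gate value belongs at the bottom of the value stack. So all values are moved to the
reversed stack, the new one is put on top there, and everything is moved back. -/
theorem wp_evalFinish {st : EvalState S T} {c : Option (Token S T)} {l : List (Token S T)}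
    (hQ : ∀ t' ≤ t + 9 * st.size + 30, Q (st.finish.mem c) (st.finish.contents l) t') :
    wp evalFinish Q (st.mem c) (st.contents l) t := by
  simp only [evalFinish, wp_seq, wp_peek, wp_push, wp_load, EvalState.mem, EvalState.contents,
    EvalStack.stk_val, EvalStack.stk_sym, EvalStack.stk_outR, EvalStack.update_outR]
  refine wp_move (by simp) some (by simp) (by simp) (by simp) ?_
  simp only [wp_seq, wp_push, wp_load, EvalStack.stk_val, EvalStack.update_val,
    EvalStack.stk_valR, EvalStack.update_valR, List.filterMap_some]
  refine wp_evalRewind ?_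
  have h : (EvalState.gateValue st.op st.arg st.val.head? st.sym.head?).toList.length ≤ 1 := by
    cases EvalState.gateValue st.op st.arg st.val.head? st.sym.head? <;> simp
  have := hQ (t + 1 + 1 + 1 + 1 + (3 * st.val.length + 2) + 1 + 1 +
    (3 * ((EvalState.gateValue st.op st.arg st.val.head? st.sym.head?).toList ++
      (st.val.reverse ++ st.valR)).length + 2) + (3 * st.symR.length + 2)) (by
      simp only [EvalState.size, List.length_append, List.length_reverse]
      omega)
  have h₁ : ((EvalState.gateValue st.op st.arg st.val.head? st.sym.head?).toList ++
      (st.val.reverse ++ st.valR)).reverse ++ [] = st.finish.val := by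
    cases h : EvalState.gateValue st.op st.arg st.val.head? st.sym.head? <;>
      simp [EvalState.finish, h]
  rw [h₁]
  exact this

theorem wp_evalNext [Fintype S] [Fintype T] {st : EvalState S T} {c : Token S T}
    {l : List (Token S T)}
    (hQ : ∀ t' ≤ t + 9 * st.size + 40, Q ((st.next c).mem (some c)) ((st.next c).contents l) t') :
    wp evalNext Q (st.mem (some c)) (st.contents l) t := by
  rw [evalNext, wp_switch]
  cases c
  case tick =>
    have := hQ (t + 6) (by omega)
    simpa [EvalState.mem, wp_seq, wp_pop, wp_push, wp_load, EvalState.contents, EvalState.next]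
      using this
  case comma =>
    have := hQ (t + 1 + 1 + (3 * st.valR.length + 2) + (3 * st.symR.length + 2)) (by
      simp only [EvalState.size]
      omega)
    simp only [EvalState.mem, wp_seq, wp_peek, EvalState.contents, EvalStack.stk_val]
    exact wp_evalRewind this
  all_goals
    simp only [EvalState.mem, wp_seq]
    refine wp_evalFinish fun t' ht' => ?_
    rw [wp_load]
    exact hQ _ (by omega)

/-- The program that separates the input word from the description of the circuit. -/
def evalSplit : Prog (EvalStack.Γ S T) (EvalMem S T) :=
  .seq (forEach .inp (fun a v => { v with io := a }) (fun v => v.io.isSome) <|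
    .seq (.push .symR fun v => v.io.bind Prod.fst) (.push .tokR fun v => v.io.bind Prod.snd)) <|
  .seq (move .symR .sym (fun a v => { v with sym := a }) (fun v => v.sym.isSome) fun v => v.sym)
    (move .tokR .tok (fun a v => { v with tok := a }) (fun v => v.tok.isSome) fun v => v.tok)

theorem wp_evalSplit {l : List (Option S × Option (Token S T))} {x : List S}
    {w : List (Token S T)} (hx : l.filterMap Prod.fst = x) (hw : l.filterMap Prod.snd = w)
    (hQ : Q ((EvalState.base x [] []).mem none) ((EvalState.base x [] []).contents w)
      (t + (4 * l.length + 3 * x.length + 3 * w.length + 6))) :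
    wp evalSplit Q ⟨none, none, none, false, none, none, none, none⟩
      (EvalStack.stk l [] [] [] [] [] [] [] []) t := by
  rw [evalSplit, wp_seq]
  have key : ∀ (l : List (Option S × Option (Token S T))) (x : List S) (w : List (Token S T))
      (t : ℕ) (io : Option (Option S × Option (Token S T)))
      (Q : EvalMem S T → Stacks (EvalStack.Γ S T) → ℕ → Prop),
      Q ⟨none, none, none, false, none, none, none, none⟩
        (EvalStack.stk [] ((l.filterMap Prod.snd).reverse ++ w) [] [] [] []
          ((l.filterMap Prod.fst).reverse ++ x) [] []) (t + (4 * l.length + 2)) →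
      wp (forEach .inp (fun a v => { v with io := a }) (fun v => v.io.isSome) <|
        .seq (.push .symR fun v => v.io.bind Prod.fst) (.push .tokR fun v => v.io.bind Prod.snd)) Q
        ⟨io, none, none, false, none, none, none, none⟩ (EvalStack.stk l w [] [] [] [] x [] []) t := by
    intro l
    induction l with
    | nil => exact fun x w t io Q h => wp_forEach_nil rfl rfl h
    | cons b l ih =>
      intro x w t io Q h
      refine wp_forEach_cons rfl rfl ?_
      simp only [wp_seq, wp_push, EvalStack.update_inp, EvalStack.stk_symR, EvalStack.update_symR,
        EvalStack.stk_tokR, EvalStack.update_tokR]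
      refine ih _ _ _ _ _ ?_
      have h₁ : t + 2 + 1 + 1 + (4 * l.length + 2) = t + (4 * (b :: l).length + 2) := by
        rw [List.length_cons]; ring
      rw [h₁]
      rcases b with ⟨_ | a, _ | c⟩ <;> simpa using h
  refine key _ _ _ _ _ _ ?_
  rw [wp_seq, hx, hw]
  refine wp_move (by simp) some (by simp) (by simp) (by simp) ?_
  refine wp_move (by simp) some (by simp) (by simp) (by simp) ?_
  have h₁ : t + (4 * l.length + 3 * x.length + 3 * w.length + 6) =
    t + (4 * l.length + 2) + (3 * x.length + 2) + (3 * w.length + 2) := by ring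
  rw [h₁] at hQ
  simpa [EvalState.mem, EvalState.contents, EvalState.base] using hQ

/-- Throughout the loop the size is at most its initial value plus the number of symbols, which
makes the total cost quadratic. -/
theorem wp_forEach_evalNext [Fintype S] [Fintype T] (w : List (Token S T)) (st : EvalState S T)
    (c : Option (Token S T))
    (hQ : ∀ t' ≤ t + w.length * (9 * (st.size + w.length) + 42) + 2,
      Q ((w.foldl EvalState.next st).mem none) ((w.foldl EvalState.next st).contents []) t') :
    wp (forEach .tok (fun a v => { v with tok := a }) (fun v => v.tok.isSome) evalNext) Q
      (st.mem c) (st.contents w) t := by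
  induction w generalizing st c t with
  | nil => exact wp_forEach_nil rfl rfl (hQ _ (by omega))
  | cons b w ih =>
    refine wp_forEach_cons rfl rfl ?_
    have : Function.update (st.contents (b :: w)) .tok w = st.contents w := by
      simp [EvalState.contents]
    rw [this]
    refine wp_evalNext fun t₁ ht₁ => ?_
    refine ih _ _ fun t₂ ht₂ => hQ _ ?_
    have h := st.size_next_le b
    have h' := Nat.mul_le_mul_left w.length
      (show 9 * ((st.next b).size + w.length) + 42 ≤ 9 * (st.size + (w.length + 1)) + 42 by omega)
    rw [List.length_cons, add_mul, one_mul]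
    omega

theorem length_out_foldl_next (w : List (Token S T)) (st : EvalState S T) :
    (w.foldl EvalState.next st).out.length ≤ st.out.length + w.length := by
  induction w generalizing st with
  | nil => simp
  | cons c w ih =>
    have h : (st.next c).out.length ≤ st.out.length + 1 := by
      have := st.length_out_finish_le
      cases c <;> simp_all [EvalState.next]
    have := ih (st.next c)
    rw [List.foldl_cons, List.length_cons]
    omega

theorem size_foldl_next (w : List (Token S T)) (st : EvalState S T) :
    (w.foldl EvalState.next st).size ≤ st.size + w.length := by
  induction w generalizing st with
  | nil => simp
  | cons c w ih =>
    have h := st.size_next_le c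
    have := ih (st.next c)
    rw [List.foldl_cons, List.length_cons]
    omega

/-- The machine that evaluates a circuit on an input word. -/
noncomputable def evalMachine (S T : Type) [Fintype S] [Fintype T] :
    Machine (Option S × Option (Token S T)) T where
  K := EvalStack
  k₀ := .inp
  k₁ := .out
  Γ := EvalStack.Γ S T
  eA := Equiv.refl _
  eB := Equiv.refl _
  σ := EvalMem S T
  init := ⟨none, none, none, false, none, none, none, none⟩
  prog :=
    .seq evalSplit <|
    .seq (forEach .tok (fun a v => { v with tok := a }) (fun v => v.tok.isSome) evalNext) <|
    .seq evalFinish <|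
    .seq (move .val .valR (fun a v => { v with bit := a }) (fun v => v.bit.isSome) fun _ => none) <|
    .seq (move .sym .symR (fun a v => { v with sym := a }) (fun v => v.sym.isSome) fun _ => none) <|
    move .outR .out (fun a v => { v with out := a }) (fun v => v.out.isSome) fun v => v.out

theorem filterMap_none {α β : Type} (l : List α) : l.filterMap (fun _ => (none : Option β)) = [] := by
  induction l <;> simp_all

theorem filterMap_fst_zipOpt {A B : Type} (u : List A) (v : List B) :
    (zipOpt u v).filterMap Prod.fst = u := by
  induction u generalizing v with
  | nil => cases v <;> simp [zipOpt]
  | cons a u ih => cases v <;> simp_all [zipOpt]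

theorem filterMap_snd_zipOpt {A B : Type} (u : List A) (v : List B) :
    (zipOpt u v).filterMap Prod.snd = v := by
  induction v generalizing u with
  | nil => cases u <;> simp [zipOpt]
  | cons b v ih => cases u <;> simp_all [zipOpt]

theorem evalMachine_outputs [Fintype S] [Fintype T] (C : Circuit S T) (x : List S) :
    (evalMachine S T).Outputs (zipOpt x C.encode) (C.eval x)
      (100 * (x.length + C.encode.length + 1) ^ 2) := by
  have hl := length_zipOpt_le x C.encode
  have hout := length_out_foldl_next C.encode (EvalState.base x [] [])
  have hsize := size_foldl_next C.encode (EvalState.base x [] [])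
  set st := C.encode.foldl EvalState.next (EvalState.base x [] []) with hst
  have hst' : st.finish = EvalState.base x (C.values x) (C.eval x).reverse :=
    EvalState.finish_foldl_circuit C x
  have hsize' := st.size_finish_le
  have hout' := st.length_out_finish_le
  have hs : (EvalState.base x [] [] : EvalState S T).size = x.length := by
    simp [EvalState.size, EvalState.base]
  have ho : (EvalState.base x [] [] : EvalState S T).out.length = 0 := rfl
  rw [hs] at hsize
  rw [ho] at hout
  rw [hst', EvalState.size] at hsize'
  rw [hst'] at hout'
  simp only [EvalState.base, List.length_nil, List.length_reverse] at hsize' hout'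
  rw [Machine.Outputs, show (zipOpt x C.encode).map (evalMachine S T).eA.symm = _ from
    List.map_id _, show (C.eval x).map (evalMachine S T).eB.symm = _ from List.map_id _]
  change wp (.seq evalSplit _) _ ⟨none, none, none, false, none, none, none, none⟩
    (single .inp (zipOpt x C.encode)) 0
  rw [EvalStack.single_inp]
  refine wp_seq.2 (wp_evalSplit (filterMap_fst_zipOpt _ _) (filterMap_snd_zipOpt _ _) ?_)
  refine wp_seq.2 (wp_forEach_evalNext _ _ _ fun t₁ ht₁ => ?_)
  refine wp_seq.2 (wp_evalFinish fun t₂ ht₂ => ?_)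
  rw [← hst, hst']
  rw [← hst] at ht₂
  -- The values and the input are discarded, as all stacks but the output must end empty.
  refine wp_seq.2 (wp_move (by simp) (fun _ => none) (by simp) (by simp) (by simp) ?_)
  refine wp_seq.2 (wp_move (by simp) (fun _ => none) (by simp) (by simp) (by simp) ?_)
  refine wp_move (by simp) some (by simp) (by simp) (by simp) ?_
  refine ⟨rfl, ?_, ?_⟩
  · refine Eq.trans ?_ (EvalStack.single_out _).symm
    simp [EvalState.contents, EvalState.base]
    rfl
  · simp only [EvalState.contents, EvalState.base, EvalStack.stk_val, EvalStack.stk_sym,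
      EvalStack.stk_outR, EvalStack.update_val, EvalStack.update_valR, EvalStack.update_sym,
      EvalStack.update_symR, List.length_reverse]
    rw [hs] at ht₁
    have h₁ := Nat.mul_le_mul_right (9 * (x.length + C.encode.length) + 42)
      (Nat.le_add_left C.encode.length x.length)
    generalize C.encode.length * (9 * (x.length + C.encode.length) + 42) = y at *
    generalize hk : x.length + C.encode.length = k at *
    have h₂ : 100 * (k + 1) ^ 2 = k * (9 * k + 42) + 91 * (k * k) + 158 * k + 100 := by ring
    have h₃ : k ≤ k * k := Nat.le_mul_self k
    omega

end

theorem polyTimeOn_eval [Fintype S] [Fintype T] {X : Type} {sz : X → ℕ} {x : X → List S}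
    {C : X → Circuit S T} (q q' : Polynomial ℕ) (hq : ∀ i, (x i).length ≤ q.eval (sz i))
    (hq' : ∀ i, (C i).encode.length ≤ q'.eval (sz i)) :
    PolyTimeOn sz (fun i => zipOpt (x i) (C i).encode) fun i => (C i).eval (x i) := by
  refine ⟨evalMachine S T, 100 * (q + q' + 1) ^ 2, fun i => (evalMachine_outputs _ _).mono ?_⟩
  have := hq i
  have := hq' i
  simp only [Polynomial.eval_add, Polynomial.eval_mul, Polynomial.eval_ofNat, Polynomial.eval_pow,
    Polynomial.eval_one]
  gcongr

end Evaluator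

open Prog

/-! ### The running time of machines in logarithmic space -/

namespace Transducer

variable {O : Type} (M : Transducer O) (n : ℕ)

theorem after_succ (k : ℕ) : M.after n (k + 1) = (M.after n k).bind (M.step n) := by
  rw [after, Function.iterate_succ_apply', ← after]

theorem exists_after_of_le {k j : ℕ} {cfg : M.Cfg} (h : M.after n k = some cfg) (hj : j ≤ k) :
    ∃ c, M.after n j = some c := by
  induction k generalizing cfg with
  | zero => exact ⟨cfg, by rwa [Nat.le_zero.1 hj]⟩
  | succ k ih =>
    rcases hj.lt_or_eq with hj | rfl
    · rw [after_succ] at h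
      cases h' : M.after n k with
      | none => rw [h'] at h; cases h
      | some c => exact ih h' (Nat.lt_succ_iff.1 hj)
    · exact ⟨cfg, h⟩

/-- A configuration without the output. -/
def Cfg.core {M : Transducer O} (c : M.Cfg) : M.Q × ℕ × (ℕ → Option M.Γ) × ℕ :=
  (c.state, c.inHead, c.work, c.workHead)

/-- The output tape is write-only and does not influence the run. -/
theorem core_step {M : Transducer O} {n : ℕ} {c d : M.Cfg} (h : c.core = d.core) :
    (M.step n c).map Cfg.core = (M.step n d).map Cfg.core := by
  obtain ⟨q, i, w, p, o⟩ := c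
  obtain ⟨q', i', w', p', o'⟩ := d
  simp only [Cfg.core, Prod.mk.injEq] at h
  obtain ⟨rfl, rfl, rfl, rfl⟩ := h
  simp only [step, Option.map_map]
  rfl

theorem core_after {M : Transducer O} {n i j : ℕ}
    (h : (M.after n i).map Cfg.core = (M.after n j).map Cfg.core) (m : ℕ) :
    (M.after n (i + m)).map Cfg.core = (M.after n (j + m)).map Cfg.core := by
  induction m with
  | zero => exact h
  | succ m ih =>
    rw [← add_assoc, ← add_assoc, after_succ, after_succ]
    cases hi : M.after n (i + m) <;> cases hj : M.after n (j + m) <;> rw [hi, hj] at ih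
    · simp at ih
    · simp at ih
    · simp only [Option.map_some, Option.some.injEq] at ih
      exact core_step ih

/-- The cells that are not reached by the head remain blank, and the input head does not leave the
end markers. -/
theorem after_bounds {M : Transducer O} {n W : ℕ}
    (hW : ∀ k cfg, M.after n k = some cfg → cfg.workHead < W) {k : ℕ} {cfg : M.Cfg}
    (h : M.after n k = some cfg) : cfg.inHead < n + 2 ∧ ∀ i, W ≤ i → cfg.work i = none := by
  induction k generalizing cfg with
  | zero =>
    have : M.init = cfg := by simpa [after] using h
    subst this
    simp [init]
  | succ k ih =>
    rw [after_succ] at h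
    cases hk : M.after n k with
    | none => rw [hk] at h; cases h
    | some c =>
      rw [hk, Option.bind_some, step, Option.map_eq_some_iff] at h
      obtain ⟨r, -, rfl⟩ := h
      have h₁ := ih hk
      have h₂ := hW _ _ hk
      refine ⟨by simp only; omega, fun i hi => ?_⟩
      simp only
      rw [Function.update_of_ne (by omega), h₁.2 i hi]

attribute [instance] Transducer.finQ Transducer.finΓ

/-- If a configuration, output disregarded, occurred twice, the machine would never halt. Hence the
`k + 1` configurations are distinct, and the factors count states, input positions, tape contents
and work positions. -/
theorem halting_time_le {M : Transducer O} {n W : ℕ}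
    (hW : ∀ k cfg, M.after n k = some cfg → cfg.workHead < W) {k : ℕ} {cfg : M.Cfg}
    (h : M.after n k = some cfg) (hs : M.step n cfg = none) :
    k + 1 ≤ Fintype.card M.Q * ((n + 2) * ((Fintype.card M.Γ + 1) ^ W * W)) := by
  have hex : ∀ j : Fin (k + 1), ∃ c, M.after n j = some c := fun j =>
    M.exists_after_of_le n h (Nat.lt_succ_iff.1 j.2)
  choose c hc using hex
  let f : Fin (k + 1) → M.Q × Fin (n + 2) × (Fin W → Option M.Γ) × Fin W := fun j =>
    ((c j).state, ⟨(c j).inHead, (after_bounds hW (hc j)).1⟩, fun i => (c j).work i,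
      ⟨(c j).workHead, hW _ _ (hc j)⟩)
  have key : ∀ i j : Fin (k + 1), i < j → f i ≠ f j := by
    intro i j hij hf
    simp only [f, Prod.mk.injEq, Fin.mk.injEq] at hf
    obtain ⟨h₁, h₂, h₃, h₄⟩ := hf
    have hcore : (M.after n i).map Cfg.core = (M.after n j).map Cfg.core := by
      rw [hc, hc, Option.map_some, Option.map_some, Cfg.core, Cfg.core, h₁, h₂, h₄]
      congr 4
      funext m
      by_cases hm : m < W
      · exact congrFun h₃ ⟨m, hm⟩
      · rw [(after_bounds hW (hc i)).2 m (by omega), (after_bounds hW (hc j)).2 m (by omega)]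
    have hj := j.2
    have hij' : (i : ℕ) < j := hij
    -- The shift takes the later time `j` past the halt, to `k + 1`, but the earlier time `i` only
    -- to at most `k`, where the run is still defined.
    have h₅ := core_after hcore (k - j + 1)
    rw [show (j : ℕ) + (k - j + 1) = k + 1 by omega, after_succ M n k, h, Option.bind_some, hs] at h₅
    obtain ⟨d, hd⟩ := M.exists_after_of_le n h (show (i : ℕ) + (k - j + 1) ≤ k by omega)
    rw [hd] at h₅
    simp at h₅
  have hinj : Function.Injective f := by
    intro i j hf
    rcases lt_trichotomy i j with h | h | h
    · exact absurd hf (key i j h)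
    · exact h
    · exact absurd hf.symm (key j i h)
  simpa using Fintype.card_le_of_injective f hinj

end Transducer

/-- The number of tape contents is polynomial: with `g ≤ 2 ^ g`, the power of `g` turns into the
power `g * c` of `2 ^ (log n + 1)`, which is at most `2 * (n + 1)`. -/
theorem LogSpaceComputable.exists_polynomial {O : Type} {F : ℕ → List O}
    (h : LogSpaceComputable F) : ∃ (M : Transducer O) (p : Polynomial ℕ), ∀ n,
      ∃ k ≤ p.eval n, ∃ cfg, M.after n k = some cfg ∧ M.step n cfg = none ∧ cfg.out = F n := by
  obtain ⟨M, c, h⟩ := h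
  set g := Fintype.card M.Γ + 1
  refine ⟨M, Polynomial.C (Fintype.card M.Q) * ((Polynomial.X + 2) *
    ((2 * (Polynomial.X + 1)) ^ (g * c) * (Polynomial.C c * (Polynomial.X + 1)))), fun n => ?_⟩
  obtain ⟨hW, k, cfg, hk, hs, ho⟩ := h n
  refine ⟨k, ?_, cfg, hk, hs, ho⟩
  have h₁ := Transducer.halting_time_le hW hk hs
  have h₂ : g ^ (c * (Nat.log 2 n + 1)) ≤ (2 * (n + 1)) ^ (g * c) := by
    calc g ^ (c * (Nat.log 2 n + 1)) ≤ (2 ^ g) ^ (c * (Nat.log 2 n + 1)) :=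
          Nat.pow_le_pow_left Nat.lt_two_pow_self.le _
      _ = (2 ^ Nat.log 2 n * 2) ^ (g * c) := by
          rw [← pow_succ, ← pow_mul, ← pow_mul]
          congr 1
          ring
      _ ≤ (2 * (n + 1)) ^ (g * c) := by
          refine Nat.pow_le_pow_left ?_ _
          have : 2 ^ Nat.log 2 n ≤ n + 1 := by
            rcases Nat.eq_zero_or_pos n with rfl | hn
            · simp
            · exact (Nat.pow_log_le_self 2 hn.ne').trans (Nat.le_succ n)
          omega
  have h₃ : c * (Nat.log 2 n + 1) ≤ c * (n + 1) := by
    have := Nat.log_le_self 2 n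
    gcongr
  simp only [Polynomial.eval_mul, Polynomial.eval_C, Polynomial.eval_add, Polynomial.eval_X,
    Polynomial.eval_ofNat, Polynomial.eval_pow, Polynomial.eval_one]
  refine (Nat.le_succ k).trans (h₁.trans ?_)
  gcongr

/-! ### Simulation of such machines -/

/-- The stacks of the simulation: the input, the two sides of the input head, the two sides of the
work head, and the output. -/
inductive SimStack
  | inp
  | left
  | right
  | workL
  | workR
  | outR
  | out
  deriving DecidableEq

instance : Fintype SimStack :=
  ⟨{.inp, .left, .right, .workL, .workR, .outR, .out}, fun k => by cases k <;> decide⟩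

namespace SimStack

variable {O : Type}

/-- The alphabets of the stacks of the simulation. -/
@[reducible] def Γ (S : Type) (M : Transducer O) : SimStack → Type
  | inp => S
  | left => Unit
  | right => Unit
  | workL => Option M.Γ
  | workR => Option M.Γ
  | outR => O
  | out => O

variable {S : Type} {M : Transducer O}

/-- The contents of the stacks of the simulation. -/
def stk (l₁ : List S) (l₂ l₃ : List Unit) (l₄ l₅ : List (Option M.Γ)) (l₆ l₇ : List O) :
    Stacks (Γ S M)
  | inp => l₁
  | left => l₂
  | right => l₃
  | workL => l₄
  | workR => l₅
  | outR => l₆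
  | out => l₇

variable (l₁ : List S) (l₂ l₃ : List Unit) (l₄ l₅ : List (Option M.Γ)) (l₆ l₇ : List O)

@[simp] theorem stk_inp : stk l₁ l₂ l₃ l₄ l₅ l₆ l₇ inp = l₁ := rfl
@[simp] theorem stk_left : stk l₁ l₂ l₃ l₄ l₅ l₆ l₇ left = l₂ := rfl
@[simp] theorem stk_right : stk l₁ l₂ l₃ l₄ l₅ l₆ l₇ right = l₃ := rfl
@[simp] theorem stk_workL : stk l₁ l₂ l₃ l₄ l₅ l₆ l₇ workL = l₄ := rfl
@[simp] theorem stk_workR : stk l₁ l₂ l₃ l₄ l₅ l₆ l₇ workR = l₅ := rfl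
@[simp] theorem stk_outR : stk l₁ l₂ l₃ l₄ l₅ l₆ l₇ outR = l₆ := rfl
@[simp] theorem stk_out : stk l₁ l₂ l₃ l₄ l₅ l₆ l₇ out = l₇ := rfl

@[simp] theorem update_inp (l) : Function.update (stk l₁ l₂ l₃ l₄ l₅ l₆ l₇) inp l =
    stk l l₂ l₃ l₄ l₅ l₆ l₇ := by
  funext k; cases k <;> simp

@[simp] theorem update_left (l) : Function.update (stk l₁ l₂ l₃ l₄ l₅ l₆ l₇) left l =
    stk l₁ l l₃ l₄ l₅ l₆ l₇ := by
  funext k; cases k <;> simp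

@[simp] theorem update_right (l) : Function.update (stk l₁ l₂ l₃ l₄ l₅ l₆ l₇) right l =
    stk l₁ l₂ l l₄ l₅ l₆ l₇ := by
  funext k; cases k <;> simp

@[simp] theorem update_workL (l) : Function.update (stk l₁ l₂ l₃ l₄ l₅ l₆ l₇) workL l =
    stk l₁ l₂ l₃ l l₅ l₆ l₇ := by
  funext k; cases k <;> simp

@[simp] theorem update_workR (l) : Function.update (stk l₁ l₂ l₃ l₄ l₅ l₆ l₇) workR l =
    stk l₁ l₂ l₃ l₄ l l₆ l₇ := by
  funext k; cases k <;> simp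

@[simp] theorem update_outR (l) : Function.update (stk l₁ l₂ l₃ l₄ l₅ l₆ l₇) outR l =
    stk l₁ l₂ l₃ l₄ l₅ l l₇ := by
  funext k; cases k <;> simp

@[simp] theorem update_out (l) : Function.update (stk l₁ l₂ l₃ l₄ l₅ l₆ l₇) out l =
    stk l₁ l₂ l₃ l₄ l₅ l₆ l := by
  funext k; cases k <;> simp

theorem single_inp : (single inp l₁ : Stacks (Γ S M)) = stk l₁ [] [] [] [] [] [] := by
  funext k; cases k <;> simp [single]

theorem single_out : (single out l₇ : Stacks (Γ S M)) = stk [] [] [] [] [] [] l₇ := by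
  funext k; cases k <;> simp [single]

end SimStack

/-! ### The simulating program -/

section Simulation

variable {S O : Type} {M : Transducer O}

instance : Finite Move :=
  Finite.of_surjective (fun i : Fin 3 => if i = 0 then Move.left else if i = 1 then .stay else .right)
    fun m => by cases m; exacts [⟨0, rfl⟩, ⟨1, rfl⟩, ⟨2, rfl⟩]

noncomputable instance : Fintype Move := Fintype.ofFinite _

/-- Two stacks contain the cells before the head (in reverse order) and the other cells. -/
def TapeRep {γ : Type} (l r : List (Option γ)) (f : ℕ → Option γ) (h : ℕ) : Prop :=
  l.length = h ∧ ∀ i, ((l.reverse ++ r)[i]?).join = f i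

namespace TapeRep

variable {γ : Type} {l r : List (Option γ)} {f : ℕ → Option γ} {h : ℕ}

theorem head (H : TapeRep l r f h) : r.head?.join = f h := by
  rw [← H.2 h, ← H.1]
  rw [List.getElem?_append_right (by simp)]
  cases r <;> simp

theorem write (H : TapeRep l r f h) (w : Option γ) :
    TapeRep l (w :: r.tail) (Function.update f h w) h := by
  refine ⟨H.1, fun i => ?_⟩
  rcases lt_trichotomy i h with hi | rfl | hi
  · rw [Function.update_of_ne hi.ne, ← H.2 i, List.getElem?_append_left (by simp [H.1, hi]),
      List.getElem?_append_left (by simp [H.1, hi])]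
  · rw [Function.update_self, List.getElem?_append_right (by simp [H.1])]
    simp [H.1]
  · rw [Function.update_of_ne hi.ne', ← H.2 i, List.getElem?_append_right (by simp [H.1, hi.le]),
      List.getElem?_append_right (by simp [H.1, hi.le])]
    obtain ⟨m, hm⟩ : ∃ m, i - l.reverse.length = m + 1 :=
      ⟨i - l.reverse.length - 1, by simp [H.1]; omega⟩
    rw [hm]
    cases r <;> simp

theorem right {w : Option γ} (H : TapeRep l (w :: r) f h) : TapeRep (w :: l) r f (h + 1) :=
  ⟨by simp [H.1], fun i => by rw [← H.2 i]; simp⟩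

theorem left {w : Option γ} (H : TapeRep (w :: l) r f h) : TapeRep l (w :: r) f (h - 1) :=
  ⟨by simp [← H.1], fun i => by rw [← H.2 i]; simp⟩

end TapeRep

/-- The memory of the simulation. -/
structure SimMem (S : Type) (M : Transducer O) where
  state : M.Q
  run : Bool
  atLeft : Bool
  atRight : Bool
  inMove : Move
  workMove : Move
  unit : Option Unit
  cell : Option (Option M.Γ)
  sym : Option S
  out : Option O

instance [Finite S] [Finite O] : Finite (SimMem S M) :=
  Finite.of_injective (fun m => (m.state, m.run, m.atLeft, m.atRight, m.inMove, m.workMove, m.unit,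
    m.cell, m.sym, m.out)) fun x y h => by cases x; cases y; simpa using h

noncomputable instance [Finite S] [Finite O] : Fintype (SimMem S M) := Fintype.ofFinite _

/-- The symbol on the input tape, if it is known whether the head is at an end marker. -/
def scanOf (l r : Bool) : Scan := if l then .leftEnd else if r then .rightEnd else .one

/-- The program that determines the next transition. -/
def simFetch : Prog (SimStack.Γ S M) (SimMem S M) :=
  .seq (.peek .left fun v a => { v with atLeft := a.isNone }) <|
  .seq (.peek .right fun v a => { v with atRight := a.isNone }) <|
  .seq (.pop .workR fun v a => { v with cell := a }) <|
  .load fun v => match M.δ v.state (scanOf v.atLeft v.atRight) v.cell.join with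
    | none => { v with run := false }
    | some r => { v with
        state := r.1, cell := some r.2.1, inMove := r.2.2.1, workMove := r.2.2.2.1,
        out := r.2.2.2.2 }

/-- The program that moves the input head. -/
noncomputable def simIn : Prog (SimStack.Γ S M) (SimMem S M) :=
  .switch SimMem.inMove fun m => match m with
    | .left => .seq (.pop .left fun v a => { v with unit := a }) (.push .right fun v => v.unit)
    | .stay => .load id
    | .right => .seq (.pop .right fun v a => { v with unit := a }) (.push .left fun v => v.unit)

/-- The program that writes a symbol on the work tape and moves the work head. -/
noncomputable def simWork : Prog (SimStack.Γ S M) (SimMem S M) :=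
  .switch SimMem.workMove fun m => match m with
    | .left => .seq (.push .workR fun v => v.cell) <|
        .seq (.pop .workL fun v a => { v with cell := a }) (.push .workR fun v => v.cell)
    | .stay => .push .workR fun v => v.cell
    | .right => .push .workL fun v => v.cell

/-- The program that performs a transition. -/
noncomputable def simPerform : Prog (SimStack.Γ S M) (SimMem S M) :=
  .seq (.push .outR fun v => v.out) <| .seq simIn simWork

/-- The program that simulates the machine until it halts. -/
noncomputable def simLoop : Prog (SimStack.Γ S M) (SimMem S M) :=
  .loop SimMem.run <| .seq simFetch <| .switch SimMem.run fun b => if b then simPerform else .load id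

/-- The stacks `l` and `r` represent an input head at position `p` on input `1ⁿ`. -/
def HeadRep (l r : List Unit) (n p : ℕ) : Prop := l.length = p ∧ l.length + r.length = n + 1

/-- The `n + 2` positions are the ways to cut a row of `n + 1` units in two; an end marker is seen
where one side is empty. -/
theorem HeadRep.scan {l r : List Unit} {n p : ℕ} (h : HeadRep l r n p) :
    scanOf l.head?.isNone r.head?.isNone = scan n p := by
  obtain ⟨rfl, h⟩ := h
  cases l with
  | nil => simp [scanOf, SublinearTime.scan]
  | cons a l =>
    cases r with
    | nil => simp [scanOf, SublinearTime.scan] at h ⊢; omega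
    | cons b r => simp [scanOf, SublinearTime.scan] at h ⊢; omega

variable {Q : SimMem S M → Stacks (SimStack.Γ S M) → ℕ → Prop}

/-- Popping an empty stack gives `none`, and pushing `none` does nothing; this makes the head stay
at either end marker. -/
theorem wp_simIn {n p : ℕ} {t : ℕ} {v : SimMem S M} {l₂ l₃ : List Unit}
    {l₄ l₅ : List (Option M.Γ)} {l₆ : List O} (hhead : HeadRep l₂ l₃ n p)
    {m : Move} (hm : v.inMove = m)
    (hQ : ∀ u l₂ l₃ t', HeadRep l₂ l₃ n (min (m.apply p) (n + 1)) → t' ≤ t + 3 →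
      Q { v with unit := u } (SimStack.stk [] l₂ l₃ l₄ l₅ l₆ []) t') :
    wp simIn Q v (SimStack.stk [] l₂ l₃ l₄ l₅ l₆ []) t := by
  rw [simIn, wp_switch, hm]
  obtain ⟨hp, hl⟩ := hhead
  cases m
  · simp only [wp_seq, wp_pop, wp_push, SimStack.stk_left, SimStack.update_left,
      SimStack.stk_right, SimStack.update_right]
    refine hQ _ _ _ _ ?_ (by omega)
    cases l₂ <;> simp_all [HeadRep, Move.apply] <;> omega
  · simp only [wp_load, id]
    exact hQ v.unit _ _ _ ⟨by simp [Move.apply]; omega, hl⟩ (by omega)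
  · simp only [wp_seq, wp_pop, wp_push, SimStack.stk_left, SimStack.update_left,
      SimStack.stk_right, SimStack.update_right]
    refine hQ _ _ _ _ ?_ (by omega)
    cases l₃ <;> simp_all [HeadRep, Move.apply]
    omega

theorem wp_simWork {f : ℕ → Option M.Γ} {h : ℕ} {w : Option M.Γ} {t : ℕ} {v : SimMem S M}
    {l₂ l₃ : List Unit} {l₄ l₅ : List (Option M.Γ)} {l₆ : List O}
    (htape : TapeRep l₄ (w :: l₅) f h) (hv : v.cell = some w)
    {m : Move} (hm : v.workMove = m)
    (hQ : ∀ c l₄' l₅' t', TapeRep l₄' l₅' f (m.apply h) →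
      l₄'.length + l₅'.length ≤ l₄.length + l₅.length + 1 → t' ≤ t + 4 →
      Q { v with cell := c } (SimStack.stk [] l₂ l₃ l₄' l₅' l₆ []) t') :
    wp simWork Q v (SimStack.stk [] l₂ l₃ l₄ l₅ l₆ []) t := by
  rw [simWork, wp_switch, hm]
  cases m
  · simp only [wp_seq, wp_pop, wp_push, SimStack.stk_workL, SimStack.update_workL,
      SimStack.stk_workR, SimStack.update_workR, hv, Option.toList_some, List.cons_append,
      List.nil_append]
    cases l₄ with
    | nil =>
      -- The head is on cell `0`: nothing can be popped, and the truncated `0 - 1` agrees with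
      -- staying.
      refine hQ _ _ _ _ ?_ (by simp) (by omega)
      have := htape.1
      subst this
      exact htape
    | cons a l₄ =>
      exact hQ _ _ _ _ htape.left (by simp; omega) (by omega)
  · simp only [wp_push, SimStack.stk_workR, SimStack.update_workR, hv]
    exact hQ v.cell _ _ _ htape (by simp; omega) (by omega)
  · simp only [wp_push, SimStack.stk_workL, SimStack.update_workL, hv]
    exact hQ v.cell _ _ _ htape.right (by simp; omega) (by omega)

/-- The postcondition keeps the output exactly, but only lengths of the other stacks: they merely
have to be emptied afterwards. -/
theorem wp_simLoop {n k : ℕ} {c c' : M.Cfg} {t : ℕ} {v : SimMem S M} {l₂ l₃ : List Unit}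
    {l₄ l₅ : List (Option M.Γ)}
    (h : (fun o : Option M.Cfg => o.bind (M.step n))^[k] (some c) = some c')
    (hc' : M.step n c' = none) (hv : v.state = c.state) (hrun : v.run = true)
    (hhead : HeadRep l₂ l₃ n c.inHead) (htape : TapeRep l₄ l₅ c.work c.workHead)
    (hQ : ∀ v l₂ l₃ l₄' l₅' t', l₂.length + l₃.length = n + 1 →
      l₄'.length + l₅'.length ≤ l₄.length + l₅.length + k → t' ≤ t + 20 * (k + 1) →
      Q v (SimStack.stk [] l₂ l₃ l₄' l₅' c'.out.reverse []) t') :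
    wp simLoop Q v (SimStack.stk [] l₂ l₃ l₄ l₅ c.out.reverse []) t := by
  induction k generalizing c v l₂ l₃ l₄ l₅ t with
  | zero =>
    obtain rfl : c = c' := by simpa using h
    have hδ : M.δ c.state (scan n c.inHead) (c.work c.workHead) = none := by
      simpa [Transducer.step] using hc'
    rw [simLoop, wp_loop, if_pos hrun]
    simp only [simFetch, wp_seq, wp_peek, wp_pop, wp_load, SimStack.stk_left, SimStack.stk_right,
      SimStack.stk_workR, SimStack.update_workR, hv, hhead.scan, htape.head, hδ, wp_switch, wp_loop,
      Bool.false_eq_true, if_false, id]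
    -- The fetch has removed the scanned cell, so the stacks need no longer represent the tape.
    exact hQ _ _ _ _ _ _ hhead.2 (by simp) (by omega)
  | succ k ih =>
    rw [Function.iterate_succ_apply, Option.bind_some] at h
    cases hδ : M.δ c.state (scan n c.inHead) (c.work c.workHead) with
    | none =>
      exfalso
      have h₀ : ∀ k, (fun o : Option M.Cfg => o.bind (M.step n))^[k] none = none := fun k => by
        induction k with
        | zero => rfl
        | succ n ih => rw [Function.iterate_succ_apply]; exact ih
      rw [Transducer.step, hδ, Option.map_none, h₀] at h
      cases h
    | some r =>
      obtain ⟨q, w, mi, mw, o⟩ := r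
      rw [Transducer.step, hδ, Option.map_some] at h
      rw [simLoop, wp_loop, if_pos hrun]
      simp only [simFetch, wp_seq, wp_peek, wp_pop, wp_load, SimStack.stk_left, SimStack.stk_right,
        SimStack.stk_workR, SimStack.update_workR, hv, hhead.scan, htape.head, hδ, wp_switch,
        hrun, if_true, simPerform, wp_push, SimStack.stk_outR, SimStack.update_outR]
      have hout : o.toList ++ c.out.reverse = (c.out ++ o.toList).reverse := by
        cases o <;> simp
      have hwrite := htape.write w
      rw [hout]
      refine wp_simIn hhead rfl fun u l₂' l₃' t₁ hhead' ht₁ => ?_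
      refine wp_simWork hwrite rfl rfl fun a l₄' l₅' t₂ htape' hlen ht₂ => ?_
      have hlen' : l₅.tail.length ≤ l₅.length := by simp
      refine ih h rfl rfl hhead' htape' fun v' l₂'' l₃'' l₄'' l₅'' t₃ h₁ h₂ h₃ =>
        hQ _ _ _ _ _ _ h₁ (by omega) (by omega)

/-- The machine that simulates `M` on input `1ⁿ`, where `n` is the length of its input. -/
noncomputable def simMachine (S : Type) [Fintype S] [Fintype O] (M : Transducer O) :
    Machine S O where
  K := SimStack
  k₀ := .inp
  k₁ := .out
  Γ := SimStack.Γ S M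
  eA := Equiv.refl _
  eB := Equiv.refl _
  σ := SimMem S M
  init := ⟨M.start, true, false, false, .stay, .stay, none, none, none, none⟩
  prog :=
    .seq (move .inp .right (fun a v => { v with sym := a }) (fun v => v.sym.isSome)
      fun _ => some ()) <|
    .seq (.push .right fun _ => some ()) <|
    .seq simLoop <|
    .seq (move .left .right (fun a v => { v with unit := a }) (fun v => v.unit.isSome)
      fun _ => none) <|
    .seq (move .right .left (fun a v => { v with unit := a }) (fun v => v.unit.isSome)
      fun _ => none) <|
    .seq (move .workL .workR (fun a v => { v with cell := a }) (fun v => v.cell.isSome)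
      fun _ => none) <|
    .seq (move .workR .workL (fun a v => { v with cell := a }) (fun v => v.cell.isSome)
      fun _ => none) <|
    .seq (move .outR .out (fun a v => { v with out := a }) (fun v => v.out.isSome)
      fun v => v.out) <|
    .load fun _ => ⟨M.start, true, false, false, .stay, .stay, none, none, none, none⟩

theorem length_out_after {n k : ℕ} {c : M.Cfg} (h : M.after n k = some c) :
    c.out.length ≤ k := by
  induction k generalizing c with
  | zero =>
    have : M.init = c := by simpa [Transducer.after] using h
    subst this
    simp [Transducer.init]
  | succ k ih =>
    rw [M.after_succ] at h
    cases hk : M.after n k with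
    | none => rw [hk] at h; cases h
    | some d =>
      rw [hk, Option.bind_some, Transducer.step, Option.map_eq_some_iff] at h
      obtain ⟨r, -, rfl⟩ := h
      have := ih hk
      have h₁ : r.2.2.2.2.toList.length ≤ 1 := by cases r.2.2.2.2 <;> simp
      simp only [List.length_append]
      omega

theorem simMachine_outputs [Fintype S] [Fintype O] {k : ℕ} {c : M.Cfg} (x : List S)
    (h : M.after x.length k = some c) (hc : M.step x.length c = none) :
    (simMachine S M).Outputs x c.out (9 * x.length + 29 * k + 50) := by
  rw [Machine.Outputs, show x.map (simMachine S M).eA.symm = _ from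
    List.map_id _, show c.out.map (simMachine S M).eB.symm = _ from List.map_id _]
  change wp (.seq _ _) _ (⟨M.start, true, false, false, .stay, .stay, none, none, none, none⟩ :
    SimMem S M) (single (Γ := SimStack.Γ S M) .inp x) 0
  rw [SimStack.single_inp]
  refine wp_seq.2 (wp_move (by simp) (fun _ => some ()) (by simp) (by simp) (by simp) ?_)
  -- One unit per input symbol and this additional one give the `n + 1` units of `HeadRep`.
  refine wp_seq.2 (wp_push.2 (wp_seq.2 ?_))
  simp only [SimStack.stk_inp, SimStack.update_inp, SimStack.stk_right, SimStack.update_right]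
  have hout := length_out_after h
  refine wp_simLoop (c := M.init) h hc rfl rfl ⟨rfl, ?_⟩ ⟨rfl, fun i => ?_⟩ ?_
  · simp
  · simp [Transducer.init]
  intro v l₂ l₃ l₄ l₅ t h₁ h₂ h₃
  refine wp_seq.2 (wp_move (by simp) (fun _ => none) (by simp) (by simp) (by simp) ?_)
  refine wp_seq.2 (wp_move (by simp) (fun _ => none) (by simp) (by simp) (by simp) ?_)
  refine wp_seq.2 (wp_move (by simp) (fun _ => none) (by simp) (by simp) (by simp) ?_)
  refine wp_seq.2 (wp_move (by simp) (fun _ => none) (by simp) (by simp) (by simp) ?_)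
  refine wp_seq.2 (wp_move (by simp) some (by simp) (by simp) (by simp) ?_)
  refine wp_load.2 ⟨rfl, ?_, ?_⟩
  · refine Eq.trans ?_ (SimStack.single_out _).symm
    simp
    rfl
  · simp only [SimStack.stk_left, SimStack.update_left, SimStack.stk_right, SimStack.update_right,
      SimStack.stk_workL, SimStack.update_workL, SimStack.stk_workR, SimStack.update_workR,
      SimStack.stk_outR, List.length_reverse, filterMap_none, List.reverse_nil, List.nil_append,
      List.length_nil, zero_add] at h₂ ⊢
    omega

end Simulation

/-! ### Functions in NC are computable in polynomial time -/

/-- The description of the circuit is written by a polynomial-time run with at most one symbol per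
step, so it has polynomial length. Pairing it with the input gives the word on which the evaluator
works. -/
theorem NCComputable.polyTimeOn {S T : Type} [Fintype S] [Fintype T] {f : List S → List T}
    (h : NCComputable f) : PolyTimeOn List.length id f := by
  obtain ⟨C, -, -, hC, hf⟩ := h
  obtain ⟨M, p, hM⟩ := hC.exists_polynomial
  choose k hk cfg h₁ h₂ h₃ using hM
  have hlen (x : List S) : (C x.length).encode.length ≤ p.eval x.length := by
    rw [← h₃]
    exact (length_out_after (h₁ _)).trans (hk _)
  have hdesc : PolyTimeOn List.length id fun x : List S => (C x.length).encode := by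
    refine ⟨simMachine S M, 9 * Polynomial.X + 29 * p + 50, fun x => ?_⟩
    change (simMachine S M).Outputs x (C x.length).encode _
    rw [← h₃]
    refine (simMachine_outputs x (h₁ _) (h₂ _)).mono ?_
    have := hk x.length
    simp only [Polynomial.eval_add, Polynomial.eval_mul, Polynomial.eval_ofNat, Polynomial.eval_X]
    omega
  have hid : PolyTimeOn List.length id fun x : List S => x :=
    PTimeComputable.polyTimeOn ⟨Turing.idComputableInPolyTime id⟩ Polynomial.X fun x => by simp
  have hzip := hid.zip hdesc Polynomial.X Polynomial.X p (fun x => by simp) (fun x => by simp) hlen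
  have := hzip.comp (polyTimeOn_eval Polynomial.X p (fun x => by simp) hlen) (Polynomial.X + p)
    fun x => (length_zipOpt_le _ _).trans (by
      have := hlen x
      simp only [Polynomial.eval_add, Polynomial.eval_X]
      omega)
  simpa only [hf] using this

/-! ### Composition of random-access Turing machines -/

namespace RATM

attribute [instance] RATM.finQ RATM.finW RATM.finΓ

/-- The configuration `c'` is reached from `c` in `n` steps. -/
def Reach {A B C : Type} (M : RATM A B C) (x : List A) (y : List B) (n : ℕ) (c c' : M.Cfg) : Prop :=
  (fun o : Option M.Cfg => o.bind (M.step x y))^[n] (some c) = some c'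

section Reach

variable {A B C : Type} {M : RATM A B C} {x : List A} {y : List B} {m n : ℕ} {c c' c'' : M.Cfg}

theorem Reach.refl : M.Reach x y 0 c c := rfl

theorem Reach.trans (h : M.Reach x y m c c') (h' : M.Reach x y n c' c'') :
    M.Reach x y (m + n) c c'' := by
  rw [Reach, add_comm, Function.iterate_add_apply]
  rw [Reach] at h
  rw [h]
  exact h'

theorem Reach.single (h : M.step x y c = some c') : M.Reach x y 1 c c' := h

theorem reach_succ : M.Reach x y (n + 1) c c'' ↔ ∃ c', M.Reach x y n c c' ∧ M.step x y c' = some c'' := by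
  rw [Reach, Function.iterate_succ_apply', Option.bind_eq_some_iff]
  rfl

theorem step_of_action {a : Action M.Q M.W M.Γ} (h : M.action x y c = some a) :
    M.step x y c = some (M.perform c a) := by
  rw [step, h, Option.map_some]

/-- After `n` steps only the first `n` cells of the index tapes can be written. -/
theorem Reach.idx_bounds (h : M.Reach x y n M.init c) (t : Tape M.W) :
    c.idxHead t ≤ n ∧ ∀ i, n ≤ i → c.idx t i = none := by
  induction n generalizing c with
  | zero =>
    have : M.init = c := by simpa [Reach] using h
    subst this
    simp [init]
  | succ n ih =>
    obtain ⟨c', h', hs⟩ := reach_succ.1 h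
    rw [step, Option.map_eq_some_iff] at hs
    obtain ⟨a, -, rfl⟩ := hs
    obtain ⟨h₁, h₂⟩ := ih h'
    refine ⟨?_, fun i hi => ?_⟩
    · simp only [perform]
      cases a.moveIdx t <;> simp only [Move.apply] <;> omega
    · simp only [perform]
      rw [Function.update_of_ne (by omega), h₂ i (by omega)]

end Reach

/-- Thus an access with blank index tapes returns all heads to cell `0`. -/
theorem address_blank : address (fun _ => none) = 0 := by
  have : sInf {i : ℕ | (none : Option Bool) = none} = 0 := by simp
  rw [address, this]
  rfl

/-- The states of the composition of two machines: it starts a clock, runs the first machine, moves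
the index heads to the left, clears the index tapes, moves the index heads to the left again, moves
the heads to the first cells, and runs the second machine. -/
inductive CompState (Q₁ Q₂ : Type)
  | start
  | first (q : Q₁)
  | back (again : Bool)
  | clear
  | jump
  | second (q : Q₂)

instance {Q₁ Q₂ : Type} [Finite Q₁] [Finite Q₂] : Finite (CompState Q₁ Q₂) := by
  let f : CompState Q₁ Q₂ → Option Q₁ ⊕ Option Q₂ ⊕ Bool ⊕ Unit := fun s => match s with
    | .start => .inl none
    | .first q => .inl (some q)
    | .back b => .inr (.inr (.inl b))
    | .clear => .inr (.inr (.inr ()))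
    | .jump => .inr (.inl none)
    | .second q => .inr (.inl (some q))
  exact Finite.of_injective f fun a b h => by cases a <;> cases b <;> simp_all [f]

section Comp

variable {A A' B C D : Type}

section Pick

variable {W₁ W₂ α : Type}

/-- A function on the tapes of the composition, given on the tapes of the first machine, on those of
the second one, and on the clock. -/
def pickFirst (f : Tape W₁ → α) (g : W₂ → α) (k : α) : Tape (W₁ ⊕ W₂ ⊕ Unit) → α
  | .data => f .data
  | .query => f .query
  | .work (.inl w) => f (.work w)
  | .work (.inr (.inl w)) => g w
  | .work (.inr (.inr _)) => k

/-- A function on the tapes of the composition, given on the tapes of the second machine. -/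
def pickSecond (f : Tape W₂ → α) : Tape (W₁ ⊕ W₂ ⊕ Unit) → α
  | .data => f .data
  | .query => f .query
  | .work (.inl _) => f .query
  | .work (.inr (.inl w)) => f (.work w)
  | .work (.inr (.inr _)) => f .query

/-- The tape that is used for a tape of the first machine. -/
def embFirst : Tape W₁ → Tape (W₁ ⊕ W₂ ⊕ Unit)
  | .data => .data
  | .query => .query
  | .work w => .work (.inl w)

/-- The tape that is used for a tape of the second machine; the output tape `o` of the first machine
is used for the problem part. -/
def embSecond (o : W₁) : Tape W₂ → Tape (W₁ ⊕ W₂ ⊕ Unit)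
  | .data => .data
  | .query => .work (.inl o)
  | .work w => .work (.inr (.inl w))

/-- The tape whose index tape is the clock. -/
abbrev clockTape : Tape (W₁ ⊕ W₂ ⊕ Unit) := .work (.inr (.inr ()))

@[simp] theorem pickFirst_embFirst (f : Tape W₁ → α) (g : W₂ → α) (k : α) (t : Tape W₁) :
    pickFirst f g k (embFirst t) = f t := by
  cases t <;> rfl

@[simp] theorem pickFirst_second (f : Tape W₁ → α) (g : W₂ → α) (k : α) (w : W₂) :
    pickFirst f g k (.work (.inr (.inl w))) = g w := rfl

@[simp] theorem pickFirst_clock (f : Tape W₁ → α) (g : W₂ → α) (k : α) :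
    pickFirst f g k clockTape = k := rfl

-- Tapes outside the range of `embSecond` get the value of the problem tape as a default; the
-- simulation claims nothing about their heads.
@[simp] theorem pickSecond_embSecond (o : W₁) (f : Tape W₂ → α) (t : Tape W₂) :
    pickSecond f (embSecond o t) = f t := by
  cases t <;> rfl

end Pick

/-- The action that changes nothing but the state. -/
def keep {Q W Γ : Type} (q : Q) (ws : W → Option Γ) (is : Tape W → Option Bool) : Action Q W Γ where
  next := q
  write := ws
  writeIdx := is
  move := fun _ => .stay
  moveIdx := fun _ => .stay

/-- The machine that runs `N` on the output of `M`; the data parts of both machines are written on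
top of each other. -/
@[reducible] noncomputable def comp (M : RATM A B C) (N : RATM A' C D) :
    RATM (Option A × Option A') B D where
  Q := CompState M.Q N.Q
  finQ := Fintype.ofFinite _
  W := M.W ⊕ N.W ⊕ Unit
  Γ := M.Γ ⊕ N.Γ
  outTape := .inr (.inl N.outTape)
  embed := N.embed.trans ⟨Sum.inr, Sum.inr_injective⟩
  start := .start
  isAccess := fun q => match q with
    | .first q => M.isAccess q
    | .second q => N.isAccess q
    | .jump => true
    | _ => false
  δ := fun q a b ws is => match q with
    -- The clock is an index tape because index heads are not displaced by accesses. It starts on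
    -- cell `1`, and the blank cell `0` marks its left end.
    | .start => some { keep (.first M.start) ws is with
        moveIdx := pickFirst (fun _ => .stay) (fun _ => .stay) .right }
    | .first q => match M.δ q (a.bind Prod.fst) b
          (fun w => (ws (.inl w)).bind Sum.getLeft?) (fun t => is (embFirst t)) with
        | some act => some
          { next := .first act.next
            write := Sum.elim (fun w => (act.write w).map .inl) fun w => ws (.inr w)
            writeIdx := pickFirst act.writeIdx (fun w => is (.work (.inr (.inl w)))) (some true)
            move := pickFirst act.move (fun _ => .stay) .stay
            moveIdx := pickFirst act.moveIdx (fun _ => .stay) .right }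
        | none => some { keep (.back false) ws is with
            moveIdx := pickFirst (fun _ => .stay) (fun _ => .stay) .left }
    | .back again => match is clockTape with
        | some _ => some { keep (.back again) ws is with
            moveIdx := pickFirst (fun _ => .left) (fun _ => .stay) .left }
        | none => if again then some (keep .jump ws is) else some
          { keep .clear ws is with
            writeIdx := pickFirst (fun _ => none) (fun w => is (.work (.inr (.inl w)))) none
            moveIdx := pickFirst (fun _ => .right) (fun _ => .stay) .right }
    | .clear => match is clockTape with
        | some a => some { keep .clear ws is with
            writeIdx := pickFirst (fun _ => none) (fun w => is (.work (.inr (.inl w)))) (some a)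
            moveIdx := pickFirst (fun _ => .right) (fun _ => .stay) .right }
        | none => some { keep (.back true) ws is with
            moveIdx := pickFirst (fun _ => .left) (fun _ => .stay) .left }
    | .jump => some (keep (.second N.start) ws is)
    | .second q => (N.δ q (a.bind Prod.snd)
          ((ws (.inl M.outTape)).bind (Function.partialInv fun c => Sum.inl (M.embed c)))
          (fun w => (ws (.inr (.inl w))).bind Sum.getRight?)
          (fun t => is (embSecond M.outTape t))).map fun act =>
        { next := .second act.next
          write := Sum.elim (fun w => ws (.inl w)) <|
            Sum.elim (fun w => (act.write w).map .inr) fun w => ws (.inr (.inr w))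
          writeIdx := pickSecond act.writeIdx
          move := pickSecond act.move
          moveIdx := pickSecond act.moveIdx }

variable {M : RATM A B C} {N : RATM A' C D} {x₁ : List A} {x₂ : List A'} {y : List B} {z : List C}

/-! ### Step-by-step simulation of both machines. -/

theorem getElem?_zipOpt_fst (i : ℕ) : (zipOpt x₁ x₂)[i]?.bind Prod.fst = x₁[i]? := by
  rw [getElem?_zipOpt]
  cases x₁[i]? <;> cases x₂[i]? <;> rfl

theorem getElem?_zipOpt_snd (i : ℕ) : (zipOpt x₁ x₂)[i]?.bind Prod.snd = x₂[i]? := by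
  rw [getElem?_zipOpt]
  cases x₁[i]? <;> cases x₂[i]? <;> rfl

/-- The content of the clock after `n` steps. -/
def clock (n i : ℕ) : Option Bool := if 1 ≤ i ∧ i ≤ n then some true else none

/-- The tapes of the second machine are untouched. -/
structure Untouched (c : (comp M N).Cfg) : Prop where
  head : ∀ w, c.head (.work (.inr (.inl w))) = 0
  work : ∀ w i, c.work (.inr (.inl w)) i = none
  idxHead : ∀ w, c.idxHead (.work (.inr (.inl w))) = 0
  idx : ∀ w, c.idx (.work (.inr (.inl w))) = fun _ => none

/-- The composition simulates the first machine. -/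
structure SimFirst (n : ℕ) (d : M.Cfg) (c : (comp M N).Cfg) : Prop where
  state : c.state = .first d.state
  head : ∀ t, c.head (embFirst t) = d.head t
  work : ∀ w i, c.work (.inl w) i = (d.work w i).map .inl
  idxHead : ∀ t, c.idxHead (embFirst t) = d.idxHead t
  idx : ∀ t, c.idx (embFirst t) = d.idx t
  clockHead : c.idxHead clockTape = n + 1
  clockIdx : c.idx clockTape = clock n
  untouched : Untouched c

/-- The composition simulates the second machine. -/
structure SimSecond (z : List C) (d : N.Cfg) (c : (comp M N).Cfg) : Prop where
  state : c.state = .second d.state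
  head : ∀ t, c.head (embSecond M.outTape t) = d.head t
  work : ∀ w i, c.work (.inr (.inl w)) i = (d.work w i).map .inr
  idxHead : ∀ t, c.idxHead (embSecond M.outTape t) = d.idxHead t
  idx : ∀ t, c.idx (embSecond M.outTape t) = d.idx t
  out : ∀ i, c.work (.inl M.outTape) i = (z[i]?).map fun c => .inl (M.embed c)

theorem SimFirst.delta_eq {n : ℕ} {d : M.Cfg} {c : (comp M N).Cfg} (h : SimFirst n d c) :
    M.δ d.state ((zipOpt x₁ x₂)[c.head .data]?.bind Prod.fst) (y[c.head .query]?)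
      (fun w => (c.work (.inl w) (c.head (.work (.inl w)))).bind Sum.getLeft?)
      (fun t => c.idx (embFirst t) (c.idxHead (embFirst t))) = M.action x₁ y d := by
  have h₁ := h.head .data
  have h₂ := h.head .query
  simp only [embFirst] at h₁ h₂
  have h₃ : (fun w => (c.work (.inl w) (c.head (.work (.inl w)))).bind Sum.getLeft?) =
      fun w => d.work w (d.head (.work w)) := by
    funext w
    have h₄ := h.head (.work w)
    simp only [embFirst] at h₄
    rw [h.work, h₄]
    cases d.work w (d.head (.work w)) <;> rfl
  simp only [action, getElem?_zipOpt_fst, h₁, h₂, h₃, h.idx, h.idxHead]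

/-- Output symbols are embedded injectively into the work alphabet, so the partial inverse reads the
word `z` back; blanks appear as the end of the problem part. -/
theorem SimSecond.delta_eq {d : N.Cfg} {c : (comp M N).Cfg} (h : SimSecond z d c) :
    N.δ d.state ((zipOpt x₁ x₂)[c.head .data]?.bind Prod.snd)
      ((c.work (.inl M.outTape) (c.head (.work (.inl M.outTape)))).bind
        (Function.partialInv fun c => Sum.inl (M.embed c)))
      (fun w => (c.work (.inr (.inl w)) (c.head (.work (.inr (.inl w))))).bind Sum.getRight?)
      (fun t => c.idx (embSecond M.outTape t) (c.idxHead (embSecond M.outTape t))) =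
    N.action x₂ z d := by
  have h₁ := h.head .data
  have h₂ := h.head .query
  simp only [embSecond] at h₁ h₂
  have h₃ : (fun w => (c.work (.inr (.inl w)) (c.head (.work (.inr (.inl w))))).bind
      Sum.getRight?) = fun w => d.work w (d.head (.work w)) := by
    funext w
    have h₄ := h.head (.work w)
    simp only [embSecond] at h₄
    rw [h.work, h₄]
    cases d.work w (d.head (.work w)) <;> rfl
  have hinj : Function.Injective fun c => (Sum.inl (M.embed c) : M.Γ ⊕ N.Γ) :=
    Sum.inl_injective.comp M.embed.injective
  have h₅ : ((z[d.head .query]?).map fun c => (Sum.inl (M.embed c) : M.Γ ⊕ N.Γ)).bind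
      (Function.partialInv fun c => Sum.inl (M.embed c)) = z[d.head .query]? := by
    cases z[d.head .query]? with
    | none => rfl
    | some a => exact Function.partialInv_left hinj a
  simp only [action, getElem?_zipOpt_snd, h₁, h₂, h₃, h.idx, h.idxHead, h.out, h₅]

theorem SimFirst.step {n : ℕ} {d d' : M.Cfg} {c : (comp M N).Cfg} (h : SimFirst n d c)
    (hd : M.step x₁ y d = some d') :
    ∃ c', (comp M N).step (zipOpt x₁ x₂) y c = some c' ∧ SimFirst (n + 1) d' c' := by
  rw [RATM.step, Option.map_eq_some_iff] at hd
  obtain ⟨a, ha, rfl⟩ := hd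
  have hδ := h.delta_eq (x₁ := x₁) (x₂ := x₂) (y := y)
  rw [ha] at hδ
  have hact : (comp M N).action (zipOpt x₁ x₂) y c = some
      { next := .first a.next
        write := Sum.elim (fun w => (a.write w).map .inl)
          fun w => c.work (.inr w) (c.head (.work (.inr w)))
        writeIdx := pickFirst a.writeIdx
          (fun w => c.idx (.work (.inr (.inl w))) (c.idxHead (.work (.inr (.inl w))))) (some true)
        move := pickFirst a.move (fun _ => .stay) .stay
        moveIdx := pickFirst a.moveIdx (fun _ => .stay) .right } := by
    simp only [action, comp, h.state]
    rw [hδ]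
  refine ⟨_, step_of_action hact, ?_⟩
  constructor
  · rfl
  · intro t
    simp only [perform, comp, pickFirst_embFirst, h.idx, h.idxHead, h.head]
  · intro w i
    have := h.head (.work w)
    simp only [embFirst] at this
    simp only [perform, Sum.elim_inl, this]
    by_cases hi : i = d.head (.work w)
    · subst hi; simp
    · rw [Function.update_of_ne hi, Function.update_of_ne hi, h.work]
  · intro t
    simp only [perform, pickFirst_embFirst, h.idxHead]
  · intro t
    simp only [perform, pickFirst_embFirst, h.idx, h.idxHead]
  · simp only [perform, pickFirst_clock, h.clockHead, Move.apply]
  · simp only [perform, pickFirst_clock, h.clockHead, h.clockIdx]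
    funext i
    by_cases hi : i = n + 1
    · subst hi; simp [clock]
    · rw [Function.update_of_ne hi]
      simp only [clock]
      congr 1
      simp only [eq_iff_iff]
      omega
  · have hu := h.untouched
    constructor
    · intro w
      -- An access of the first machine moves these heads as well, but their blank index tapes name
      -- cell `0`.
      simp only [perform, pickFirst_second, hu.idx, hu.head, Function.update_eq_self, address_blank,
        Move.apply, ite_self]
    · intro w i
      simp only [perform, Sum.elim_inr]
      rw [Function.update_eq_self, hu.work]
    · intro w
      simp only [perform, pickFirst_second, hu.idxHead, Move.apply]
    · intro w
      simp only [perform, pickFirst_second, Function.update_eq_self, hu.idx]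

theorem SimSecond.step {d d' : N.Cfg} {c : (comp M N).Cfg} (h : SimSecond z d c)
    (hd : N.step x₂ z d = some d') :
    ∃ c', (comp M N).step (zipOpt x₁ x₂) y c = some c' ∧ SimSecond z d' c' := by
  rw [RATM.step, Option.map_eq_some_iff] at hd
  obtain ⟨a, ha, rfl⟩ := hd
  have hδ := h.delta_eq (x₁ := x₁) (x₂ := x₂)
  rw [ha] at hδ
  have hact : (comp M N).action (zipOpt x₁ x₂) y c = some
      { next := .second a.next
        write := Sum.elim (fun w => c.work (.inl w) (c.head (.work (.inl w)))) <|
          Sum.elim (fun w => (a.write w).map .inr)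
            fun w => c.work (.inr (.inr w)) (c.head (.work (.inr (.inr w))))
        writeIdx := pickSecond a.writeIdx
        move := pickSecond a.move
        moveIdx := pickSecond a.moveIdx } := by
    simp only [action, comp, h.state]
    rw [hδ]
    rfl
  refine ⟨_, step_of_action hact, ?_⟩
  constructor
  · rfl
  · intro t
    simp only [perform, comp, pickSecond_embSecond, h.idx, h.idxHead, h.head]
  · intro w i
    have := h.head (.work w)
    simp only [embSecond] at this
    simp only [perform, Sum.elim_inl, Sum.elim_inr, this]
    by_cases hi : i = d.head (.work w)
    · subst hi; simp
    · rw [Function.update_of_ne hi, Function.update_of_ne hi, h.work]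
  · intro t
    simp only [perform, pickSecond_embSecond, h.idxHead]
  · intro t
    simp only [perform, pickSecond_embSecond, h.idx, h.idxHead]
  · intro i
    simp only [perform, Sum.elim_inl]
    rw [Function.update_eq_self, h.out]

theorem SimSecond.step_none {d : N.Cfg} {c : (comp M N).Cfg} (h : SimSecond z d c)
    (hd : N.step x₂ z d = none) : (comp M N).step (zipOpt x₁ x₂) y c = none := by
  rw [RATM.step, Option.map_eq_none_iff] at hd
  have hδ := h.delta_eq (x₁ := x₁) (x₂ := x₂)
  rw [hd] at hδ
  rw [RATM.step, Option.map_eq_none_iff]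
  simp only [action, comp, h.state]
  rw [hδ]
  rfl

/-! ### Resetting index tapes and heads between the runs. -/

/-- A situation between the runs of the two machines: the output `z` of the first machine has been
computed in `n` steps, the index head of the clock is on cell `k`, and the index tapes of the first
machine satisfy conditions on blank cells and on the positions of the heads. -/
structure Cleaning (z : List C) (n : ℕ) (q : CompState M.Q N.Q) (k : ℕ) (blank pos : ℕ → Prop)
    (c : (comp M N).Cfg) : Prop where
  state : c.state = q
  out : ∀ i, c.work (.inl M.outTape) i = (z[i]?).map fun c => .inl (M.embed c)
  untouched : Untouched c
  clockHead : c.idxHead clockTape = k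
  clockIdx : c.idx clockTape = clock n
  idx : ∀ t i, blank i → c.idx (embFirst t) i = none
  idxHead : ∀ t, pos (c.idxHead (embFirst t))

variable {n k : ℕ} {c : (comp M N).Cfg} {q q' : CompState M.Q N.Q} {blank pos : ℕ → Prop}

theorem Cleaning.imp {blank' pos' : ℕ → Prop} (h : Cleaning z n q k blank pos c)
    (hb : ∀ i, blank' i → blank i) (hp : ∀ i, pos i → pos' i) : Cleaning z n q k blank' pos' c :=
  ⟨h.state, h.out, h.untouched, h.clockHead, h.clockIdx, fun t i hi => h.idx t i (hb i hi),
    fun t => hp _ (h.idxHead t)⟩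

/-- The symbols that an action writes on the index tapes if it writes nothing new. -/
abbrev oldIdx (c : (comp M N).Cfg) : Tape (M.W ⊕ N.W ⊕ Unit) → Option Bool :=
  fun t => c.idx t (c.idxHead t)

/-- The symbols that an action writes on the work tapes if it writes nothing new. -/
abbrev oldWork (c : (comp M N).Cfg) : M.W ⊕ N.W ⊕ Unit → Option (M.Γ ⊕ N.Γ) :=
  fun w => c.work w (c.head (.work w))

theorem Cleaning.perform_move (h : Cleaning z n q k blank pos c)
    (hq : (comp M N).isAccess q' = false) (m m' : Move) :
    Cleaning z n q' (m'.apply k) blank (fun i => ∃ j, pos j ∧ i = m.apply j)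
      ((comp M N).perform c { keep q' (oldWork c) (oldIdx c) with
        moveIdx := pickFirst (fun _ => m) (fun _ => .stay) m' }) := by
  have hu := h.untouched
  constructor
  · rfl
  · intro i
    simp only [perform, keep, oldWork, Function.update_eq_self, h.out]
  · constructor
    · intro w
      exact (if_neg (ne_true_of_eq_false hq)).trans (hu.head w)
    · intro w i
      simp only [perform, keep, oldWork, Function.update_eq_self, hu.work]
    · intro w
      simp only [perform, keep, pickFirst_second, Move.apply, hu.idxHead]
    · intro w
      simp only [perform, keep, oldIdx, Function.update_eq_self, hu.idx]
  · simp only [perform, pickFirst_clock, h.clockHead]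
  · simp only [perform, keep, oldIdx, Function.update_eq_self, h.clockIdx]
  · intro t i hi
    simp only [perform, keep, oldIdx, Function.update_eq_self, h.idx t i hi]
  · intro t
    exact ⟨_, h.idxHead t, by simp only [perform, pickFirst_embFirst]⟩

/-- All index heads of the first machine are on the same cell `k`, so one step erases that cell on
all of them, while the clock is rewritten unchanged. -/
theorem Cleaning.perform_clear (h : Cleaning z n q k blank (· = k) c)
    (hq : (comp M N).isAccess q' = false) :
    Cleaning z n q' (k + 1) (fun i => blank i ∨ i = k) (· = k + 1)
      ((comp M N).perform c { keep q' (oldWork c) (oldIdx c) with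
        writeIdx := pickFirst (fun _ => none) (fun w => oldIdx c (.work (.inr (.inl w)))) (clock n k)
        moveIdx := pickFirst (fun _ => .right) (fun _ => .stay) .right }) := by
  have hu := h.untouched
  constructor
  · rfl
  · intro i
    simp only [perform, keep, oldWork, Function.update_eq_self, h.out]
  · constructor
    · intro w
      exact (if_neg (ne_true_of_eq_false hq)).trans (hu.head w)
    · intro w i
      simp only [perform, keep, oldWork, Function.update_eq_self, hu.work]
    · intro w
      simp only [perform, pickFirst_second, Move.apply, hu.idxHead]
    · intro w
      simp only [perform, pickFirst_second, oldIdx, Function.update_eq_self, hu.idx]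
  · simp only [perform, pickFirst_clock, h.clockHead, Move.apply]
  · simp only [perform, pickFirst_clock, h.clockHead, h.clockIdx, Function.update_eq_self]
  · intro t i hi
    simp only [perform, pickFirst_embFirst, h.idxHead t]
    by_cases hik : i = k
    · subst hik; simp
    · rw [Function.update_of_ne hik, h.idx t i (by tauto)]
  · intro t
    simp only [perform, pickFirst_embFirst, h.idxHead t, Move.apply]

variable {u : List (Option A × Option A')}

theorem Cleaning.back_step {b : Bool} (h : Cleaning z n (.back b) (k + 1) blank (· ≤ k + 1) c)
    (hk : k + 1 ≤ n) : ∃ c', (comp M N).step u y c = some c' ∧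
      Cleaning z n (.back b) k blank (· ≤ k) c' := by
  have hact : (comp M N).action u y c = some { keep (.back b) (oldWork c) (oldIdx c) with
      moveIdx := pickFirst (fun _ => .left) (fun _ => .stay) .left } := by
    simp only [action, comp, h.state, h.clockIdx, h.clockHead]
    simp [clock, hk]
  refine ⟨_, step_of_action hact,
    (h.perform_move (q' := .back b) rfl .left .left).imp (fun _ h => h) ?_⟩
  rintro i ⟨j, hj, rfl⟩
  simp only [Move.apply]
  omega

/-- Heads at distance at most `k` reach cell `0` within `k` moves and stay there by truncation. The
clock tells when this is certain; the tapes themselves have no left end mark. -/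
theorem Cleaning.back_walk {b : Bool} (h : Cleaning z n (.back b) k blank (· ≤ k) c)
    (hk : k ≤ n) : ∃ c', (comp M N).Reach u y k c c' ∧
      Cleaning z n (.back b) 0 blank (· ≤ 0) c' := by
  induction k generalizing c with
  | zero => exact ⟨c, .refl, h⟩
  | succ k ih =>
    obtain ⟨c', h₁, h₂⟩ := h.back_step hk
    obtain ⟨c'', h₃, h₄⟩ := ih h₂ (by omega)
    exact ⟨c'', by rw [add_comm]; exact (Reach.single h₁).trans h₃, h₄⟩

theorem Cleaning.back_turn (h : Cleaning z n (.back false) 0 (n ≤ ·) (· ≤ 0) c) :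
    ∃ c', (comp M N).step u y c = some c' ∧
      Cleaning z n .clear 1 (fun i => i < 1 ∨ n ≤ i) (· = 1) c' := by
  -- `clock n 0` is the blank, written in the form that `perform_clear` expects.
  have hact : (comp M N).action u y c = some { keep .clear (oldWork c) (oldIdx c) with
      writeIdx := pickFirst (fun _ => none) (fun w => oldIdx c (.work (.inr (.inl w)))) (clock n 0)
      moveIdx := pickFirst (fun _ => .right) (fun _ => .stay) .right } := by
    simp only [action, comp, h.state, h.clockIdx, h.clockHead]
    simp [clock]
  have h' := h.imp (blank' := (n ≤ ·)) (pos' := (· = 0)) (fun _ h => h) (fun i hi => by omega)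
  refine ⟨_, step_of_action hact, (h'.perform_clear rfl).imp ?_ fun _ h => h⟩
  intro i hi
  omega

theorem Cleaning.clear_step (h : Cleaning z n .clear k (fun i => i < k ∨ n ≤ i) (· = k) c)
    (hk : 1 ≤ k) (hn : k ≤ n) : ∃ c', (comp M N).step u y c = some c' ∧
      Cleaning z n .clear (k + 1) (fun i => i < k + 1 ∨ n ≤ i) (· = k + 1) c' := by
  have hact : (comp M N).action u y c = some { keep .clear (oldWork c) (oldIdx c) with
      writeIdx := pickFirst (fun _ => none) (fun w => oldIdx c (.work (.inr (.inl w)))) (clock n k)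
      moveIdx := pickFirst (fun _ => .right) (fun _ => .stay) .right } := by
    simp only [action, comp, h.state, h.clockIdx, h.clockHead]
    simp [clock, hk, hn]
  refine ⟨_, step_of_action hact, (h.perform_clear rfl).imp ?_ fun _ h => h⟩
  intro i hi
  omega

theorem Cleaning.clear_walk {m : ℕ} (h : Cleaning z n .clear k (fun i => i < k ∨ n ≤ i) (· = k) c)
    (hk : 1 ≤ k) (hm : k + m = n + 1) : ∃ c', (comp M N).Reach u y m c c' ∧
      Cleaning z n .clear (n + 1) (fun i => i < n + 1 ∨ n ≤ i) (· = n + 1) c' := by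
  induction m generalizing c k with
  | zero =>
    obtain rfl : k = n + 1 := by omega
    exact ⟨c, .refl, h⟩
  | succ m ih =>
    obtain ⟨c', h₁, h₂⟩ := h.clear_step hk (by omega)
    obtain ⟨c'', h₃, h₄⟩ := ih h₂ (by omega) (by omega)
    exact ⟨c'', by rw [add_comm]; exact (Reach.single h₁).trans h₃, h₄⟩

/-- The cells up to `n` have been erased and those from `n` on were never written, so every cell is
blank. -/
theorem Cleaning.clear_turn
    (h : Cleaning z n .clear (n + 1) (fun i => i < n + 1 ∨ n ≤ i) (· = n + 1) c) :
    ∃ c', (comp M N).step u y c = some c' ∧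
      Cleaning z n (.back true) n (fun _ => True) (· ≤ n) c' := by
  have hact : (comp M N).action u y c = some { keep (.back true) (oldWork c) (oldIdx c) with
      moveIdx := pickFirst (fun _ => .left) (fun _ => .stay) .left } := by
    simp only [action, comp, h.state, h.clockIdx, h.clockHead]
    simp [clock]
  refine ⟨_, step_of_action hact, (h.perform_move (q' := .back true) rfl .left .left).imp
    (fun i _ => by omega) ?_⟩
  rintro i ⟨j, hj, rfl⟩
  simp only [Move.apply]
  omega

/-- Two steps: entering the access state resets the heads, then the second machine is started. -/
theorem Cleaning.jump (h : Cleaning z n (.back true) 0 (fun _ => True) (· ≤ 0) c) :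
    ∃ c', (comp M N).Reach u y 2 c c' ∧ SimSecond z N.init c' := by
  have hu := h.untouched
  have hact : (comp M N).action u y c = some (keep .jump (oldWork c) (oldIdx c)) := by
    simp only [action, comp, h.state, h.clockIdx, h.clockHead]
    simp [clock]
  have hidx (t : Tape M.W) : c.idx (embFirst t) = fun _ => none :=
    funext fun i => h.idx t i trivial
  set c' := (comp M N).perform c (keep .jump (oldWork c) (oldIdx c)) with hc'
  have hhead (t : Tape (M.W ⊕ N.W ⊕ Unit)) (ht : c.idx t = fun _ => none) : c'.head t = 0 := by
    simp only [hc', perform, keep, if_true, oldIdx, Function.update_eq_self, ht, address_blank]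
  have hidx' : c'.idx = c.idx := by
    funext t
    simp only [hc', perform, keep, oldIdx, Function.update_eq_self]
  have hwork' : c'.work = c.work := by
    funext t
    simp only [hc', perform, keep, oldWork, Function.update_eq_self]
  have hidxHead' : c'.idxHead = c.idxHead := by
    funext t
    simp only [hc', perform, keep, Move.apply]
  have hact' : (comp M N).action u y c' =
      some (keep (.second N.start) (oldWork c') (oldIdx c')) := by
    have : c'.state = .jump := rfl
    simp only [action, comp, this]
  set c'' := (comp M N).perform c' (keep (.second N.start) (oldWork c') (oldIdx c')) with hc''
  -- If the start state of `N` is an access state, entering it jumps once more, again to cell `0`.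
  have hhead' (t : Tape (M.W ⊕ N.W ⊕ Unit)) (ht : c.idx t = fun _ => none) : c''.head t = 0 := by
    simp only [hc'', perform, keep, oldIdx, Function.update_eq_self, hidx', ht, address_blank,
      Move.apply, hhead t ht, ite_self]
  have hidx'' : c''.idx = c.idx := by
    funext t
    simp only [hc'', perform, keep, oldIdx, Function.update_eq_self, hidx']
  have hwork'' : c''.work = c.work := by
    funext t
    simp only [hc'', perform, keep, oldWork, Function.update_eq_self, hwork']
  have hidxHead'' : c''.idxHead = c.idxHead := by
    funext t
    simp only [hc'', perform, keep, Move.apply, hidxHead']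
  have hblank (t : Tape N.W) : c.idx (embSecond M.outTape t) = fun _ => none := by
    cases t with
    | data => exact hidx .data
    | query => exact hidx (.work M.outTape)
    | work w => exact hu.idx w
  refine ⟨c'', (Reach.single (step_of_action hact)).trans (Reach.single (step_of_action hact')),
    rfl, fun t => hhead' _ (hblank t), fun w i => ?_, fun t => ?_, fun t => ?_, fun i => ?_⟩
  · rw [hwork'', hu.work]; rfl
  · rw [hidxHead'']
    cases t with
    | data => exact Nat.le_zero.1 (h.idxHead .data)
    | query => exact Nat.le_zero.1 (h.idxHead (.work M.outTape))
    | work w => exact hu.idxHead w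
  · rw [hidx'', hblank]; rfl
  · rw [hwork'', h.out]

/-- By `Reach.idx_bounds` the `n` steps on the clock bound both the index heads and the written
cells, which is what the cleaning needs. -/
theorem SimFirst.halt {d : M.Cfg} (h : SimFirst n d c) (hr : M.Reach x₁ y n M.init d)
    (hd : M.step x₁ y d = none) (hz : ∀ i, d.work M.outTape i = (z[i]?).map M.embed) :
    ∃ c', (comp M N).step (zipOpt x₁ x₂) y c = some c' ∧
      Cleaning z n (.back false) n (n ≤ ·) (· ≤ n) c' := by
  rw [RATM.step, Option.map_eq_none_iff] at hd
  have hδ := h.delta_eq (x₁ := x₁) (x₂ := x₂) (y := y)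
  rw [hd] at hδ
  have hact : (comp M N).action (zipOpt x₁ x₂) y c =
      some { keep (.back false) (oldWork c) (oldIdx c) with
        moveIdx := pickFirst (fun _ => .stay) (fun _ => .stay) .left } := by
    simp only [action, comp, h.state]
    rw [hδ]
  have h₀ : Cleaning z n (.first d.state) (n + 1) (n ≤ ·) (· ≤ n) c := by
    refine ⟨h.state, fun i => ?_, h.untouched, h.clockHead, h.clockIdx, fun t i hi => ?_,
      fun t => ?_⟩
    · rw [h.work, hz, Option.map_map]; rfl
    · rw [h.idx]; exact (hr.idx_bounds t).2 i hi
    · rw [h.idxHead]; exact (hr.idx_bounds t).1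
  refine ⟨_, step_of_action hact, (h₀.perform_move (q' := .back false) rfl .stay .left).imp
    (fun _ h => h) ?_⟩
  rintro i ⟨j, hj, rfl⟩
  exact hj

/-! ### The complete run of the composition. -/

theorem exists_simFirst : ∃ c, (comp M N).Reach u y 1 (comp M N).init c ∧ SimFirst 0 M.init c := by
  have hact : (comp M N).action u y (comp M N).init =
      some { keep (.first M.start) (oldWork (comp M N).init) (oldIdx (comp M N).init) with
        moveIdx := pickFirst (fun _ => .stay) (fun _ => .stay) .right } := by
    simp only [action, comp, init]
  refine ⟨_, Reach.single (step_of_action hact), ?_⟩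
  have hupd : ∀ (α : Type) (i : ℕ), Function.update (fun _ => (none : Option α)) i none =
      fun _ => none := fun α i => Function.update_eq_self i _
  constructor
  · rfl
  · intro t
    simp only [perform, keep, oldIdx, init, Move.apply, hupd, address_blank, ite_self]
  · intro w i
    simp only [perform, keep, oldWork, init, hupd, Option.map_none]
  · intro t
    simp only [perform, pickFirst_embFirst, init, Move.apply]
  · intro t
    simp only [perform, keep, oldIdx, init, hupd]
  · simp only [perform, pickFirst_clock, init, Move.apply]
  · simp only [perform, keep, oldIdx, init, hupd]
    funext i
    rw [clock, if_neg (by omega)]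
  · constructor
    · intro w
      simp only [perform, keep, oldIdx, init, Move.apply, hupd, address_blank, ite_self]
    · intro w i
      simp only [perform, keep, oldWork, init, hupd]
    · intro w
      simp only [perform, pickFirst_second, init, Move.apply]
    · intro w
      simp only [perform, keep, oldIdx, init, hupd]

theorem Reach.simFirst {d : M.Cfg} (h : M.Reach x₁ y n M.init d) :
    ∃ c, (comp M N).Reach (zipOpt x₁ x₂) y (1 + n) (comp M N).init c ∧ SimFirst n d c := by
  induction n generalizing d with
  | zero =>
    obtain rfl : M.init = d := by simpa [Reach] using h
    exact exists_simFirst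
  | succ n ih =>
    obtain ⟨d', h₁, h₂⟩ := reach_succ.1 h
    obtain ⟨c', h₃, h₄⟩ := ih h₁
    obtain ⟨c, h₅, h₆⟩ := h₄.step (x₂ := x₂) h₂
    exact ⟨c, reach_succ.2 ⟨c', h₃, h₅⟩, h₆⟩

theorem SimSecond.reach {d d' : N.Cfg} (h : SimSecond z d c) (hd : N.Reach x₂ z n d d') :
    ∃ c', (comp M N).Reach (zipOpt x₁ x₂) y n c c' ∧ SimSecond z d' c' := by
  induction n generalizing d' with
  | zero =>
    obtain rfl : d = d' := by simpa [Reach] using hd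
    exact ⟨c, .refl, h⟩
  | succ n ih =>
    obtain ⟨d₁, h₁, h₂⟩ := reach_succ.1 hd
    obtain ⟨c₁, h₃, h₄⟩ := ih h₁
    obtain ⟨c₂, h₅, h₆⟩ := h₄.step (x₁ := x₁) (y := y) h₂
    exact ⟨c₂, reach_succ.2 ⟨c₁, h₃, h₅⟩, h₆⟩

/-- The factor four comes from the run of `M` and three passes over the clock: back, erase, back.
Six steps are spent on the start, the turns and the jump. -/
theorem OutputsWithin.comp {v : List D} {t₁ t₂ : ℕ} (h₁ : M.OutputsWithin x₁ y z t₁)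
    (h₂ : N.OutputsWithin x₂ z v t₂) :
    (M.comp N).OutputsWithin (zipOpt x₁ x₂) y v (4 * t₁ + t₂ + 6) := by
  obtain ⟨m, hm, d, hd, hd', hz⟩ := h₁
  obtain ⟨n, hn, e, he, he', hv⟩ := h₂
  obtain ⟨c₁, hr₁, hs₁⟩ := Reach.simFirst (N := N) (x₂ := x₂) hd
  obtain ⟨c₂, hr₂, hc₂⟩ := hs₁.halt (x₂ := x₂) hd hd' hz
  obtain ⟨c₃, hr₃, hc₃⟩ := hc₂.back_walk (u := zipOpt x₁ x₂) (y := y) le_rfl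
  obtain ⟨c₄, hr₄, hc₄⟩ := hc₃.back_turn (u := zipOpt x₁ x₂) (y := y)
  obtain ⟨c₅, hr₅, hc₅⟩ := hc₄.clear_walk (u := zipOpt x₁ x₂) (y := y) le_rfl (add_comm 1 m)
  obtain ⟨c₆, hr₆, hc₆⟩ := hc₅.clear_turn (u := zipOpt x₁ x₂) (y := y)
  obtain ⟨c₇, hr₇, hc₇⟩ := hc₆.back_walk (u := zipOpt x₁ x₂) (y := y) le_rfl
  obtain ⟨c₈, hr₈, hs₈⟩ := hc₇.jump (u := zipOpt x₁ x₂) (y := y)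
  obtain ⟨c₉, hr₉, hs₉⟩ := hs₈.reach (x₁ := x₁) (y := y) he
  have hr := (((((((hr₁.trans (.single hr₂)).trans hr₃).trans (.single hr₄)).trans hr₅).trans
    (.single hr₆)).trans hr₇).trans hr₈).trans hr₉
  refine ⟨_, ?_, c₉, hr, hs₉.step_none he', fun i => ?_⟩
  · omega
  · refine (hs₉.work N.outTape i).trans ?_
    rw [hv, Option.map_map]
    rfl

end Comp

end RATM

/-! ### Composition of preprocessing functions -/

/-- A step pushes at most one symbol. Polynomial time therefore yields the polynomial length bounds
that pairing requires. -/
theorem Prog.Exec.length_le {K : Type} {Γ : K → Type} {σ : Type} [DecidableEq K] {p : Prog Γ σ}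
    {v v' : σ} {S S' : Prog.Stacks Γ} {n : ℕ} (h : Prog.Exec p v S v' S' n) (k : K) :
    (S' k).length ≤ (S k).length + n := by
  induction h with
  | @push j f v S =>
    by_cases hk : k = j
    · subst hk
      rw [Function.update_self, List.length_append]
      cases f v <;> simp [add_comm]
    · simp [Function.update_of_ne hk]
  | @pop j f v S =>
    by_cases hk : k = j
    · subst hk
      rw [Function.update_self, List.length_tail]
      omega
    · simp [Function.update_of_ne hk]
  | peek => omega
  | load => omega
  | seq _ _ h₁ h₂ => omega
  | switch _ h => omega
  | loop_done => omega
  | loop_step _ _ _ h₁ h₂ => omega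

theorem Machine.Outputs.length_le {A B : Type} {M : Machine A B} {u : List A} {v : List B} {T : ℕ}
    (h : M.Outputs u v T) : v.length ≤ u.length + T := by
  obtain ⟨_, _, n, hex, -, rfl, hn⟩ := h
  have h₁ := hex.length_le M.k₁
  have h₂ : (Prog.single M.k₀ (u.map M.eA.symm) M.k₁).length ≤ u.length := by
    by_cases hk : M.k₁ = M.k₀
    · rw [hk]; simp
    · simp [Prog.single_of_ne hk]
  rw [Prog.single_self, List.length_map] at h₁
  omega

theorem PolyTimeOn.exists_length_le {S B : Type} {b : List S → List B}
    (h : PolyTimeOn List.length id b) :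
    ∃ q : Polynomial ℕ, ∀ x, (b x).length ≤ q.eval x.length := by
  obtain ⟨M, p, h⟩ := h
  refine ⟨Polynomial.X + p, fun x => ?_⟩
  simpa using (h x).length_le

theorem NCComputable.polyTimeOn_comp {S T E : Type} [Fintype S] [Fintype T] {f : List S → List T}
    (hf : NCComputable f) (hl : LinearSize f) {Pi : List T → List E} (hPi : PTimeComputable Pi) :
    PolyTimeOn List.length id fun x => Pi (f x) := by
  obtain ⟨c, hc⟩ := hl
  have hq (x : List S) :
      (f x).length ≤ (Polynomial.C c * (Polynomial.X + 1) : Polynomial ℕ).eval x.length := by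
    simpa using hc x
  exact hf.polyTimeOn.comp (hPi.polyTimeOn _ hq) _ hq

theorem PolyTimeOn.zipOpt {S B C : Type} [Fintype S] [Fintype B] [Fintype C] {b : List S → List B}
    {c : List S → List C} (hb : PolyTimeOn List.length id b) (hc : PolyTimeOn List.length id c) :
    PolyTimeOn List.length id fun x => zipOpt (b x) (c x) := by
  obtain ⟨q₁, h₁⟩ := hb.exists_length_le
  obtain ⟨q₂, h₂⟩ := hc.exists_length_le
  exact hb.zip hc Polynomial.X q₁ q₂ (fun x => by simp) h₁ h₂

/-! ### Sublinear time bounds -/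

theorem isSublinear_iff {t : ℕ → ℕ} :
    IsSublinear t ↔ ∀ ε : ℝ, 0 < ε → ∀ᶠ n : ℕ in atTop, (t n : ℝ) ≤ ε * n := by
  simp only [IsSublinear, isLittleO_iff, Real.norm_natCast]

theorem IsSublinear.add {s t : ℕ → ℕ} (hs : IsSublinear s) (ht : IsSublinear t) :
    IsSublinear fun n => s n + t n := by
  simpa [IsSublinear] using IsLittleO.add hs ht

theorem IsSublinear.const_mul {t : ℕ → ℕ} (ht : IsSublinear t) (a : ℕ) :
    IsSublinear fun n => a * t n := by
  simpa [IsSublinear] using IsLittleO.const_mul_left ht (a : ℝ)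

theorem isSublinear_const (a : ℕ) : IsSublinear fun _ => a := by
  rw [isSublinear_iff]
  intro ε hε
  filter_upwards [tendsto_natCast_atTop_atTop.eventually_ge_atTop ((a : ℝ) / ε)] with n hn
  rwa [div_le_iff₀' hε] at hn

/-- The maximum of a time bound over all lengths up to `c * (n + 1)`. -/
def maxTime (t : ℕ → ℕ) (c n : ℕ) : ℕ := (Finset.range (c * (n + 1) + 1)).sup t

theorem le_maxTime {t : ℕ → ℕ} {c n m : ℕ} (h : m ≤ c * (n + 1)) : t m ≤ maxTime t c n :=
  Finset.le_sup (Finset.mem_range.2 (Nat.lt_succ_of_le h))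

/-- A time bound need not be monotone, hence the maximum. If it is attained below the threshold `N`,
it is bounded by a constant; otherwise at some `m ≤ c * (n + 1) ≤ (c + 1) * (2 * n)`, which explains
the choice of `ε / (2 * (c + 1))`. -/
theorem IsSublinear.maxTime {t : ℕ → ℕ} (ht : IsSublinear t) (c : ℕ) :
    IsSublinear (maxTime t c) := by
  rw [isSublinear_iff] at ht ⊢
  intro ε hε
  have hε' : 0 < ε / (2 * (c + 1)) := by positivity
  obtain ⟨N, hN⟩ := eventually_atTop.1 (ht _ hε')
  have hK := isSublinear_iff.1 (isSublinear_const ((Finset.range N).sup t)) ε hε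
  filter_upwards [hK, eventually_ge_atTop 1] with n hn hn₁
  have hn₁' : (1 : ℝ) ≤ n := by exact_mod_cast hn₁
  obtain ⟨m, hm, hmt⟩ := Finset.exists_mem_eq_sup (Finset.range (c * (n + 1) + 1)) ⟨0, by simp⟩ t
  rw [SublinearTime.maxTime, hmt]
  by_cases hmN : m < N
  · refine le_trans ?_ hn
    exact_mod_cast Finset.le_sup (f := t) (Finset.mem_range.2 hmN)
  · have hmc : (m : ℝ) ≤ c * (n + 1) := by
      exact_mod_cast Nat.lt_succ_iff.1 (Finset.mem_range.1 hm)
    calc (t m : ℝ) ≤ ε / (2 * (c + 1)) * m := hN m (not_lt.1 hmN)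
      _ ≤ ε / (2 * (c + 1)) * ((c + 1) * (2 * n)) := by
          gcongr
          refine hmc.trans ?_
          gcongr <;> linarith
      _ = ε * n := by field_simp

theorem RATM.OutputsWithin.mono {A B C : Type} {M : RATM A B C} {x : List A} {y : List B}
    {z : List C} {s t : ℕ} (h : M.OutputsWithin x y z s) (hst : s ≤ t) : M.OutputsWithin x y z t :=
  let ⟨n, hn, h⟩ := h
  ⟨n, hn.trans hst, h⟩

/-! ### Approximation ratios -/

namespace OptProblem

variable {S : Type} {X : OptProblem S} {D P y : List S}

theorem isLeast_opt (hX : X.goal = .min) (h : X.IsInstance D P) :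
    IsLeast (X.measure D P '' X.sol D P) (X.opt D P) := by
  obtain ⟨y, hy, hopt⟩ := X.exists_optimum D P h
  simp only [hX] at hopt
  have : IsLeast (X.measure D P '' X.sol D P) (X.measure D P y) :=
    ⟨⟨y, hy, rfl⟩, by rintro _ ⟨z, hz, rfl⟩; exact hopt z hz⟩
  simpa only [opt, hX, this.csInf_eq] using this

theorem isGreatest_opt (hX : X.goal = .max) (h : X.IsInstance D P) :
    IsGreatest (X.measure D P '' X.sol D P) (X.opt D P) := by
  obtain ⟨y, hy, hopt⟩ := X.exists_optimum D P h
  simp only [hX] at hopt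
  have : IsGreatest (X.measure D P '' X.sol D P) (X.measure D P y) :=
    ⟨⟨y, hy, rfl⟩, by rintro _ ⟨z, hz, rfl⟩; exact hopt z hz⟩
  simpa only [opt, hX, this.csSup_eq] using this

theorem opt_pos (h : X.IsInstance D P) : 0 < X.opt D P := by
  have : X.opt D P ∈ X.measure D P '' X.sol D P := by
    cases hX : X.goal
    · exact (isLeast_opt hX h).1
    · exact (isGreatest_opt hX h).1
  obtain ⟨y, hy, hopt⟩ := this
  exact hopt ▸ X.measure_pos D P h y hy

/-- Both quotients in the ratio are bounded, so the goal of the problem is irrelevant. If the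
measure is below the optimum, the bound `δ * measure` is relaxed to `δ * opt`. -/
theorem abs_opt_sub_measure_le {δ : ℝ} (hδ : 0 ≤ δ) (h : X.IsInstance D P) (hy : y ∈ X.sol D P)
    (hr : X.ratio D P y ≤ 1 + δ) : |X.opt D P - X.measure D P y| ≤ δ * X.opt D P := by
  have ho := opt_pos h
  have hm := X.measure_pos D P h y hy
  obtain ⟨h₁, h₂⟩ := max_le_iff.1 hr
  rw [div_le_iff₀ ho] at h₁
  rw [div_le_iff₀ hm] at h₂
  rw [abs_le]
  constructor
  · linarith
  · rcases le_total (X.opt D P) (X.measure D P y) with hle | hle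
    · have := mul_nonneg hδ ho.le
      linarith
    · have := mul_le_mul_of_nonneg_left hle hδ
      linarith

theorem ratio_le_of_min {ε : ℝ} (hX : X.goal = .min) (hε : 0 ≤ ε) (h : X.IsInstance D P)
    (hy : y ∈ X.sol D P) (habs : |X.opt D P - X.measure D P y| ≤ ε * X.opt D P) :
    X.ratio D P y ≤ 1 + ε := by
  have ho := opt_pos h
  have hle : X.opt D P ≤ X.measure D P y := (isLeast_opt hX h).2 ⟨y, hy, rfl⟩
  refine max_le ?_ ?_
  · rw [div_le_iff₀ ho]
    linarith [neg_abs_le (X.opt D P - X.measure D P y)]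
  · linarith [div_le_one_of_le₀ hle (ho.trans_le hle).le]

theorem ratio_le_of_max {ε : ℝ} (hX : X.goal = .max) (hε : 0 ≤ ε) (hε₁ : ε < 1)
    (h : X.IsInstance D P) (hy : y ∈ X.sol D P)
    (habs : |X.opt D P - X.measure D P y| ≤ ε * X.opt D P) :
    X.ratio D P y ≤ 1 + ε / (1 - ε) := by
  have ho := opt_pos h
  have hm := X.measure_pos D P h y hy
  have hle : X.measure D P y ≤ X.opt D P := (isGreatest_opt hX h).2 ⟨y, hy, rfl⟩
  have hε₂ : 0 < 1 - ε := by linarith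
  refine max_le ?_ ?_
  · linarith [div_le_one_of_le₀ hle ho.le, div_nonneg hε hε₂.le]
  · have : 1 + ε / (1 - ε) = 1 / (1 - ε) := by field_simp; ring
    rw [this, div_le_div_iff₀ hm hε₂]
    linarith [le_abs_self (X.opt D P - X.measure D P y)]

end OptProblem

/-! ### Transfer of approximation algorithms -/

/-- An approximation algorithm for the target of an L-reduction yields a pseudo-sublinear-time
algorithm for its source, with a bound on the absolute error. -/
theorem PsTLReducible.exists_algorithm {S₁ S₂ : Type} [Fintype S₁] [Fintype S₂]
    {P₁ : OptProblem S₁} {P₂ : OptProblem S₂} {α β δ : ℝ} (hβ : 0 ≤ β) (hδ : 0 ≤ δ)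
    (hred : PsTLReducible P₁ P₂ α β) (happrox : P₂.HasPsTApprox (1 + δ)) :
    ∃ (E : Type) (_ : Fintype E) (Pi : List S₁ → List E) (M : RATM E S₁ S₁) (t : ℕ → ℕ),
      PTimeComputable Pi ∧ IsSublinear t ∧
        ∀ D P, P₁.IsInstance D P → ∃ y ∈ P₁.sol D P, M.OutputsWithin (Pi D) P y (t D.length) ∧
          |P₁.opt D P - P₁.measure D P y| ≤ α * β * δ * P₁.opt D P := by
  obtain ⟨A, _, f₁, f₂, g, h, hf₁, hl₁, hf₂, hl₂, hg, hh, hinst⟩ := hred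
  obtain ⟨Eg, _, Pg, Mg, tg, hPg, htg, hMg⟩ := hg
  obtain ⟨Eh, _, Ph, Mh, th, hPh, hth, hMh⟩ := hh
  obtain ⟨E₂, _, Pi₂, M₂, t₂, hP₂, ht₂, hM₂⟩ := happrox
  obtain ⟨c₁, hc₁⟩ := id hl₁
  obtain ⟨c₂, hc₂⟩ := id hl₂
  -- The nesting of the tracks follows that of the composed machines.
  refine ⟨_, inferInstance, fun D => zipOpt (zipOpt (Pg (f₂ D)) (Pi₂ (f₁ D))) (Ph (f₂ D)),
    (Mg.comp M₂).comp Mh,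
    fun n => 4 * (4 * maxTime tg c₂ n + maxTime t₂ c₁ n + 6) + maxTime th c₂ n + 6, ?_, ?_, ?_⟩
  · exact (((hf₂.polyTimeOn_comp hl₂ hPg).zipOpt (hf₁.polyTimeOn_comp hl₁ hP₂)).zipOpt
      (hf₂.polyTimeOn_comp hl₂ hPh)).pTimeComputable
  · exact ((((((htg.maxTime c₂).const_mul 4).add (ht₂.maxTime c₁)).add
      (isSublinear_const 6)).const_mul 4).add (hth.maxTime c₂)).add (isSublinear_const 6)
  · intro D P hP
    obtain ⟨hP', hα, hsol⟩ := hinst D P hP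
    obtain ⟨y, hy, hout, hr⟩ := hM₂ _ _ hP'
    obtain ⟨hy', herr⟩ := hsol y hy
    refine ⟨_, hy', RATM.OutputsWithin.comp (RATM.OutputsWithin.comp
      ((hMg (f₂ D) P).mono (le_maxTime (hc₂ D))) (hout.mono (le_maxTime (hc₁ D))))
      ((hMh (f₂ D) y).mono (le_maxTime (hc₂ D))), ?_⟩
    calc _ ≤ β * |P₂.opt (f₁ D) (g (f₂ D) P) - P₂.measure (f₁ D) (g (f₂ D) P) y| := herr
      _ ≤ β * (δ * (α * P₁.opt D P)) := by
          gcongr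
          exact (OptProblem.abs_opt_sub_measure_le hδ hP' hy hr).trans (by gcongr)
      _ = α * β * δ * P₁.opt D P := by ring

end SublinearTime

theorem theorem11 {S₁ S₂ : Type} [Fintype S₁] [Fintype S₂]
    (P₁ : SublinearTime.OptProblem S₁) (P₂ : SublinearTime.OptProblem S₂)
    (α β δ : ℝ) (hα : 0 ≤ α) (hβ : 0 ≤ β) (hδ : 0 ≤ δ)
    (hred : SublinearTime.PsTLReducible P₁ P₂ α β)
    (happrox : P₂.HasPsTApprox (1 + δ)) :
    (P₁.goal = SublinearTime.Goal.min → P₁.HasPsTApprox (1 + α * β * δ)) ∧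
    (P₁.goal = SublinearTime.Goal.max → α * β * δ < 1 →
      P₁.HasPsTApprox (1 + α * β * δ / (1 - α * β * δ))) := by
  have hε : 0 ≤ α * β * δ := by positivity
  -- One algorithm serves both goals; only the passage from the absolute error to the ratio differs.
  obtain ⟨E, hE, Pi, M, t, hPi, ht, halg⟩ := hred.exists_algorithm hβ hδ happrox
  constructor
  · refine fun hgoal => ⟨E, hE, Pi, M, t, hPi, ht, fun D P hP => ?_⟩
    obtain ⟨y, hy, hout, habs⟩ := halg D P hP
    exact ⟨y, hy, hout, SublinearTime.OptProblem.ratio_le_of_min hgoal hε hP hy habs⟩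
  · refine fun hgoal hlt => ⟨E, hE, Pi, M, t, hPi, ht, fun D P hP => ?_⟩
    obtain ⟨y, hy, hout, habs⟩ := halg D P hP
    exact ⟨y, hy, hout, SublinearTime.OptProblem.ratio_le_of_max hgoal hε hlt hP hy habs⟩
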